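/- Let $\mathbb K$ be a field of characteristic $0$, $n\ge 1$, and let $f\in\mathbb K[X_1,\dots,X_n]$ be a nonzero polynomial with exactly $k$ nonzero terms and total degree $D$, given in lacunary representation (the list of its nonzero terms, each a coefficient together with an exponent vector). Let $d_1,\dots,d_n$ be positive integers and $d=\max_i d_i$. The Newton polytope $\mathrm{Newt}(g)$ of a polynomial $g$ is the convex hull of the exponent vectors of its nonzero terms, and $g$ is called multidimensional if $\dim\mathrm{Newt}(g)\ge 2$. $\mathrm{mult}_g(f)$ is the largest integer $\mu$ such that $g^\mu$ divides $f$. For $h\ne0$ let $h^\circ=h/(X_1^{v_1}\cdots X_n^{v_n})$, where $v_i$ is the smallest exponent of $X_i$ in a term of $h$. A partition of $f$ is an expression $f=f_1+\dots+f_s$ obtained by distributing the terms of $f$ among $s$ disjoint nonempty sets. The algorithm UnivariatePartition$(h,\delta,i)$ sorts the terms of $h$ by their exponent of $X_i$ (by radix sort) and cuts the sorted list between any two consecutive terms whose exponents of $X_i$ differ by more than $\delta$; its result is the set of the resulting summands of $h$. The algorithm MultivariatePartition$(f,d_1,\dots,d_n)$ starts with $\mathcal S=\{f\}$ and sweeps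 over $i=1,\dots,n$; for each $i$ it replaces each $h\in\mathcal S$, with $\ell$ terms say, by the elements of UnivariatePartition$(h,\delta,i)$, where $M_i=\max_{i'\ne i}d_{i'}$ (with $M_1=0$ if $n=1$) and $\delta=4(\ell-1)^2d_i^2M_i^2$. It repeats these sweeps as long as the preceding sweep has increased $|\mathcal S|$, and finally outputs the polynomials $h^\circ$ for $h\in\mathcal S$. Theorem. There is an absolute constant $C$ such that, for all $\mathbb K,n,f,d_1,\dots,d_n$ as above, MultivariatePartition$(f,d_1,\dots,d_n)$ terminates after at most $C\,n\,k^2\log(D+2)$ steps and outputs polynomials $f_1^\circ,\dots,f_s^\circ$ for some partition $f=f_1+\dots+f_s$ of $f$, such that 1. each $f_t^\circ$ has degree at most $C\,d^4k^3$ in every variable; 2. for every multidimensional $g\in\mathbb K[X_1,\dots,X_n]$ with $\deg_{X_i}(g)\le d_i$ for all $i$ and all of whose irreducible factors are multidimensional (in particular, for every irreducible multidimensional such $g$), $$\mathrm{mult}_g(f)=\min_{1\le t\le s}\mathrm{mult}_g(f_t)=\min_{1\le t\le s}\mathrm{mult}_g(f_t^\circ).$$ Steps are counted as follows: list operations, array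 accesses and the inspection of one bit of an integer take one step each, up to constant factors; an addition, subtraction or multiplication of integers takes as many steps as its operands have bits in total (logarithmic cost); a comparison takes as many steps as the shorter of the two integers has bits. The numbers $d_i$ are replaced by $\min(d_i,D)$ before the thresholds $\delta$ are computed, which does not affect the outcome of any comparison. -/

import Mathlib

namespace Sparse

/-! ### Step counting -/

/-- A value together with the number of elementary steps spent on computing it. -/
structure Timed (α : Type*) where
  val : α
  cost : ℕ

def ret {α : Type*} (a : α) : Timed α := ⟨a, 0⟩

/-- Run `x`, then run `f` on its value; the costs add up. -/
def Timed.bind {α β : Type*} (x : Timed α) (f : α → Timed β) : Timed β :=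
  ⟨(f x.val).val, x.cost + (f x.val).cost⟩

/-- Charge one elementary step (list operations) on top of the cost of `x`. -/
def tick {α : Type*} (x : Timed α) : Timed α := ⟨x.val, x.cost + 1⟩

/-! Integer operations. An arithmetic operation costs the total bit length of its operands
(logarithmic cost). A comparison reads both integers in parallel from the lowest bit on and stops
where the shorter one ends. -/

def natAdd (a b : ℕ) : Timed ℕ := ⟨a + b, a.size + b.size + 1⟩

def natSub (a b : ℕ) : Timed ℕ := ⟨a - b, a.size + b.size + 1⟩

def natMul (a b : ℕ) : Timed ℕ := ⟨a * b, a.size + b.size + 1⟩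

def natLT (a b : ℕ) : Timed Bool := ⟨decide (a < b), min a.size b.size + 1⟩

def natMin (a b : ℕ) : Timed ℕ := ⟨min a b, min a.size b.size + 1⟩

def natMax (a b : ℕ) : Timed ℕ := ⟨max a b, min a.size b.size + 1⟩

def bitLength (a : ℕ) : Timed ℕ := ⟨a.size, a.size + 1⟩

def bitAt (a b : ℕ) : Timed Bool := ⟨a.testBit b, 1⟩

/-- Fill an array of length `n`, one entry after the other. -/
def fillArray {α : Type*} {n : ℕ} (c : Fin n → Timed α) : Timed (Fin n → α) :=
  ⟨fun i => (c i).val, ∑ i, ((c i).cost + 1)⟩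

def count {α : Type*} : List α → Timed ℕ
  | [] => tick <| ret 0
  | _ :: l => tick <|
    (count l).bind fun c =>
    ret (c + 1)

def concat {α : Type*} : List α → List α → Timed (List α)
  | [], r => tick <| ret r
  | a :: l, r => tick <|
    (concat l r).bind fun s =>
    ret (a :: s)

/-! ### Polynomials in lacunary representation -/

/-- A term `coeff * X ^ exp` in `n` variables; the exponent vector is an array. -/
structure SparseTerm (K : Type*) (n : ℕ) where
  coeff : K
  exp : Fin n → ℕ

/-- `l` lists the nonzero terms of `f`, each exactly once, in any order. -/
def IsLacunaryRep {K : Type*} [Field K] {n : ℕ} (l : List (SparseTerm K n))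
    (f : MvPolynomial (Fin n) K) : Prop :=
  (∀ t ∈ l, t.coeff ≠ 0) ∧ (l.map SparseTerm.exp).Nodup ∧
    (l.map fun t => MvPolynomial.monomial (Finsupp.equivFunOnFinite.symm t.exp) t.coeff).sum = f

/-! ### The algorithm -/

section Algorithm

variable {K : Type*} {n : ℕ}

/-- Largest exponent of the `i`-th variable. -/
def maxExponent (i : Fin n) : List (SparseTerm K n) → Timed ℕ
  | [] => tick <| ret 0
  | t :: l => tick <|
    (maxExponent i l).bind fun m =>
    natMax (t.exp i) m

/-- Separate, keeping the order, the terms whose exponent of the `i`-th variable has the bit `b`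
equal to zero from those where it is one. -/
def splitBit (i : Fin n) (b : ℕ) :
    List (SparseTerm K n) → Timed (List (SparseTerm K n) × List (SparseTerm K n))
  | [] => tick <| ret ([], [])
  | t :: l => tick <|
    (splitBit i b l).bind fun s =>
    (bitAt (t.exp i) b).bind fun c =>
    ret (if c then (s.1, t :: s.2) else (t :: s.1, s.2))

/-- Radix sort with respect to the bits `b, b + 1, …, b + m - 1`. -/
def radixSort (i : Fin n) (b : ℕ) : ℕ → List (SparseTerm K n) → Timed (List (SparseTerm K n))
  | 0, h => ret h
  | m + 1, h =>
    (splitBit i b h).bind fun s =>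
    (concat s.1 s.2).bind fun h' =>
    radixSort i (b + 1) m h'

/-- Cut a sorted list of terms between any two consecutive terms whose exponents of the `i`-th
variable differ by more than `δ`. -/
def cutAtGaps (i : Fin n) (δ : ℕ) : List (SparseTerm K n) → Timed (List (List (SparseTerm K n)))
  | [] => tick <| ret []
  | [t] => tick <| ret [[t]]
  | t :: u :: l => tick <|
    (natSub (u.exp i) (t.exp i)).bind fun gap =>
    (natLT δ gap).bind fun c =>
    (cutAtGaps i δ (u :: l)).bind fun r =>
    ret (if c then [t] :: r else
      match r with
      | [] => [[t]]
      | p :: ps => (t :: p) :: ps)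

def univariatePartition (h : List (SparseTerm K n)) (δ : ℕ) (i : Fin n) :
    Timed (List (List (SparseTerm K n))) :=
  (maxExponent i h).bind fun e =>
  (bitLength e).bind fun m =>
  (radixSort i 0 m h).bind fun h' =>
  cutAtGaps i δ h'

/-- `γ(k) * dX * dY`, where `γ(k) = 4 * dX * dY * (k - 1) ^ 2`. -/
def threshold (k dX dY : ℕ) : Timed ℕ :=
  (natSub k 1).bind fun j =>
  (natMul j j).bind fun j2 =>
  (natMul dX dY).bind fun e =>
  (natMul 4 e).bind fun e4 =>
  (natMul e4 j2).bind fun γ =>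
  natMul γ e

def sumEntries (e : Fin n → ℕ) : List (Fin n) → Timed ℕ
  | [] => tick <| ret 0
  | i :: is => tick <|
    (sumEntries e is).bind fun s =>
    natAdd (e i) s

/-- The total degree. -/
def totalDegreeOf : List (SparseTerm K n) → Timed ℕ
  | [] => tick <| ret 0
  | t :: l => tick <|
    (totalDegreeOf l).bind fun m =>
    (sumEntries t.exp (List.finRange n)).bind fun s =>
    natMax s m

/-- The table of all `(i, d i, max_{i' ≠ i} d i')`, computed with prefix and suffix maxima, with
each `d i` replaced by `min (d i) D`. `pre` is the maximum over the indices already passed; the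
second component of the result is the maximum over the indices in the list. As `D` will be the total
degree of the input, this cap does not affect any comparison of a difference of exponents with a
threshold: see `threshold_cap`. -/
def boundTable (D : ℕ) (d : Fin n → ℕ) (pre : ℕ) :
    List (Fin n) → Timed (List (Fin n × ℕ × ℕ) × ℕ)
  | [] => tick <| ret ([], 0)
  | i :: is => tick <|
    (natMin (d i) D).bind fun c =>
    (natMax pre c).bind fun pre' =>
    (boundTable D d pre' is).bind fun r =>
    (natMax pre r.2).bind fun others =>
    (natMax c r.2).bind fun suf =>
    ret ((i, c, others) :: r.1, suf)

/-- Replace each `h` of `S` by the summands of its univariate partition in the variable `i`, where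
`di` and `others` stand for `d i` and `max_{i' ≠ i} d i'`. -/
def refineAll (i : Fin n) (di others : ℕ) :
    List (List (SparseTerm K n)) → Timed (List (List (SparseTerm K n)))
  | [] => tick <| ret []
  | h :: S => tick <|
    (count h).bind fun k =>
    (threshold k others di).bind fun δ =>
    (univariatePartition h δ i).bind fun Sh =>
    (refineAll i di others S).bind fun R =>
    concat Sh R

/-- The `for` loop over all variables. -/
def sweep : List (Fin n × ℕ × ℕ) → List (List (SparseTerm K n)) →
    Timed (List (List (SparseTerm K n)))
  | [], S => tick <| ret S
  | b :: bs, S => tick <|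
    (refineAll b.1 b.2.1 b.2.2 S).bind fun S' =>
    sweep bs S'

/-- The `while s < |S|` loop; the result is `none` if the condition has been evaluated `fuel` times
and the loop is still not over. -/
def whileLoop (bs : List (Fin n × ℕ × ℕ)) : ℕ → ℕ → List (List (SparseTerm K n)) →
    Timed (Option (List (List (SparseTerm K n))))
  | 0, _, _ => ret none
  | fuel + 1, s, S =>
    (count S).bind fun c =>
    (natLT s c).bind fun b =>
    if b then
      (sweep bs S).bind fun S' =>
      whileLoop bs fuel c S'
    else ret (some S)

/-- Componentwise minimum of `v` and all exponent vectors. -/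
def minExponents (v : Fin n → ℕ) : List (SparseTerm K n) → Timed (Fin n → ℕ)
  | [] => tick <| ret v
  | t :: l => tick <|
    (fillArray fun i => natMin (v i) (t.exp i)).bind fun v' =>
    minExponents v' l

def shiftExponents (v : Fin n → ℕ) : List (SparseTerm K n) → Timed (List (SparseTerm K n))
  | [] => tick <| ret []
  | t :: l => tick <|
    (fillArray fun i => natSub (t.exp i) (v i)).bind fun e =>
    (shiftExponents v l).bind fun r =>
    ret (⟨t.coeff, e⟩ :: r)

/-- `h ↦ h / X ^ mval(h)`. -/
def removeMonomial : List (SparseTerm K n) → Timed (List (SparseTerm K n))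
  | [] => tick <| ret []
  | t :: l => tick <|
    (minExponents t.exp l).bind fun v =>
    shiftExponents v (t :: l)

def removeMonomials :
    List (List (SparseTerm K n)) → Timed (List (List (SparseTerm K n)))
  | [] => tick <| ret []
  | h :: S => tick <|
    (removeMonomial h).bind fun h' =>
    (removeMonomials S).bind fun R =>
    ret (h' :: R)

/-- The algorithm MultivariatePartition. The result is `none` only if the `while` loop has not
stopped when its condition has been evaluated `fuel` times. -/
def multivariatePartition (fuel : ℕ) (f : List (SparseTerm K n)) (d : Fin n → ℕ) :
    Timed (Option (List (List (SparseTerm K n)))) :=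
  (totalDegreeOf f).bind fun D =>
  (boundTable D d 0 (List.finRange n)).bind fun bs =>
  (whileLoop bs.1 fuel 0 [f]).bind fun r =>
  match r with
  | none => ret none
  | some S =>
    (removeMonomials S).bind fun out =>
    ret (some out)

end Algorithm

/-- Capping the degree bounds at `D` does not change the comparison of the threshold with a
difference of exponents, which is at most `D`. -/
theorem threshold_cap (k dX dY D x : ℕ) (hx : x ≤ D) :
    (threshold k (min dX D) (min dY D)).val < x ↔ (threshold k dX dY).val < x := by
  change 4 * (min dX D * min dY D) * ((k - 1) * (k - 1)) * (min dX D * min dY D) < x ↔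
    4 * (dX * dY) * ((k - 1) * (k - 1)) * (dX * dY) < x
  by_cases h : dX ≤ D ∧ dY ≤ D
  · rw [min_eq_left h.1, min_eq_left h.2]
  rcases Nat.eq_zero_or_pos dX with h1 | h1
  · simp [h1]
  rcases Nat.eq_zero_or_pos dY with h2 | h2
  · simp [h2]
  rcases Nat.eq_zero_or_pos (k - 1) with h3 | h3
  · simp [h3]
  rcases Nat.eq_zero_or_pos D with h4 | h4
  · have : x = 0 := by omega
    simp [this]
  have key : ∀ a b : ℕ, 0 < a → 0 < b → (D ≤ a ∨ D ≤ b) →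
      ¬ 4 * (a * b) * ((k - 1) * (k - 1)) * (a * b) < x := by
    intro a b ha hb hD hlt
    have hab : D ≤ a * b := by
      rcases hD with hD | hD
      · exact hD.trans (Nat.le_mul_of_pos_right a hb)
      · exact hD.trans (Nat.le_mul_of_pos_left b ha)
    have hpos : 0 < 4 * (a * b) * ((k - 1) * (k - 1)) := by positivity
    have := Nat.le_mul_of_pos_left (a * b) hpos
    omega
  refine iff_of_false (key _ _ (lt_min h1 h4) (lt_min h2 h4) ?_) (key _ _ h1 h2 ?_)
  · rcases not_and_or.mp h with h | h
    · left; exact le_min (by omega) le_rfl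
    · right; exact le_min (by omega) le_rfl
  · omega

/-! ### Newton polytopes and partitions -/

section Polynomials

variable {K : Type*} [Field K] {n : ℕ}

/-- The convex hull of the support. -/
def newtonPolytope (f : MvPolynomial (Fin n) K) : Set (Fin n → ℝ) :=
  convexHull ℝ ((fun (a : Fin n →₀ ℕ) (i : Fin n) => (a i : ℝ)) '' (f.support : Set (Fin n →₀ ℕ)))

/-- The Newton polytope has dimension at least two. -/
def IsMultidimensional (f : MvPolynomial (Fin n) K) : Prop :=
  2 ≤ Module.finrank ℝ (vectorSpan ℝ (newtonPolytope f))

/-- The nonzero polynomials in `p` arise by distributing the terms of `f` among disjoint sets. -/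
def IsPartition (f : MvPolynomial (Fin n) K) (p : List (MvPolynomial (Fin n) K)) : Prop :=
  (∀ h ∈ p, h ≠ 0) ∧ p.Pairwise (fun h h' => Disjoint h.support h'.support) ∧ p.sum = f

/-- The vector of the valuations of `h` with respect to each of the variables. -/
noncomputable def multivaluation (h : MvPolynomial (Fin n) K) : Fin n →₀ ℕ :=
  Finsupp.equivFunOnFinite.symm
    fun i => sInf ((fun a : Fin n →₀ ℕ => a i) '' (h.support : Set (Fin n →₀ ℕ)))

/-- `h / X ^ mval(h)`. -/
noncomputable def normalized (h : MvPolynomial (Fin n) K) : MvPolynomial (Fin n) K :=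
  h.divMonomial (multivaluation h)

end Polynomials

end Sparse

/-! ### Wronskians and extension of derivations -/

open MvPolynomial

/-! The heart is a gap theorem, `dvd_lowPart`. Let q be irreducible and multidimensional, of
positive degree in X_i, and let q divide a polynomial F with at most ℓ terms. If no exponent of X_i
in F lies in a window above α of length (ℓ-1)(ℓ-2) deg_i q, then q divides the sum of the terms with
exponent at most α. Hence cutting F at a gap loses no such factor.

To prove it, work in the function field L of q = 0, where F becomes a linear relation between
monomials. Multidimensionality supplies a second variable X_j for which q is planar. Write θ for X
∂/∂X. The derivation (θ_j q) θ_i - (θ_i q) θ_j kills q, so it induces a derivation D of L. Relations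
with D-constant coefficients decompose into minimal ones (`sum_filter_eq_zero_of_circuits`), so it
suffices that a minimal relation never straddles the gap. In a minimal relation the Wronskian of all
monomials but one is nonzero, and Cramer's rule (`exists_monomial_relation`) gives c X^μ U = X^ν V
with c a D-constant and U, V of controlled degree. By `isAlgebraic_of_deriv_eq_zero`, c is algebraic
over the variables other than X_i and X_j.

It remains to bound μ_i - ν_i. Choose a weight on X_i, X_j for which μ and ν weigh the same, and
substitute X_k s^(wt k) for X_k, where s runs through the roots in the algebraic closure of K(X) of
the equation obtained from q. Each substitution has kernel (q), so it extends to L, and the powers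
of s coming from X^μ and X^ν cancel. The product over all s turns U and V into resultants whose
degrees in X_i are bounded by the Sylvester matrix, while c becomes algebraic over the variables
other than X_i and so cannot affect the comparison of degrees in X_i. This is
`exponent_le_of_monomial_relation`.

Powers of q reduce to q itself: θ_j commutes with cutting, does not enlarge supports, and θ_j q is
not divisible by q, so the order of vanishing along q is read off from the iterates of θ_j. Products
are treated one prime power at a time; a factor free of X_i survives any cut in X_i trivially.

For the algorithm, the thresholds dominate the gap bound, so divisibility by each power of g is an
invariant of the loop; conversely, a power dividing all pieces divides their sum. Every sweep but
the last increases the number of pieces, which is at most k, so there are at most k sweeps, each of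
cost O(n k log(D + 2)). A last sweep without effect shows that within each piece consecutive
exponents differ by at most the threshold, which bounds the degrees after the monomial content is
removed. -/

theorem exists_constant_relation_of_det_eq_zero {L : Type*} [Field L] (D : Derivation ℤ L L) :
    ∀ (r : ℕ) (v : Fin r → L), (Matrix.of fun i j : Fin r => D^[i] (v j)).det = 0 →
      ∃ c : Fin r → L, (∀ j, D (c j) = 0) ∧ c ≠ 0 ∧ ∑ j, c j * v j = 0
  | 0, v, h => by simp at h
  | r + 1, v, h => by
    -- If the minor of the first r functions vanishes, induction applies; otherwise it is invertible
    -- and the kernel vector can be normalised.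
    let N : Matrix (Fin r) (Fin r) L := Matrix.of fun i j : Fin r => D^[i] (v j.castSucc)
    by_cases hN : N.det = 0
    · obtain ⟨c, hc, hc0, hs⟩ := exists_constant_relation_of_det_eq_zero D r _ hN
      refine ⟨Fin.snoc c 0, fun j => ?_, fun h0 => hc0 ?_, ?_⟩
      · induction j using Fin.lastCases <;> simp [hc]
      · funext j
        simpa using congrFun h0 j.castSucc
      · simpa [Fin.sum_univ_castSucc] using hs
    have hinj : ∀ b : Fin r → L, (∀ i : Fin r, ∑ j, D^[i] (v j.castSucc) * b j = 0) → b = 0 := by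
      intro b hb
      by_contra hb0
      exact hN (Matrix.exists_mulVec_eq_zero_iff.mp ⟨b, hb0, funext fun i => hb i⟩)
    obtain ⟨b, hb0, hb⟩ := Matrix.exists_mulVec_eq_zero_iff.mpr h
    have hrow : ∀ i : Fin (r + 1), ∑ j, D^[i] (v j) * b j = 0 := fun i => congrFun hb i
    have hlast : b (Fin.last r) ≠ 0 := by
      intro hl
      have h1 := hinj (fun j => b j.castSucc) fun i => by
        simpa [Fin.sum_univ_castSucc, hl] using hrow i.castSucc
      refine hb0 (funext fun j => ?_)
      induction j using Fin.lastCases with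
      | last => exact hl
      | cast j => exact congrFun h1 j
    let c : Fin (r + 1) → L := fun j => b j / b (Fin.last r)
    have hc : ∀ i : Fin (r + 1), ∑ j, D^[i] (v j) * c j = 0 := by
      intro i
      have := hrow i
      simp only [c, mul_div_assoc', ← Finset.sum_div, this, zero_div]
    have hcl : c (Fin.last r) = 1 := div_self hlast
    -- With last entry 1, differentiating row i and subtracting row i + 1 leaves the derivatives of
    -- the other entries as a solution of the invertible system.
    have hDc : (fun j : Fin r => D (c j.castSucc)) = 0 := by
      refine hinj _ fun i => ?_
      have h1 : D (∑ j, D^[i] (v j) * c j) = 0 := by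
        have := hc i.castSucc
        simp only [Fin.val_castSucc] at this
        rw [this, map_zero]
      have h2 := hc i.succ
      rw [map_sum] at h1
      simp only [Derivation.leibniz, smul_eq_mul, Finset.sum_add_distrib] at h1
      have h3 : ∑ j, c j * D (D^[i] (v j)) = 0 := by
        rw [← h2]
        refine Finset.sum_congr rfl fun j _ => ?_
        rw [Fin.val_succ, Function.iterate_succ_apply', mul_comm]
      rw [h3, add_zero, Fin.sum_univ_castSucc, hcl] at h1
      simpa using h1
    refine ⟨c, fun j => ?_, fun h0 => ?_, ?_⟩
    · induction j using Fin.lastCases with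
      | last => rw [hcl]; simp
      | cast j => exact congrFun hDc j
    · have := congrFun h0 (Fin.last r)
      rw [hcl] at this
      exact one_ne_zero this
    · have := hc 0
      simpa [mul_comm] using this

/-- A derivation of a domain extends to the field of fractions. -/
theorem exists_derivation_extension {A L : Type*} [CommRing A] [IsDomain A] [Field L]
    [Algebra A L] [IsFractionRing A L] (d : Derivation ℤ A A) :
    ∃ D : Derivation ℤ L L, ∀ a, D (algebraMap A L a) = algebraMap A L (d a) := by
  have hs : ∀ (x : A) (y : L), x • y = algebraMap A L x * y := fun x y => Algebra.smul_def x y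
  -- A derivation is the same as a ring homomorphism a ↦ a + ε d(a) into the dual numbers, and
  -- homomorphisms extend to the localization because units are detected on the first component.
  let f : A →+* TrivSqZeroExt L L :=
    { toFun := fun a => TrivSqZeroExt.inl (algebraMap A L a) +
        TrivSqZeroExt.inr (algebraMap A L (d a))
      map_one' := by ext <;> simp
      map_zero' := by ext <;> simp
      map_mul' := fun a b => by ext <;> simp [hs]; ring
      map_add' := fun a b => by ext <;> simp [hs] }
  have hf : ∀ y : nonZeroDivisors A, IsUnit (f y) := by
    intro y
    rw [TrivSqZeroExt.isUnit_iff_isUnit_fst]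
    have : algebraMap A L y ≠ 0 := by
      simp
    simp [f]
  let g : L →+* TrivSqZeroExt L L := IsLocalization.lift hf
  have hg : ∀ a, g (algebraMap A L a) = f a := fun a => IsLocalization.lift_eq hf a
  have hfst : ∀ x, (g x).fst = x := by
    have : ((TrivSqZeroExt.fstHom ℤ L L).toRingHom.comp g) = RingHom.id L := by
      refine IsLocalization.ringHom_ext (nonZeroDivisors A) ?_
      ext a
      simp [hg, f]
    exact fun x => RingHom.congr_fun this x
  refine ⟨Derivation.mk' ((TrivSqZeroExt.sndHom L L).toAddMonoidHom.comp
    g.toAddMonoidHom).toIntLinearMap fun a b => ?_, fun a => ?_⟩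
  · simp [hfst, mul_comm b]
  · simp [hg, f, hs]

/-! ### Euler derivations and the tangent derivation -/

section Euler
variable {σ K : Type*} [Field K]

/-- `X_i ∂/∂X_i`. -/
noncomputable def eulerDeriv (i : σ) : Derivation K (MvPolynomial σ K) (MvPolynomial σ K) :=
  (X i : MvPolynomial σ K) • pderiv i

theorem eulerDeriv_monomial (i : σ) (m : σ →₀ ℕ) (r : K) :
    eulerDeriv i (monomial m r) = monomial m ((m i : K) * r) := by
  simp only [eulerDeriv, Derivation.smul_apply, smul_eq_mul, X_mul_pderiv_monomial]
  rw [← map_nsmul, nsmul_eq_mul]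

theorem coeff_eulerDeriv (i : σ) (m : σ →₀ ℕ) (G : MvPolynomial σ K) :
    coeff m (eulerDeriv i G) = (m i : K) * coeff m G := by
  classical
  induction G using MvPolynomial.induction_on' with
  | monomial u a =>
    rw [eulerDeriv_monomial, coeff_monomial, coeff_monomial]
    split_ifs with h
    · rw [h]
    · simp
  | add p q hp hq => rw [map_add, coeff_add, coeff_add, hp, hq, mul_add]

/-- This is why Euler derivations are preferred to partial derivatives: they respect term counts,
gaps, degrees and weights. -/
theorem support_eulerDeriv_subset (i : σ) (G : MvPolynomial σ K) :
    (eulerDeriv i G).support ⊆ G.support := by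
  intro m hm
  rw [mem_support_iff, coeff_eulerDeriv] at hm
  exact mem_support_iff.mpr (right_ne_zero_of_mul hm)

/-- The derivation tangent to the hypersurface `q = 0`. -/
noncomputable def tangentDeriv (q : MvPolynomial σ K) (i j : σ) :
    Derivation K (MvPolynomial σ K) (MvPolynomial σ K) :=
  eulerDeriv j q • eulerDeriv i - eulerDeriv i q • eulerDeriv j

theorem tangentDeriv_apply (q : MvPolynomial σ K) (i j : σ) (G : MvPolynomial σ K) :
    tangentDeriv q i j G = eulerDeriv j q * eulerDeriv i G - eulerDeriv i q * eulerDeriv j G := rfl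

/-- This makes the ideal (q) stable, so that the derivation descends to the function field of q = 0.
-/
theorem tangentDeriv_self (q : MvPolynomial σ K) (i j : σ) : tangentDeriv q i j q = 0 := by
  rw [tangentDeriv_apply]; ring

/-- The logarithmic derivative of `X ^ m`. -/
noncomputable def tangentLog (q : MvPolynomial σ K) (i j : σ) (m : σ →₀ ℕ) : MvPolynomial σ K :=
  C (m i : K) * eulerDeriv j q - C (m j : K) * eulerDeriv i q

theorem tangentDeriv_monomial (q : MvPolynomial σ K) (i j : σ) (m : σ →₀ ℕ) :
    tangentDeriv q i j (monomial m 1) = tangentLog q i j m * monomial m 1 := by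
  rw [tangentDeriv_apply, eulerDeriv_monomial, eulerDeriv_monomial, tangentLog,
    ← C_mul_monomial (a := (m i : K)), ← C_mul_monomial (a := (m j : K))]
  ring

/-- The `r`-th derivative of `X ^ m` divided by `X ^ m`. -/
noncomputable def tangentRatio (q : MvPolynomial σ K) (i j : σ) (m : σ →₀ ℕ) :
    ℕ → MvPolynomial σ K
  | 0 => 1
  | r + 1 => tangentDeriv q i j (tangentRatio q i j m r) +
      tangentLog q i j m * tangentRatio q i j m r

theorem iterate_tangentDeriv_monomial (q : MvPolynomial σ K) (i j : σ) (m : σ →₀ ℕ) (r : ℕ) :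
    (tangentDeriv q i j)^[r] (monomial m 1) = tangentRatio q i j m r * monomial m 1 := by
  induction r with
  | zero => simp [tangentRatio]
  | succ r ih =>
    rw [Function.iterate_succ_apply', ih, Derivation.leibniz, tangentDeriv_monomial, tangentRatio]
    simp only [smul_eq_mul]
    ring

end Euler

/-! ### Bookkeeping of degrees and weights -/

section Box
variable {σ K : Type*} [Field K]

/-- Exponent vectors whose `i`-th entry is at most `N * e` and whose weight is between `N * lo` and
`N * hi`. -/
def weightBox (wt : σ → ℤ) (i : σ) (e : ℕ) (lo hi : ℤ) (N : ℕ) : Set (σ →₀ ℕ) :=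
  {m | m i ≤ N * e ∧ N * lo ≤ Finsupp.weight wt m ∧ Finsupp.weight wt m ≤ N * hi}

variable {wt : σ → ℤ} {i : σ} {e : ℕ} {lo hi : ℤ}

theorem mul_mem_weightBox {N M : ℕ} {F G : MvPolynomial σ K}
    (hF : F ∈ restrictSupport K (weightBox wt i e lo hi N))
    (hG : G ∈ restrictSupport K (weightBox wt i e lo hi M)) :
    F * G ∈ restrictSupport K (weightBox wt i e lo hi (N + M)) := by
  classical
  rw [mem_restrictSupport_iff] at *
  intro m hm
  obtain ⟨a, ha, b, hb, rfl⟩ := Finset.mem_add.mp (support_mul F G hm)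
  obtain ⟨h1, h2, h3⟩ := hF ha
  obtain ⟨h4, h5, h6⟩ := hG hb
  refine ⟨?_, ?_, ?_⟩
  · rw [Finsupp.add_apply, add_mul]; omega
  · rw [map_add]; push_cast; linarith
  · rw [map_add]; push_cast; linarith

theorem one_mem_weightBox :
    (1 : MvPolynomial σ K) ∈ restrictSupport K (weightBox wt i e lo hi 0) := by
  rw [← C_1, ← monomial_zero', monomial_mem_restrictSupport]
  left
  simp [weightBox]

theorem prod_mem_weightBox {ι : Type*} (s : Finset ι) (N : ι → ℕ) (F : ι → MvPolynomial σ K)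
    (hF : ∀ t ∈ s, F t ∈ restrictSupport K (weightBox wt i e lo hi (N t))) :
    ∏ t ∈ s, F t ∈ restrictSupport K (weightBox wt i e lo hi (∑ t ∈ s, N t)) := by
  classical
  induction s using Finset.induction_on with
  | empty => simpa using one_mem_weightBox
  | insert a s ha ih =>
    rw [Finset.prod_insert ha, Finset.sum_insert ha]
    exact mul_mem_weightBox (hF a (Finset.mem_insert_self _ _))
      (ih fun t ht => hF t (Finset.mem_insert_of_mem ht))

theorem eulerDeriv_mem_weightBox {N : ℕ} {F : MvPolynomial σ K} (k : σ)
    (hF : F ∈ restrictSupport K (weightBox wt i e lo hi N)) :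
    eulerDeriv k F ∈ restrictSupport K (weightBox wt i e lo hi N) := by
  rw [mem_restrictSupport_iff] at *
  exact fun m hm => hF (support_eulerDeriv_subset k F hm)

variable {q : MvPolynomial σ K}

/-- Each differentiation contributes one factor that is an Euler derivative of q, so the r-th ratio
is as large as a product of r copies of q. -/
theorem tangentRatio_mem_weightBox
    (hq : q ∈ restrictSupport K (weightBox wt i e lo hi 1)) (k j : σ) (m : σ →₀ ℕ) (r : ℕ) :
    tangentRatio q k j m r ∈ restrictSupport K (weightBox wt i e lo hi r) := by
  induction r with
  | zero => exact one_mem_weightBox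
  | succ r ih =>
    rw [tangentRatio, tangentDeriv_apply, add_comm r 1]
    refine add_mem (sub_mem ?_ ?_) (mul_mem_weightBox ?_ ih)
    · exact mul_mem_weightBox (eulerDeriv_mem_weightBox j hq) (eulerDeriv_mem_weightBox k ih)
    · exact mul_mem_weightBox (eulerDeriv_mem_weightBox k hq) (eulerDeriv_mem_weightBox j ih)
    · rw [tangentLog, C_mul', C_mul']
      exact sub_mem (Submodule.smul_mem _ _ (eulerDeriv_mem_weightBox j hq))
        (Submodule.smul_mem _ _ (eulerDeriv_mem_weightBox k hq))

/-- Every term of the expansion takes one entry from each row, and row a costs a, so the total is 0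
+ 1 + … + (r - 1). -/
theorem det_mem_weightBox {r : ℕ} (M : Matrix (Fin r) (Fin r) (MvPolynomial σ K))
    (hM : ∀ a b : Fin r, M a b ∈ restrictSupport K (weightBox wt i e lo hi a)) :
    M.det ∈ restrictSupport K (weightBox wt i e lo hi (r.choose 2)) := by
  have hr : r.choose 2 = ∑ a : Fin r, (a : ℕ) := by
    rw [Fin.sum_univ_eq_sum_range (fun a => a), Finset.sum_range_id, Nat.choose_two_right]
  rw [← Matrix.det_transpose, Matrix.det_apply, hr]
  refine sum_mem fun p _ => ?_
  have : ∏ a, M.transpose (p a) a ∈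
      restrictSupport K (weightBox wt i e lo hi (∑ a : Fin r, (a : ℕ))) :=
    prod_mem_weightBox _ _ _ fun a _ => hM a (p a)
  rcases Int.units_eq_one_or (Equiv.Perm.sign p) with h | h
  · rw [h, one_smul]; exact this
  · rw [h]; simpa using this

end Box

/-! ### One-parameter twists -/

section Twist
variable {σ K : Type*} [Field K]

/-- `G(X_k S ^ wt k) / S ^ c` as a polynomial in `S`. -/
noncomputable def twist (wt : σ → ℤ) (c : ℤ) (G : MvPolynomial σ K) :
    Polynomial (MvPolynomial σ K) :=
  ∑ m ∈ G.support, Polynomial.monomial (Finsupp.weight wt m - c).toNat (monomial m (coeff m G))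

theorem coeff_coeff_twist (wt : σ → ℤ) (c : ℤ) (G : MvPolynomial σ K) (t : ℕ) (m : σ →₀ ℕ) :
    coeff m ((twist wt c G).coeff t) =
      if (Finsupp.weight wt m - c).toNat = t then coeff m G else 0 := by
  classical
  rw [twist, Polynomial.finsetSum_coeff, coeff_sum]
  simp only [Polynomial.coeff_monomial, apply_ite (coeff m), coeff_monomial, coeff_zero]
  rw [Finset.sum_eq_single m]
  · simp
  · intro b _ hb
    simp [hb]
  · intro hm
    simp [notMem_support_iff.mp hm]

theorem natDegree_twist_le {wt : σ → ℤ} {c : ℤ} {G : MvPolynomial σ K} {t : ℕ}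
    (h : ∀ m ∈ G.support, Finsupp.weight wt m ≤ c + t) : (twist wt c G).natDegree ≤ t := by
  refine Polynomial.natDegree_sum_le_of_forall_le _ _ fun m hm => ?_
  refine (Polynomial.natDegree_monomial_le _).trans ?_
  have := h m hm
  omega

/-- Twisting only sorts the terms by weight; each keeps its own monomial, so nothing cancels. -/
theorem coeff_twist_ne_zero {wt : σ → ℤ} {c : ℤ} {G : MvPolynomial σ K} {m : σ →₀ ℕ}
    (hm : m ∈ G.support) : (twist wt c G).coeff (Finsupp.weight wt m - c).toNat ≠ 0 := by
  intro h
  have := coeff_coeff_twist wt c G (Finsupp.weight wt m - c).toNat m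
  rw [h, if_pos rfl, coeff_zero] at this
  exact mem_support_iff.mp hm this.symm

theorem degreeOf_coeff_twist_le (wt : σ → ℤ) (c : ℤ) {G : MvPolynomial σ K} {i : σ} {e : ℕ}
    (h : ∀ m ∈ G.support, m i ≤ e) (t : ℕ) : degreeOf i ((twist wt c G).coeff t) ≤ e := by
  rw [degreeOf_le_iff]
  intro m hm
  rw [mem_support_iff, coeff_coeff_twist] at hm
  refine h m (mem_support_iff.mpr fun h0 => hm ?_)
  simp [h0]

variable {Ω : Type*} [Field Ω] [Algebra K Ω] [Algebra (MvPolynomial σ K) Ω]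
  [IsScalarTower K (MvPolynomial σ K) Ω]

/-- The substitution `X_k ↦ X_k s ^ wt k`. -/
noncomputable def twistHom (wt : σ → ℤ) (s : Ω) : MvPolynomial σ K →ₐ[K] Ω :=
  aeval fun k => algebraMap (MvPolynomial σ K) Ω (X k) * s ^ wt k

theorem twistHom_monomial (wt : σ → ℤ) {s : Ω} (hs : s ≠ 0) (m : σ →₀ ℕ) (r : K) :
    twistHom wt s (monomial m r) =
      algebraMap (MvPolynomial σ K) Ω (monomial m r) * s ^ Finsupp.weight wt m := by
  have h1 : ∀ m : σ →₀ ℕ, twistHom wt s (monomial m (1 : K)) =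
      algebraMap (MvPolynomial σ K) Ω (monomial m 1) * s ^ Finsupp.weight wt m := by
    intro m
    induction m using Finsupp.induction_linear with
    | zero => simp
    | add f g hf hg =>
      rw [← mul_one (1 : K), ← monomial_mul, map_mul, map_mul, hf, hg, map_add, zpow_add₀ hs]
      ring
    | single k n =>
      rw [← X_pow_eq_monomial, map_pow, map_pow, twistHom, aeval_X, mul_pow,
        Finsupp.weight_single, nsmul_eq_mul, mul_comm (n : ℤ), zpow_mul, zpow_natCast]
  rw [← mul_one r, ← C_mul_monomial, map_mul, map_mul, h1, ← algebraMap_eq, AlgHom.commutes,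
    ← IsScalarTower.algebraMap_apply]
  ring

/-- Weights may be negative; the lower bound c ensures that the truncation in `twist` loses nothing
and the twist is an honest polynomial in S. -/
theorem eval₂_twist (wt : σ → ℤ) {s : Ω} (hs : s ≠ 0) {c : ℤ} {G : MvPolynomial σ K}
    (h : ∀ m ∈ G.support, c ≤ Finsupp.weight wt m) :
    (twist wt c G).eval₂ (algebraMap (MvPolynomial σ K) Ω) s * s ^ c = twistHom wt s G := by
  conv_rhs => rw [G.as_sum, map_sum]
  rw [twist, Polynomial.eval₂_finsetSum, Finset.sum_mul]
  refine Finset.sum_congr rfl fun m hm => ?_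
  rw [Polynomial.eval₂_monomial, twistHom_monomial wt hs, mul_assoc, ← zpow_natCast,
    Int.toNat_of_nonneg (by linarith [h m hm]), ← zpow_add₀ hs, sub_add_cancel]

end Twist

/-! ### Resultants as products over roots -/

section Resultant
open Polynomial
variable {R Ω : Type*} [CommRing R] [Field Ω] [IsAlgClosed Ω] [Algebra R Ω]

theorem algebraMap_resultant (hR : Function.Injective (algebraMap R Ω)) (Q U : R[X]) (m : ℕ)
    (hU : U.natDegree ≤ m) :
    algebraMap R Ω (resultant Q U Q.natDegree m) = algebraMap R Ω Q.leadingCoeff ^ m *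
      ((Q.map (algebraMap R Ω)).roots.map fun s => U.eval₂ (algebraMap R Ω) s).prod := by
  rw [← resultant_map_map]
  have := resultant_eq_prod_eval (Q.map (algebraMap R Ω)) (U.map (algebraMap R Ω)) m
    (natDegree_map_le.trans hU) (IsAlgClosed.splits _)
  rw [natDegree_map_eq_of_injective hR, leadingCoeff_map_of_injective hR] at this
  simpa only [Polynomial.eval_map] using this

/-- Multiply the given relations over all roots of Q, with multiplicity. Giving U and V the same
formal degree m makes the powers of the leading coefficient of Q agree on both sides. -/
theorem resultant_relation (hR : Function.Injective (algebraMap R Ω)) (Q U V : R[X]) (m : ℕ)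
    (hU : U.natDegree ≤ m) (hV : V.natDegree ≤ m) (A B : R) (κ : Ω → Ω)
    (h : ∀ s, Q.eval₂ (algebraMap R Ω) s = 0 → κ s * (algebraMap R Ω A *
      U.eval₂ (algebraMap R Ω) s) = algebraMap R Ω B * V.eval₂ (algebraMap R Ω) s) :
    ((Q.map (algebraMap R Ω)).roots.map κ).prod *
      algebraMap R Ω (A ^ Q.natDegree * resultant Q U Q.natDegree m) =
      algebraMap R Ω (B ^ Q.natDegree * resultant Q V Q.natDegree m) := by
  by_cases hQ : Q = 0
  · subst hQ
    simp
  have hcard : Multiset.card (Q.map (algebraMap R Ω)).roots = Q.natDegree := by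
    rw [← natDegree_map_eq_of_injective hR Q, (IsAlgClosed.splits _).natDegree_eq_card_roots]
  have h1 : ((Q.map (algebraMap R Ω)).roots.map fun s => κ s * (algebraMap R Ω A *
      U.eval₂ (algebraMap R Ω) s)).prod = ((Q.map (algebraMap R Ω)).roots.map fun s =>
      algebraMap R Ω B * V.eval₂ (algebraMap R Ω) s).prod := by
    refine congrArg Multiset.prod (Multiset.map_congr rfl fun s hs => h s ?_)
    rw [← Polynomial.eval_map]
    exact (mem_roots'.mp hs).2
  simp only [Multiset.prod_map_mul, Multiset.map_const', Multiset.prod_replicate, hcard] at h1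
  rw [map_mul, map_mul, algebraMap_resultant hR _ _ _ hU, algebraMap_resultant hR _ _ _ hV,
    map_pow, map_pow]
  linear_combination (algebraMap R Ω Q.leadingCoeff ^ m) * h1

theorem resultant_ne_zero_of_eval₂_ne_zero (hR : Function.Injective (algebraMap R Ω)) {Q U : R[X]}
    (hQ : Q ≠ 0) (m : ℕ) (hU : U.natDegree ≤ m)
    (h : ∀ s, Q.eval₂ (algebraMap R Ω) s = 0 → U.eval₂ (algebraMap R Ω) s ≠ 0) :
    resultant Q U Q.natDegree m ≠ 0 := by
  intro h0
  have h1 := algebraMap_resultant hR Q U m hU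
  rw [h0, map_zero, eq_comm, mul_eq_zero] at h1
  rcases h1 with h1 | h1
  · exact hQ (leadingCoeff_eq_zero.mp
      ((injective_iff_map_eq_zero _).mp hR _ (eq_zero_of_pow_eq_zero h1)))
  · obtain ⟨s, hs, h2⟩ := Multiset.mem_map.mp (Multiset.prod_eq_zero_iff.mp h1)
    refine h s ?_ h2
    rw [← Polynomial.eval_map]
    exact (mem_roots'.mp hs).2

end Resultant

/-- In the Sylvester matrix w columns consist of coefficients of V and m columns of coefficients of
Q. -/
theorem degreeOf_resultant_le {σ K : Type*} [Field K] (i : σ)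
    (Q V : Polynomial (MvPolynomial σ K)) (w m a b : ℕ)
    (hQ : ∀ t, degreeOf i (Q.coeff t) ≤ a) (hV : ∀ t, degreeOf i (V.coeff t) ≤ b) :
    degreeOf i (Polynomial.resultant Q V w m) ≤ w * b + m * a := by
  classical
  have hM : ∀ r s, degreeOf i (Polynomial.sylvester Q V w m r s) ≤
      Fin.addCases (motive := fun _ => ℕ) (fun _ => b) (fun _ => a) s := by
    intro r s
    induction s using Fin.addCases with
    | left s =>
      simp only [Polynomial.sylvester, Matrix.of_apply, Fin.addCases_left]
      split_ifs
      · exact hV _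
      · simp
    | right s =>
      simp only [Polynomial.sylvester, Matrix.of_apply, Fin.addCases_right]
      split_ifs
      · exact hQ _
      · simp
  rw [Polynomial.resultant, Matrix.det_apply]
  refine (degreeOf_sum_le _ _ _).trans (Finset.sup_le fun p _ => ?_)
  have h1 : degreeOf i (∏ s, Polynomial.sylvester Q V w m (p s) s) ≤ w * b + m * a := by
    refine (degreeOf_prod_le _ _ _).trans ((Finset.sum_le_sum fun s _ => hM (p s) s).trans ?_)
    simp [Fin.sum_univ_add]
  rcases Int.units_eq_one_or (Equiv.Perm.sign p) with h | h
  · rw [h, one_smul]; exact h1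
  · rw [h, Units.neg_smul, one_smul, degreeOf_neg]; exact h1

/-! ### Algebraic dependence and comparison of degrees -/

section Algebraic
open Algebra

theorem IsAlgebraic.adjoin_mono {K L : Type*} [Field K] [Field L] [Algebra K L] {s t : Set L}
    (h : s ⊆ t) {x : L} (hx : IsAlgebraic (adjoin K s) x) : IsAlgebraic (adjoin K t) x :=
  hx.adjoin_of_forall_isAlgebraic fun _ hy => (hy.2 (h hy.1)).elim

theorem IsAlgebraic.zpow' {S L : Type*} [CommRing S] [IsDomain S] [Field L] [Algebra S L] {x : L}
    (hx : IsAlgebraic S x) (n : ℤ) : IsAlgebraic S (x ^ n) := by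
  cases n with
  | ofNat n => simpa using hx.pow n
  | negSucc n => rw [zpow_negSucc]; exact (hx.pow _).inv

/-- Relative algebraic dependence is preserved by homomorphisms. -/
theorem IsAlgebraic.map_adjoin {K L Ω : Type*} [Field K] [Field L] [Field Ω] [Algebra K L]
    [Algebra K Ω] (ψ : L →ₐ[K] Ω) {s : Set L} {x : L} (hx : IsAlgebraic (adjoin K s) x) :
    IsAlgebraic (adjoin K (ψ '' s)) (ψ x) := by
  have hmap : ∀ y : adjoin K s, ψ y ∈ adjoin K (ψ '' s) := by
    intro y
    rw [← AlgHom.map_adjoin]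
    exact ⟨y, y.2, rfl⟩
  let f : adjoin K s →+* adjoin K (ψ '' s) :=
    (ψ.toRingHom.comp (adjoin K s).val.toRingHom).codRestrict _ hmap
  refine hx.ringHom_of_comp_eq f ψ.toRingHom ?_ ?_
  · intro a b hab
    have : ψ a = ψ b := congrArg Subtype.val hab
    exact Subtype.ext (ψ.injective this)
  · ext y
    rfl

/-- A derivation in characteristic zero vanishes on what is algebraic over its constants. -/
theorem Derivation.eq_zero_of_isAlgebraic {L : Type*} [Field L] [CharZero L]
    (D : Derivation ℤ L L) {K : Type*} [Field K] [Algebra K L] (S : Subalgebra K L)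
    (hS : ∀ y ∈ S, D y = 0) {x : L} (hx : IsAlgebraic S x) : D x = 0 := by
  obtain ⟨p, hp0, hp⟩ := hx
  -- Induction on the degree: applying D to p(x) = 0 gives p'(x) D x = 0, so either D x = 0 or the
  -- derivative, nonzero in characteristic 0, is a smaller relation.
  have key : ∀ (n : ℕ) (p : Polynomial S), p.natDegree = n → p ≠ 0 → Polynomial.aeval x p = 0 →
      D x = 0 := by
    intro n
    induction n using Nat.strong_induction_on with
    | _ n ih =>
      intro p hn hp0 hp
      have hdeg : p.natDegree ≠ 0 := by
        intro h0
        obtain ⟨c, rfl⟩ := Polynomial.natDegree_eq_zero.mp h0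
        rw [Polynomial.aeval_C] at hp
        have : c = 0 := Subtype.ext hp
        simp [this] at hp0
      have hder : Polynomial.aeval x p.derivative * D x = 0 := by
        have h1 : D (Polynomial.aeval x p) = Polynomial.aeval x p.derivative * D x := by
          clear hp hp0 hn hdeg
          induction p using Polynomial.induction_on' with
          | add p q hp hq => rw [map_add, map_add, hp, hq, map_add, map_add, add_mul]
          | monomial m a =>
            rw [Polynomial.aeval_monomial, Polynomial.derivative_monomial,
              Polynomial.aeval_monomial, Derivation.leibniz, Derivation.leibniz_pow,
              show D (algebraMap S L a) = 0 from hS _ a.2]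
            simp only [smul_eq_mul, nsmul_eq_mul, mul_zero, add_zero, map_mul]
            have hm : algebraMap S L (m : S) = (m : L) := _root_.map_natCast (algebraMap S L) m
            linear_combination (-(algebraMap S L a) * x ^ (m - 1) * D x) * hm
        rw [← h1, hp, map_zero]
      rcases mul_eq_zero.mp hder with h | h
      · refine ih p.derivative.natDegree ?_ p.derivative rfl ?_ h
        · rw [← hn]; exact Polynomial.natDegree_derivative_lt hdeg
        · intro h0
          exact hdeg (Polynomial.derivative_eq_zero.mp h0)
      · exact h
  exact key _ p rfl hp0 hp

variable {σ K : Type*} [Field K]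

theorem exists_degreeOf_eq_zero_of_mem_adjoin {L : Type*} [Field L] [Algebra K L]
    (ι : MvPolynomial σ K →ₐ[K] L) (i : σ) {y : L}
    (hy : y ∈ adjoin K ((fun k => ι (X k)) '' {i}ᶜ)) :
    ∃ p : MvPolynomial σ K, degreeOf i p = 0 ∧ ι p = y := by
  classical
  induction hy using Algebra.adjoin_induction with
  | mem x hx =>
    obtain ⟨k, hk, rfl⟩ := hx
    exact ⟨X k, degreeOf_X_of_ne (Ne.symm hk), rfl⟩
  | algebraMap r => exact ⟨C r, degreeOf_C r i, by rw [← algebraMap_eq, AlgHom.commutes]⟩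
  | add x y _ _ hx hy =>
    obtain ⟨p, hp, rfl⟩ := hx
    obtain ⟨q, hq, rfl⟩ := hy
    exact ⟨p + q, by have := degreeOf_add_le i p q; omega, map_add _ _ _⟩
  | mul x y _ _ hx hy =>
    obtain ⟨p, hp, rfl⟩ := hx
    obtain ⟨q, hq, rfl⟩ := hy
    exact ⟨p * q, by have := degreeOf_mul_le i p q; omega, map_mul _ _ _⟩

/-- An algebraic relation for `x` with nonzero constant term, with polynomial coefficients. -/
theorem exists_polynomial_relation {L : Type*} [Field L] [Algebra K L]
    (ι : MvPolynomial σ K →ₐ[K] L) (i : σ) {x : L} (hx0 : x ≠ 0)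
    (hx : IsAlgebraic (adjoin K ((fun k => ι (X k)) '' {i}ᶜ)) x) :
    ∃ (r : ℕ) (E : ℕ → MvPolynomial σ K), (∀ e, degreeOf i (E e) = 0) ∧ ι (E 0) ≠ 0 ∧
      ∑ e ∈ Finset.range (r + 1), ι (E e) * x ^ e = 0 := by
  obtain ⟨p, hp0, hp⟩ := hx.exists_nonzero_coeff_and_aeval_eq_zero
    (mem_nonZeroDivisors_of_ne_zero hx0)
  choose E hE hE' using fun e => exists_degreeOf_eq_zero_of_mem_adjoin ι i (p.coeff e).2
  refine ⟨p.natDegree, E, hE, ?_, ?_⟩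
  · rw [hE']
    exact fun h => hp0 (Subtype.ext h)
  · rw [Polynomial.aeval_eq_sum_range] at hp
    rw [← hp]
    refine Finset.sum_congr rfl fun e _ => ?_
    rw [hE']
    rfl

/-- Clearing denominators in an algebraic equation for κ = v/u gives ∑ E_e v^e u^(r-e) = 0 with all
E_e free of X_i and E_0 ≠ 0. If u had the larger degree in X_i, the term e = 0 would strictly
dominate and could not cancel. -/
theorem degreeOf_le_of_isAlgebraic_ratio {Ω : Type*} [Field Ω] [Algebra K Ω]
    (ι : MvPolynomial σ K →ₐ[K] Ω) (hι : Function.Injective ι) (i : σ) {κ : Ω}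
    (hκ : IsAlgebraic (adjoin K ((fun k => ι (X k)) '' {i}ᶜ)) κ)
    {u v : MvPolynomial σ K} (hv : v ≠ 0) (h : κ * ι u = ι v) : degreeOf i u ≤ degreeOf i v := by
  have hv' : ι v ≠ 0 := fun h0 => hv (hι (by rw [h0, map_zero]))
  have hκ0 : κ ≠ 0 := by rintro rfl; rw [zero_mul] at h; exact hv' h.symm
  have hu : u ≠ 0 := by rintro rfl; rw [map_zero, mul_zero] at h; exact hv' h.symm
  obtain ⟨r, E, hE, hE0, hsum⟩ := exists_polynomial_relation ι i hκ0 hκ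
  by_contra! hlt
  have h1 : ∑ e ∈ Finset.range (r + 1), E e * v ^ e * u ^ (r - e) = 0 := by
    refine hι ?_
    rw [map_zero, map_sum, ← zero_mul (ι u ^ r), ← hsum, Finset.sum_mul]
    refine Finset.sum_congr rfl fun e he => ?_
    rw [map_mul, map_mul, map_pow, map_pow, ← h, mul_pow, ← pow_sub_mul_pow (ι u)
      (Nat.lt_succ_iff.mp (Finset.mem_range.mp he))]
    ring
  have hE0' : E 0 ≠ 0 := fun h0 => hE0 (by rw [h0, map_zero])
  rw [Finset.sum_range_succ'] at h1
  have h2 : degreeOf i (E 0 * v ^ 0 * u ^ (r - 0)) = r * degreeOf i u := by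
    rw [pow_zero, mul_one, degreeOf_mul_eq hE0' (pow_ne_zero _ hu), hE, degreeOf_pow_eq i u _ hu,
      zero_add, Nat.sub_zero]
  rw [eq_neg_of_add_eq_zero_right h1, degreeOf_neg] at h2
  have h3 : degreeOf i (∑ e ∈ Finset.range r, E (e + 1) * v ^ (e + 1) * u ^ (r - (e + 1))) ≤
      r * degreeOf i u - 1 := by
    refine (degreeOf_sum_le _ _ _).trans (Finset.sup_le fun e he => ?_)
    have he := Finset.mem_range.mp he
    have h4 := degreeOf_mul_le i (E (e + 1) * v ^ (e + 1)) (u ^ (r - (e + 1)))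
    have h5 := degreeOf_mul_le i (E (e + 1)) (v ^ (e + 1))
    have h6 := degreeOf_pow_le i v (e + 1)
    have h7 := degreeOf_pow_le i u (r - (e + 1))
    have h8 : (e + 1) * degreeOf i v + (e + 1) ≤ (e + 1) * degreeOf i u := by
      rw [← Nat.mul_succ]; exact Nat.mul_le_mul_left _ hlt
    have h9 : (e + 1) * degreeOf i u + (r - (e + 1)) * degreeOf i u = r * degreeOf i u := by
      rw [← add_mul, Nat.add_sub_cancel' he]
    rw [hE] at h5
    omega
  have hr : 0 < r := by
    rcases Nat.eq_zero_or_pos r with rfl | hr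
    · simp at hsum
      exact (hE0 hsum).elim
    · exact hr
  have : 0 < r * degreeOf i u := Nat.mul_pos hr (by omega)
  omega

end Algebraic

/-- The field of functions on an irreducible hypersurface: generation, universal property, and
extension of tangent derivations. -/
theorem exists_function_field.{u} {σ : Type} {K : Type u} [Field K] {q : MvPolynomial σ K}
    (hq : Irreducible q) :
    ∃ (L : Type u) (_ : Field L) (_ : Algebra K L) (ι : MvPolynomial σ K →ₐ[K] L),
      (∀ G, ι G = 0 ↔ q ∣ G) ∧ (∀ z, ∃ G H, ι H ≠ 0 ∧ z = ι G / ι H) ∧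
      (∀ (Ω : Type u) [Field Ω] [Algebra K Ω] (φ : MvPolynomial σ K →ₐ[K] Ω),
        (∀ G, φ G = 0 ↔ q ∣ G) → ∃ ψ : L →ₐ[K] Ω, ∀ G, ψ (ι G) = φ G) ∧
      (∀ d : Derivation K (MvPolynomial σ K) (MvPolynomial σ K), d q = 0 →
        ∃ D : Derivation ℤ L L, ∀ G, D (ι G) = ι (d G)) := by
  have hprime : (Ideal.span {q}).IsPrime :=
    (Ideal.span_singleton_prime hq.ne_zero).mpr hq.prime
  let A := MvPolynomial σ K ⧸ Ideal.span {q}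
  let L := FractionRing A
  let π : MvPolynomial σ K →ₐ[K] A := Ideal.Quotient.mkₐ K (Ideal.span {q})
  have hπ : ∀ G, π G = 0 ↔ q ∣ G := fun G => by
    rw [← Ideal.mem_span_singleton]
    exact Ideal.Quotient.eq_zero_iff_mem
  have hπs : Function.Surjective π := Ideal.Quotient.mkₐ_surjective K _
  let j : A →ₐ[K] L := IsScalarTower.toAlgHom K A L
  have hj : Function.Injective j := IsFractionRing.injective A L
  refine ⟨L, inferInstance, inferInstance, j.comp π, fun G => ?_, fun z => ?_, ?_, ?_⟩
  · rw [← hπ, AlgHom.comp_apply]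
    exact map_eq_zero_iff j hj
  · obtain ⟨a, b, hb, rfl⟩ := IsFractionRing.div_surjective (A := A) z
    obtain ⟨G, rfl⟩ := hπs a
    obtain ⟨H, rfl⟩ := hπs b
    exact ⟨G, H, fun h => nonZeroDivisors.ne_zero hb (hj (h.trans (map_zero j).symm)), rfl⟩
  · intro Ω _ _ φ hφ
    have hle : ∀ a ∈ Ideal.span {q}, φ a = 0 := fun a ha =>
      (hφ a).mpr (Ideal.mem_span_singleton.mp ha)
    let φ' : A →ₐ[K] Ω := Ideal.Quotient.liftₐ (Ideal.span {q}) φ hle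
    have hφ' : ∀ G, φ' (π G) = φ G := fun G => Ideal.Quotient.liftₐ_apply _ _ _ _
    have hinj : Function.Injective φ' := by
      rw [injective_iff_map_eq_zero]
      intro a ha
      obtain ⟨G, rfl⟩ := hπs a
      rw [hφ', hφ] at ha
      exact (hπ G).mpr ha
    refine ⟨IsFractionRing.liftAlgHom hinj, fun G => ?_⟩
    rw [← hφ']
    exact IsFractionRing.lift_algebraMap hinj (π G)
  · intro d hd
    have hd' : ∀ G, π G = 0 → π (d G) = 0 := by
      intro G hG
      obtain ⟨H, rfl⟩ := (hπ G).mp hG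
      rw [Derivation.leibniz, hd, smul_zero, add_zero, smul_eq_mul, map_mul, (hπ q).mpr dvd_rfl,
        zero_mul]
    obtain ⟨D, hD⟩ := exists_derivation_extension (A := A) (L := L)
      ((Derivation.liftOfSurjective hπs hd').restrictScalars ℤ)
    refine ⟨D, fun G => ?_⟩
    exact (hD (π G)).trans
      (congrArg (algebraMap A L) (Derivation.liftOfSurjective_apply hπs hd' G))

/-! ### Constants of the tangent derivation on the function field -/

section Algebraic
open Algebra
variable {σ K L : Type*} [Field K] [Field L] [Algebra K L] {q : MvPolynomial σ K}
  (ι : MvPolynomial σ K →ₐ[K] L)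

/-- A nonzero multiple of q involves X_j, so the other variables stay independent in the function
field. Were X_j transcendental over them, all variables would be independent, but q is a relation.
-/
theorem isAlgebraic_adjoin_of_degreeOf_pos (hι : ∀ G, ι G = 0 ↔ q ∣ G) {j : σ}
    (hj : 0 < degreeOf j q) :
    IsAlgebraic (adjoin K ((fun k => ι (X k)) '' {j}ᶜ)) (ι (X j)) := by
  classical
  have hq0 : q ≠ 0 := by rintro rfl; simp at hj
  have haeval : ∀ G, aeval (fun k => ι (X k)) G = ι G := fun G =>
    (DFunLike.congr_fun (aeval_unique ι) G).symm
  by_contra htr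
  have hind : AlgebraicIndependent K (fun k : {k // k ≠ j} => ι (X (k : σ))) := by
    rw [algebraicIndependent_iff]
    intro p hp
    have h1 : ι (rename Subtype.val p) = 0 := by
      rw [← haeval, aeval_rename]
      exact hp
    by_contra hp0
    have h2 : rename (Subtype.val : {k // k ≠ j} → σ) p ≠ 0 := fun h =>
      hp0 (rename_injective _ Subtype.val_injective (by rw [h, map_zero]))
    obtain ⟨H, hH⟩ := (hι _).mp h1
    have hH0 : H ≠ 0 := by rintro rfl; rw [mul_zero] at hH; exact h2 hH
    have h3 : degreeOf j (rename (Subtype.val : {k // k ≠ j} → σ) p) = 0 := by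
      by_contra h
      have : j ∈ (rename (Subtype.val : {k // k ≠ j} → σ) p).vars := by
        rw [vars_def, Multiset.mem_toFinset, ← Multiset.count_pos, ← degreeOf_def]
        omega
      obtain ⟨k, _, hk⟩ := Finset.mem_image.mp (vars_rename _ _ this)
      exact k.2 hk
    rw [hH, degreeOf_mul_eq hq0 hH0] at h3
    omega
  have hall := (AlgebraicIndependent.iff_transcendental_adjoin_image
    (x := fun k => ι (X k)) j).mpr ⟨hind, htr⟩
  rw [algebraicIndependent_iff] at hall
  exact hq0 (hall q (by rw [haeval]; exact (hι q).mpr dvd_rfl))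

theorem isAlgebraic_of_forall_X (S : Subalgebra K L) (h : ∀ k, IsAlgebraic S (ι (X k)))
    (G : MvPolynomial σ K) : IsAlgebraic S (ι G) := by
  induction G using MvPolynomial.induction_on with
  | C a =>
    rw [← algebraMap_eq, AlgHom.commutes]
    exact isAlgebraic_algebraMap (⟨_, S.algebraMap_mem a⟩ : S)
  | add p q hp hq => rw [map_add]; exact hp.add hq
  | mul_X p n hp => rw [map_mul]; exact hp.mul (h n)

theorem isAlgebraic_adjoin_compl (hι : ∀ G, ι G = 0 ↔ q ∣ G) {j : σ} (hj : 0 < degreeOf j q)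
    (G : MvPolynomial σ K) : IsAlgebraic (adjoin K ((fun k => ι (X k)) '' {j}ᶜ)) (ι G) := by
  refine isAlgebraic_of_forall_X ι _ (fun k => ?_) G
  by_cases hk : k = j
  · subst hk
    exact isAlgebraic_adjoin_of_degreeOf_pos ι hι hj
  · exact isAlgebraic_algebraMap
      (⟨_, subset_adjoin ⟨k, hk, rfl⟩⟩ : adjoin K ((fun k => ι (X k)) '' {j}ᶜ))

/-- The constants of the tangent derivation are algebraic over the remaining variables. -/
theorem isAlgebraic_of_deriv_eq_zero [CharZero L] (hι : ∀ G, ι G = 0 ↔ q ∣ G)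
    (hfrac : ∀ z, ∃ G H, ι H ≠ 0 ∧ z = ι G / ι H) {i j : σ} (hij : i ≠ j)
    (hj : 0 < degreeOf j q) (hX : ¬ q ∣ X i) (hθ : ¬ q ∣ eulerDeriv j q)
    (D : Derivation ℤ L L) (hD : ∀ G, D (ι G) = ι (tangentDeriv q i j G)) {c : L} (hc : D c = 0) :
    IsAlgebraic (adjoin K ((fun k => ι (X k)) '' {i, j}ᶜ)) c := by
  by_contra htr
  have hcompl : (fun k => ι (X k)) '' {j}ᶜ =
      insert (ι (X i)) ((fun k => ι (X k)) '' {i, j}ᶜ) := by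
    rw [← Set.image_insert_eq (f := fun k => ι (X k))]
    congr 1
    ext k
    simp only [Set.mem_compl_iff, Set.mem_singleton_iff, Set.mem_insert_iff, not_or]
    by_cases hk : k = i
    · simp [hk, hij]
    · simp [hk]
  have hcj : IsAlgebraic (adjoin K ((fun k => ι (X k)) '' {j}ᶜ)) c := by
    obtain ⟨G, H, _, rfl⟩ := hfrac c
    rw [div_eq_mul_inv]
    exact (isAlgebraic_adjoin_compl ι hι hj G).mul (isAlgebraic_adjoin_compl ι hι hj H).inv
  rw [hcompl] at hcj
  -- By the exchange property, a constant c that depends on X_i makes X_i algebraic over c and the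
  -- variables other than X_i and X_j. All of these are killed by D, hence D X_i = 0; but D X_i =
  -- (θ_j q) X_i is nonzero modulo q.
  have hex : IsAlgebraic (adjoin K (insert c ((fun k => ι (X k)) '' {i, j}ᶜ))) (ι (X i)) := by
    have h1 := (AlgebraicIndependent.matroid K L).closure_exchange (e := c) (f := ι (X i))
      (X := (fun k => ι (X k)) '' {i, j}ᶜ)
    simp only [AlgebraicIndependent.matroid_closure_eq, Set.mem_sdiff, SetLike.mem_coe,
      Subalgebra.mem_algebraicClosure] at h1
    exact (h1 ⟨hcj, htr⟩).1
  have hzero : ∀ y ∈ adjoin K (insert c ((fun k => ι (X k)) '' {i, j}ᶜ)), D y = 0 := by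
    intro y hy
    induction hy using Algebra.adjoin_induction with
    | mem x hx =>
      rcases hx with rfl | ⟨k, hk, rfl⟩
      · exact hc
      · simp only [Set.mem_compl_iff, Set.mem_insert_iff, Set.mem_singleton_iff, not_or] at hk
        have h1 : eulerDeriv i (X k : MvPolynomial σ K) = 0 := by
          simp [eulerDeriv, pderiv_X_of_ne hk.1]
        have h2 : eulerDeriv j (X k : MvPolynomial σ K) = 0 := by
          simp [eulerDeriv, pderiv_X_of_ne hk.2]
        simp only [hD, tangentDeriv_apply, h1, h2, mul_zero, sub_zero, map_zero]
    | algebraMap r =>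
      rw [← ι.commutes, hD, Derivation.map_algebraMap, map_zero]
    | add x y _ _ hx hy => rw [map_add, hx, hy, add_zero]
    | mul x y _ _ hx hy => rw [Derivation.leibniz, hx, hy, smul_zero, smul_zero, add_zero]
  have h3 := D.eq_zero_of_isAlgebraic _ hzero hex
  have h4 : eulerDeriv j (X i : MvPolynomial σ K) = 0 := by
    simp [eulerDeriv, pderiv_X_of_ne hij]
  have h5 : eulerDeriv i (X i : MvPolynomial σ K) = X i := by
    simp [eulerDeriv, pderiv_X_self]
  rw [hD, tangentDeriv_apply, h4, h5, mul_zero, sub_zero, map_mul, mul_eq_zero, hι, hι] at h3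
  exact h3.elim hθ hX

end Algebraic

/-! ### Substitutions at the roots of the twist and the exponent bound -/

section TwistKernel
open Algebra
variable {σ K : Type*} [Field K] {q : MvPolynomial σ K}

/-- Eliminating X_j between q and G yields a nonzero polynomial free of X_j that φ kills. Since φ
agrees with ε on the variables other than X_i and X_j, whose images are independent, this is an
algebraic equation for φ(X_i) over them. -/
theorem isAlgebraic_of_twistHom_eq_zero {L Ω : Type*} [Field L] [Algebra K L] [Field Ω]
    [Algebra K Ω] (ι : MvPolynomial σ K →ₐ[K] L) (hι : ∀ G, ι G = 0 ↔ q ∣ G)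
    (φ ε : MvPolynomial σ K →ₐ[K] Ω) (hε : Function.Injective ε) {i j : σ} (hij : i ≠ j)
    (hφε : ∀ k, k ≠ i → k ≠ j → φ (X k) = ε (X k)) (hφq : φ q = 0) (hj : 0 < degreeOf j q)
    {G : MvPolynomial σ K} (hφG : φ G = 0) (hG : ¬ q ∣ G) :
    IsAlgebraic (adjoin K ((fun k => ε (X k)) '' {i, j}ᶜ)) (φ (X i)) := by
  have hιG : ι G ≠ 0 := fun h => hG ((hι G).mp h)
  obtain ⟨r, E, hE, hE0, hsum⟩ :=
    exists_polynomial_relation ι j hιG (isAlgebraic_adjoin_compl ι hι hj G)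
  have hφE : φ (E 0) = 0 := by
    have h1 : q ∣ ∑ e ∈ Finset.range (r + 1), E e * G ^ e := by
      rw [← hι, map_sum, ← hsum]
      simp only [map_mul, map_pow]
    obtain ⟨H, hH⟩ := h1
    have h2 := congrArg φ hH
    rw [map_mul, hφq, zero_mul, map_sum, Finset.sum_range_succ'] at h2
    simpa [hφG] using h2
  have hE0' : E 0 ≠ 0 := fun h => hE0 (by rw [h, map_zero])
  by_contra htr
  have hεind : AlgebraicIndependent K (fun k => ε (X k)) := by
    have := (MvPolynomial.algebraicIndependent_X σ K).map' (f := ε) hε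
    exact this
  have h1 : AlgebraicIndepOn K (fun k => φ (X k)) ({i, j}ᶜ : Set σ) := by
    have h2 := hεind.comp (Subtype.val : (({i, j}ᶜ : Set σ)) → σ) Subtype.val_injective
    have h3 : (fun k => ε (X k)) ∘ (Subtype.val : (({i, j}ᶜ : Set σ)) → σ) =
        fun k : ({i, j}ᶜ : Set σ) => φ (X (k : σ)) := by
      funext k
      have hk := k.2
      simp only [Set.mem_compl_iff, Set.mem_insert_iff, Set.mem_singleton_iff, not_or] at hk
      exact (hφε k hk.1 hk.2).symm
    rw [h3] at h2
    exact h2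
  have himg : (fun k => φ (X k)) '' ({i, j}ᶜ : Set σ) = (fun k => ε (X k)) '' {i, j}ᶜ := by
    refine Set.image_congr fun k hk => ?_
    simp only [Set.mem_compl_iff, Set.mem_insert_iff, Set.mem_singleton_iff, not_or] at hk
    exact hφε k hk.1 hk.2
  have hset : insert i ({i, j}ᶜ : Set σ) = {j}ᶜ := by
    ext k
    simp only [Set.mem_compl_iff, Set.mem_singleton_iff, Set.mem_insert_iff, not_or]
    by_cases hk : k = i
    · simp [hk, hij]
    · simp [hk]
  have h3 : AlgebraicIndepOn K (fun k => φ (X k)) ({j}ᶜ : Set σ) := by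
    rw [← hset]
    exact (AlgebraicIndepOn.insert_iff (by simp)).mpr ⟨h1, by rw [himg]; exact htr⟩
  have hmem : E 0 ∈ Set.range (rename (R := K) (Subtype.val : ({j}ᶜ : Set σ) → σ)) := by
    classical
    obtain ⟨p, hp⟩ := (exists_rename_eq_of_vars_subset_range (E 0)
      (Subtype.val : ({j}ᶜ : Set σ) → σ) Subtype.val_injective (by
        intro k hk
        rw [Subtype.range_coe]
        rintro rfl
        have h0 := hE 0
        rw [degreeOf_def] at h0
        rw [Finset.mem_coe, vars_def, Multiset.mem_toFinset, ← Multiset.count_pos] at hk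
        omega))
    exact ⟨p, hp⟩
  obtain ⟨p, hp⟩ := hmem
  have hp0 : aeval (fun k : ({j}ᶜ : Set σ) => φ (X (k : σ))) p = 0 := by
    have : φ (rename (Subtype.val : ({j}ᶜ : Set σ) → σ) p) =
        aeval (fun k : ({j}ᶜ : Set σ) => φ (X (k : σ))) p := by
      exact (DFunLike.congr_fun (aeval_unique φ) _).trans (aeval_rename _ _ _)
    rw [← this, hp, hφE]
  have h4 := algebraicIndependent_iff.mp h3 p hp0
  rw [h4, map_zero] at hp
  exact hE0' hp.symm

/-- The kernel of the substitution at a root of the twist of `q` is generated by `q`. -/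
theorem twistHom_eq_zero_iff {L Ω : Type*} [Field L] [Algebra K L] [Field Ω]
    [Algebra K Ω] [Algebra (MvPolynomial σ K) Ω] [IsScalarTower K (MvPolynomial σ K) Ω]
    (hΩ : Function.Injective (algebraMap (MvPolynomial σ K) Ω))
    (ι : MvPolynomial σ K →ₐ[K] L) (hι : ∀ G, ι G = 0 ↔ q ∣ G) {i j : σ} (hij : i ≠ j)
    {wt : σ → ℤ} (hwt : ∀ k, k ≠ i → k ≠ j → wt k = 0) (hwtj : wt j ≠ 0)
    {s : Ω} (hs : s ≠ 0) (hφq : twistHom wt s q = 0) (hi : 0 < degreeOf i q)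
    (hj : 0 < degreeOf j q) (G : MvPolynomial σ K) : twistHom wt s G = 0 ↔ q ∣ G := by
  refine ⟨fun hG => ?_, fun ⟨H, hH⟩ => by rw [hH, map_mul, hφq, zero_mul]⟩
  by_contra hqG
  let ε : MvPolynomial σ K →ₐ[K] Ω := IsScalarTower.toAlgHom K _ Ω
  have hX : ∀ k, twistHom wt s (X k : MvPolynomial σ K) = ε (X k) * s ^ wt k := fun k => by
    rw [twistHom, aeval_X]; rfl
  have hφε : ∀ k, k ≠ i → k ≠ j → twistHom wt s (X k : MvPolynomial σ K) = ε (X k) := by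
    intro k h1 h2
    rw [hX, hwt k h1 h2, zpow_zero, mul_one]
  have h1 := isAlgebraic_of_twistHom_eq_zero ι hι (twistHom wt s) ε hΩ hij hφε hφq hj hG hqG
  have h2 := isAlgebraic_of_twistHom_eq_zero ι hι (twistHom wt s) ε hΩ hij.symm
    (fun k h1 h2 => hφε k h2 h1) hφq hi hG hqG
  rw [Set.pair_comm j i] at h2
  have hεind : AlgebraicIndependent K (fun k => ε (X k)) :=
    (MvPolynomial.algebraicIndependent_X σ K).map' (f := ε) hΩ
  have h3 := hεind.transcendental_adjoin (s := {i}ᶜ) (i := i) (by simp)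
  refine h3 ?_
  have hsub : (fun k => ε (X k)) '' ({i, j}ᶜ : Set σ) ⊆ (fun k => ε (X k)) '' {i}ᶜ := by
    refine Set.image_mono fun k hk => ?_
    simp only [Set.mem_compl_iff, Set.mem_insert_iff, Set.mem_singleton_iff, not_or] at hk
    exact hk.1
  have h4 := (h1.adjoin_mono hsub).zpow' (wt j)
  have h5 := (h2.adjoin_mono hsub).zpow' (wt i)
  have h6 : IsAlgebraic (adjoin K ((fun k => ε (X k)) '' {i}ᶜ)) (ε (X j)) :=
    isAlgebraic_algebraMap
      (⟨_, subset_adjoin ⟨j, hij.symm, rfl⟩⟩ : adjoin K ((fun k => ε (X k)) '' {i}ᶜ))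
  have hX0 : ε (X j : MvPolynomial σ K) ≠ 0 := fun h0 => X_ne_zero j (hΩ (h0.trans (map_zero _).symm))
  -- If the kernel were larger than (q), both X_i s^(wt i) and X_j s^(wt j) would be algebraic over
  -- the remaining variables. Eliminating s makes a nonzero power of X_i algebraic over the
  -- variables other than X_i, which is absurd.
  have h7 : (ε (X i : MvPolynomial σ K)) ^ wt j =
      twistHom wt s (X i : MvPolynomial σ K) ^ wt j *
        (twistHom wt s (X j : MvPolynomial σ K) ^ wt i)⁻¹ * ε (X j) ^ wt i := by
    rw [hX, hX, mul_zpow, mul_zpow, ← zpow_mul, ← zpow_mul, mul_comm (wt j) (wt i)]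
    have : s ^ (wt i * wt j) ≠ 0 := zpow_ne_zero _ hs
    have : ε (X j : MvPolynomial σ K) ^ wt i ≠ 0 := zpow_ne_zero _ hX0
    field_simp
  have h8 : IsAlgebraic (adjoin K ((fun k => ε (X k)) '' {i}ᶜ)) (ε (X i) ^ wt j) := by
    rw [h7]
    exact (h4.mul h5.inv).mul (h6.zpow' _)
  have h9 : IsAlgebraic (adjoin K ((fun k => ε (X k)) '' {i}ᶜ)) (ε (X i) ^ (wt j).natAbs) := by
    rcases Int.natAbs_eq (wt j) with h | h
    · rw [h, zpow_natCast] at h8; exact h8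
    · rw [h, zpow_neg, zpow_natCast] at h8
      simpa using h8.inv
  exact h9.of_pow (Int.natAbs_pos.mpr hwtj)

end TwistKernel

/-- If `c X ^ μ U = X ^ ν V` on the hypersurface `q = 0`, where `c` is algebraic over the variables
other than `X_i` and `X_j`, then the difference of the `X_i`-exponents is bounded. -/
theorem exponent_le_of_monomial_relation.{u} {σ : Type} {K : Type u} [Field K]
    {q : MvPolynomial σ K} {L : Type u} [Field L] [Algebra K L] (ι : MvPolynomial σ K →ₐ[K] L)
    (hι : ∀ G, ι G = 0 ↔ q ∣ G)
    (hlift : ∀ (Ω : Type u) [Field Ω] [Algebra K Ω] (φ : MvPolynomial σ K →ₐ[K] Ω),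
      (∀ G, φ G = 0 ↔ q ∣ G) → ∃ ψ : L →ₐ[K] Ω, ∀ G, ψ (ι G) = φ G)
    {i j : σ} (hij : i ≠ j) (hi : 0 < degreeOf i q) (hj : 0 < degreeOf j q)
    {wt : σ → ℤ} (hwt : ∀ k, k ≠ i → k ≠ j → wt k = 0) (hwtj : wt j ≠ 0)
    {e : ℕ} {lo : ℤ} {w N : ℕ} (hq : q ∈ restrictSupport K (weightBox wt i e lo (lo + w) 1))
    {m₀ m₁ : σ →₀ ℕ} (hm₀ : m₀ ∈ q.support) (hm₀' : Finsupp.weight wt m₀ = lo)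
    (hm₁ : m₁ ∈ q.support) (hm₁' : Finsupp.weight wt m₁ = lo + w) (hw : 0 < w)
    {U V : MvPolynomial σ K} (hU : U ∈ restrictSupport K (weightBox wt i e lo (lo + w) N))
    (hV : V ∈ restrictSupport K (weightBox wt i e lo (lo + w) N))
    (hqU : ¬ q ∣ U) (hqV : ¬ q ∣ V) {μ ν : σ →₀ ℕ}
    (hμν : Finsupp.weight wt μ = Finsupp.weight wt ν) {c : L}
    (hc : IsAlgebraic (Algebra.adjoin K ((fun k => ι (X k)) '' {i, j}ᶜ)) c)
    (h : c * (ι (monomial μ 1) * ι U) = ι (monomial ν 1) * ι V) : μ i ≤ ν i + 2 * N * e := by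
  let Ω := AlgebraicClosure (FractionRing (MvPolynomial σ K))
  have hΩ : Function.Injective (algebraMap (MvPolynomial σ K) Ω) := by
    rw [IsScalarTower.algebraMap_eq (MvPolynomial σ K) (FractionRing (MvPolynomial σ K)) Ω]
    exact (algebraMap (FractionRing (MvPolynomial σ K)) Ω).injective.comp
      (IsFractionRing.injective _ _)
  have hsupp : ∀ {M : ℕ} {G : MvPolynomial σ K},
      G ∈ restrictSupport K (weightBox wt i e lo (lo + w) M) → ∀ m ∈ G.support,
        m i ≤ M * e ∧ M * lo ≤ Finsupp.weight wt m ∧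
          Finsupp.weight wt m ≤ M * lo + ((M * w : ℕ) : ℤ) := by
    intro M G hG m hm
    obtain ⟨h1, h2, h3⟩ := (mem_restrictSupport_iff K).mp hG hm
    exact ⟨h1, h2, h3.trans (by push_cast; rw [mul_add])⟩
  have hq' := hsupp hq
  simp only [Nat.cast_one, one_mul] at hq'
  -- The extreme weights of q are attained, so the twist of q has degree exactly w and, by `hconst`,
  -- no root at 0.
  have hdeg : (twist wt lo q).natDegree = w := by
    refine le_antisymm (natDegree_twist_le fun m hm => (hq' m hm).2.2) ?_
    refine Polynomial.le_natDegree_of_ne_zero ?_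
    have := coeff_twist_ne_zero (wt := wt) (c := lo) hm₁
    rwa [hm₁', add_sub_cancel_left, Int.toNat_natCast] at this
  have hQ0 : twist wt lo q ≠ 0 := by
    intro h0
    rw [h0, Polynomial.natDegree_zero] at hdeg
    omega
  have hconst : (twist wt lo q).coeff 0 ≠ 0 := by
    have := coeff_twist_ne_zero (wt := wt) (c := lo) hm₀
    rwa [hm₀', sub_self, Int.toNat_zero] at this
  have hroot : ∀ s : Ω, (twist wt lo q).eval₂ (algebraMap (MvPolynomial σ K) Ω) s = 0 → s ≠ 0 := by
    rintro s hs rfl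
    rw [Polynomial.eval₂_at_zero] at hs
    exact hconst (hΩ (hs.trans (map_zero _).symm))
  have hker : ∀ s : Ω, (twist wt lo q).eval₂ (algebraMap (MvPolynomial σ K) Ω) s = 0 →
      ∀ G, twistHom wt s G = 0 ↔ q ∣ G := by
    intro s hs
    refine twistHom_eq_zero_iff hΩ ι hι hij hwt hwtj (hroot s hs) ?_ hi hj
    rw [← eval₂_twist wt (hroot s hs) fun m hm => (hq' m hm).2.1, hs, zero_mul]
  have hκ : ∀ s : Ω, ∃ κ : Ω,
      (twist wt lo q).eval₂ (algebraMap (MvPolynomial σ K) Ω) s = 0 →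
        κ * (algebraMap (MvPolynomial σ K) Ω (monomial μ 1) *
          (twist wt (N * lo) U).eval₂ (algebraMap (MvPolynomial σ K) Ω) s) =
          algebraMap (MvPolynomial σ K) Ω (monomial ν 1) *
            (twist wt (N * lo) V).eval₂ (algebraMap (MvPolynomial σ K) Ω) s ∧
        IsAlgebraic (Algebra.adjoin K
          ((fun k => algebraMap (MvPolynomial σ K) Ω (X k)) '' {i}ᶜ)) κ := by
    intro s
    by_cases hs : (twist wt lo q).eval₂ (algebraMap (MvPolynomial σ K) Ω) s = 0
    swap
    -- Away from the roots the value of κ is irrelevant.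
    · exact ⟨0, fun h => (hs h).elim⟩
    have hs0 := hroot s hs
    obtain ⟨ψ, hψ⟩ := hlift Ω (twistHom wt s) (hker s hs)
    refine ⟨ψ c, fun _ => ⟨?_, ?_⟩⟩
    -- Since μ and ν have equal weight and U, V the same normalisation N * lo, the powers of s agree
    -- on both sides and cancel.
    · have h1 := congrArg ψ h
      rw [map_mul, map_mul, map_mul, hψ, hψ, hψ, hψ, twistHom_monomial wt hs0,
        twistHom_monomial wt hs0, hμν, ← eval₂_twist wt hs0 fun m hm => (hsupp hU m hm).2.1,
        ← eval₂_twist wt hs0 fun m hm => (hsupp hV m hm).2.1] at h1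
      refine mul_right_cancel₀ (mul_ne_zero (zpow_ne_zero (Finsupp.weight wt ν) hs0)
        (zpow_ne_zero (N * lo) hs0)) ?_
      linear_combination h1
    -- The variables over which c is algebraic have weight 0, so the substitution fixes them.
    · refine (hc.map_adjoin ψ).adjoin_mono ?_
      rintro _ ⟨_, ⟨k, hk, rfl⟩, rfl⟩
      simp only [Set.mem_compl_iff, Set.mem_insert_iff, Set.mem_singleton_iff, not_or] at hk
      refine ⟨k, hk.1, ?_⟩
      simp only [hψ, twistHom, aeval_X, hwt k hk.1 hk.2, zpow_zero, mul_one]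
  choose κ hκ using hκ
  have hdU : (twist wt (N * lo) U).natDegree ≤ N * w :=
    natDegree_twist_le fun m hm => (hsupp hU m hm).2.2
  have hdV : (twist wt (N * lo) V).natDegree ≤ N * w :=
    natDegree_twist_le fun m hm => (hsupp hV m hm).2.2
  have hrel := resultant_relation hΩ (twist wt lo q) _ _ (N * w) hdU hdV _ _ κ
    fun s hs => (hκ s hs).1
  have hne : ∀ {G : MvPolynomial σ K}, G ∈ restrictSupport K (weightBox wt i e lo (lo + w) N) →
      ¬ q ∣ G → Polynomial.resultant (twist wt lo q) (twist wt (N * lo) G)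
        (twist wt lo q).natDegree (N * w) ≠ 0 := by
    intro G hG hqG
    refine resultant_ne_zero_of_eval₂_ne_zero hΩ hQ0 (N * w)
      (natDegree_twist_le fun m hm => (hsupp hG m hm).2.2) fun s hs h0 => hqG ?_
    rw [← hker s hs, ← eval₂_twist wt (hroot s hs) fun m hm => (hsupp hG m hm).2.1, h0, zero_mul]
  rw [hdeg] at hrel hne
  have hmono : ∀ m : σ →₀ ℕ, (monomial m (1 : K)) ^ w ≠ 0 := fun m =>
    pow_ne_zero _ (monomial_eq_zero.not.mpr one_ne_zero)
  have halg : IsAlgebraic (Algebra.adjoin K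
      ((fun k => algebraMap (MvPolynomial σ K) Ω (X k)) '' {i}ᶜ))
      ((((twist wt lo q).map (algebraMap (MvPolynomial σ K) Ω)).roots.map κ).prod) := by
    refine Multiset.prod_induction (IsAlgebraic (Algebra.adjoin K
      ((fun k => algebraMap (MvPolynomial σ K) Ω (X k)) '' {i}ᶜ))) _
      (fun _ _ => IsAlgebraic.mul) isAlgebraic_one fun a ha => ?_
    obtain ⟨s, hs, rfl⟩ := Multiset.mem_map.mp ha
    refine (hκ s ?_).2
    rw [← Polynomial.eval_map]
    exact (Polynomial.mem_roots'.mp hs).2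
  have hle := degreeOf_le_of_isAlgebraic_ratio
    (IsScalarTower.toAlgHom K (MvPolynomial σ K) Ω) hΩ i halg
    (mul_ne_zero (hmono ν) (hne hV hqV)) hrel
  rw [degreeOf_mul_eq (hmono μ) (hne hU hqU), degreeOf_mul_eq (hmono ν) (hne hV hqV),
    degreeOf_pow_eq i _ _ (monomial_eq_zero.not.mpr one_ne_zero),
    degreeOf_pow_eq i _ _ (monomial_eq_zero.not.mpr one_ne_zero),
    degreeOf_monomial_eq _ _ one_ne_zero, degreeOf_monomial_eq _ _ one_ne_zero] at hle
  -- The resultant with U is only used through its degree being nonnegative; the one with V costs w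
  -- * (N * e) for V and N * w * e for q. The common factor w is then cancelled.
  have hres := degreeOf_resultant_le i (twist wt lo q) (twist wt (N * lo) V) w (N * w) e (N * e)
    (degreeOf_coeff_twist_le _ _ fun m hm => (hq' m hm).1)
    (degreeOf_coeff_twist_le _ _ fun m hm => (hsupp hV m hm).1)
  have hfin : w * μ i ≤ w * (ν i + 2 * N * e) := by
    calc w * μ i ≤ w * ν i + (w * (N * e) + N * w * e) := by omega
      _ = w * (ν i + 2 * N * e) := by ring
  exact Nat.le_of_mul_le_mul_left hfin hw

/-! ### Minimal relations between monomials -/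

section Circuit
variable {σ K L : Type*} [Field K] [Field L] [Algebra K L] {q : MvPolynomial σ K}
  (ι : MvPolynomial σ K →ₐ[K] L) {i j : σ} (D : Derivation ℤ L L)

theorem iterate_deriv_map (hD : ∀ G, D (ι G) = ι (tangentDeriv q i j G)) (m : σ →₀ ℕ) (r : ℕ) :
    D^[r] (ι (monomial m 1)) = ι (monomial m 1) * ι (tangentRatio q i j m r) := by
  have h : ∀ G, D^[r] (ι G) = ι ((tangentDeriv q i j)^[r] G) := by
    intro G
    induction r with
    | zero => rfl
    | succ r ih => rw [Function.iterate_succ_apply', ih, hD, Function.iterate_succ_apply' (tangentDeriv q i j)]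
  rw [h, iterate_tangentDeriv_monomial, map_mul, mul_comm]

theorem iterate_deriv_const_mul {c : L} (hc : D c = 0) (x : L) (r : ℕ) :
    D^[r] (c * x) = c * D^[r] x := by
  induction r with
  | zero => rfl
  | succ r ih =>
    rw [Function.iterate_succ_apply', ih, Derivation.leibniz, hc, smul_zero, add_zero,
      smul_eq_mul, Function.iterate_succ_apply']

theorem iterate_deriv_sum {κ : Type*} (s : Finset κ) (x : κ → L) (r : ℕ) :
    D^[r] (∑ m ∈ s, x m) = ∑ m ∈ s, D^[r] (x m) := by
  induction r generalizing x with
  | zero => rfl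
  | succ r ih => simp only [Function.iterate_succ_apply, map_sum, ih]

/-- Cramer's rule for a relation between monomials none of which can be omitted. -/
theorem exists_monomial_relation [DecidableEq σ] (hι : ∀ G, ι G = 0 ↔ q ∣ G)
    (hD : ∀ G, D (ι G) = ι (tangentDeriv q i j G))
    (hX : ∀ m, ι (monomial m 1) ≠ 0) {J : Finset (σ →₀ ℕ)} {c : (σ →₀ ℕ) → L}
    (hc : ∀ m, D (c m) = 0) (hrel : ∑ m ∈ J, c m * ι (monomial m 1) = 0) {μ ν : σ →₀ ℕ}
    (hμ : μ ∈ J) (hν : ν ∈ J) (hμν : ν ≠ μ) (hcν : c ν ≠ 0)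
    (hmin : ∀ c' : (σ →₀ ℕ) → L, (∀ m, D (c' m) = 0) →
      ∑ m ∈ J.erase μ, c' m * ι (monomial m 1) = 0 → ∀ m ∈ J.erase μ, c' m = 0)
    {wt : σ → ℤ} {k : σ} {e : ℕ} {lo hi : ℤ}
    (hq : q ∈ restrictSupport K (weightBox wt k e lo hi 1)) :
    ∃ U V : MvPolynomial σ K,
      U ∈ restrictSupport K (weightBox wt k e lo hi ((J.card - 1).choose 2)) ∧
      V ∈ restrictSupport K (weightBox wt k e lo hi ((J.card - 1).choose 2)) ∧
      ¬ q ∣ U ∧ ¬ q ∣ V ∧ ∃ c' : L, D c' = 0 ∧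
        c' * (ι (monomial μ 1) * ι U) = ι (monomial ν 1) * ι V := by
  let r := J.card - 1
  have hr : (J.erase μ).card = r := Finset.card_erase_of_mem hμ
  let f : J.erase μ ≃ Fin r := (J.erase μ).equivFinOfCardEq hr
  let e' : Fin r → (σ →₀ ℕ) := fun t => (f.symm t : σ →₀ ℕ)
  have hsum : ∀ g : (σ →₀ ℕ) → L, ∑ t, g (e' t) = ∑ m ∈ J.erase μ, g m := by
    intro g
    rw [← Finset.sum_coe_sort (J.erase μ) g]
    exact Equiv.sum_comp f.symm fun m : J.erase μ => g m
  let M : Matrix (Fin r) (Fin r) (MvPolynomial σ K) :=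
    Matrix.of fun a t => tangentRatio q i j (e' t) a
  -- In Cramer's rule the column of ν is the one replaced by that of μ.
  let t₀ : Fin r := f ⟨ν, Finset.mem_erase.mpr ⟨hμν, hν⟩⟩
  have ht₀ : e' t₀ = ν := by simp [e', t₀]
  let col : Fin r → MvPolynomial σ K := fun a => tangentRatio q i j μ a
  let M' : Matrix (Fin r) (Fin r) L := Matrix.of fun a t => ι (tangentRatio q i j (e' t) a)
  have hM' : ι M.det = M'.det := by
    have := (ι : MvPolynomial σ K →+* L).map_det M
    exact this
  have hMu : ι (M.updateCol t₀ col).det = (M'.updateCol t₀ fun a => ι (col a)).det := by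
    have h1 := (ι : MvPolynomial σ K →+* L).map_det (M.updateCol t₀ col)
    refine h1.trans (congrArg Matrix.det ?_)
    ext a t
    simp only [RingHom.mapMatrix_apply, Matrix.map_apply, Matrix.updateCol_apply]
    split_ifs <;> rfl
  -- Up to a product of monomials this is the Wronskian of the monomials other than μ; its vanishing
  -- would give a nontrivial relation without μ, against `hmin`.
  have hdet : M'.det ≠ 0 := by
    intro h0
    have hW : (Matrix.of fun a t : Fin r => D^[a] (ι (monomial (e' t) 1))).det = 0 := by
      have : (Matrix.of fun a t : Fin r => D^[a] (ι (monomial (e' t) 1))) =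
          Matrix.of fun a t => ι (monomial (e' t) 1) * M' a t := by
        ext a t
        exact iterate_deriv_map ι D hD _ _
      rw [this, Matrix.det_mul_row, h0, mul_zero]
    obtain ⟨b, hb, hb0, hbs⟩ := exists_constant_relation_of_det_eq_zero D r _ hW
    let c' : (σ →₀ ℕ) → L := fun m => if h : m ∈ J.erase μ then b (f ⟨m, h⟩) else 0
    have hc'e : ∀ t, c' (e' t) = b t := by
      intro t
      simp only [c', e', dif_pos (f.symm t).2, Subtype.coe_eta, Equiv.apply_symm_apply]
    have h1 := hmin c' (fun m => by
      by_cases h : m ∈ J.erase μ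
      · simp only [c', dif_pos h]; exact hb _
      · simp only [c', dif_neg h, map_zero]) (by
      rw [← hsum fun m => c' m * ι (monomial m 1)]
      simpa only [hc'e] using hbs)
    refine hb0 (funext fun t => ?_)
    rw [← hc'e]
    exact h1 _ (f.symm t).2
  -- Differentiating the relation a times, with constant coefficients, gives the a-th equation of a
  -- linear system whose unknowns are the terms c_m X^m.
  have hrow : ∀ a : Fin r, c μ * ι (monomial μ 1) * ι (col a) =
      ∑ t, (-(c (e' t) * ι (monomial (e' t) 1))) * M' a t := by
    intro a
    have h1 : D^[a] (∑ m ∈ J, c m * ι (monomial m 1)) = 0 := by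
      rw [hrel]
      exact Function.iterate_fixed (map_zero D) _
    rw [iterate_deriv_sum] at h1
    simp only [iterate_deriv_const_mul D (hc _), iterate_deriv_map ι D hD] at h1
    rw [← Finset.add_sum_erase _ _ hμ, ← hsum fun m =>
      c m * (ι (monomial m 1) * ι (tangentRatio q i j m a))] at h1
    simp only [neg_mul, Finset.sum_neg_distrib]
    rw [eq_neg_iff_add_eq_zero, ← h1]
    simp only [mul_assoc, col, M', Matrix.of_apply]
  have hcr : c μ * ι (monomial μ 1) * ι (M.updateCol t₀ col).det =
      -(c ν * ι (monomial ν 1)) * ι M.det := by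
    rw [hMu, hM', ← Matrix.det_updateCol_smul]
    have : ((c μ * ι (monomial μ 1)) • fun a => ι (col a)) =
        fun a => ∑ t, (-(c (e' t) * ι (monomial (e' t) 1))) • M' a t := by
      funext a
      exact hrow a
    rw [this, Matrix.det_updateCol_sum, smul_eq_mul, ht₀]
  have hV : ι M.det ≠ 0 := hM' ▸ hdet
  have hU : ι (M.updateCol t₀ col).det ≠ 0 := by
    intro h0
    rw [h0, mul_zero, eq_comm, mul_eq_zero] at hcr
    exact hcr.elim (neg_ne_zero.mpr (mul_ne_zero hcν (hX _))) hV
  refine ⟨(M.updateCol t₀ col).det, M.det, ?_, ?_, fun h => hU ((hι _).mpr h),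
    fun h => hV ((hι _).mpr h), -(c μ / c ν), ?_, ?_⟩
  · refine det_mem_weightBox _ fun a t => ?_
    rw [Matrix.updateCol_apply]
    split_ifs
    · exact tangentRatio_mem_weightBox hq _ _ _ _
    · exact tangentRatio_mem_weightBox hq _ _ _ _
  · exact det_mem_weightBox _ fun a t => tangentRatio_mem_weightBox hq _ _ _ _
  · rw [map_neg, Derivation.leibniz_div]
    simp [hc]
  · field_simp
    linear_combination -hcr

/-- Relations are built from those of minimal support. By induction on the support, a relation that
is not minimal splits into two relations, each with a vanishing coefficient; if every minimal
relation lies inside S or inside its complement, the S-part of any relation is a relation. -/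
theorem sum_filter_eq_zero_of_circuits {κ : Type*} [DecidableEq κ] (x : κ → L) (S : κ → Prop)
    [DecidablePred S] (T : Finset κ)
    (hcirc : ∀ (J : Finset κ) (c : κ → L), J ⊆ T → (∀ m, D (c m) = 0) →
      (∀ m ∈ J, c m ≠ 0) → ∑ m ∈ J, c m * x m = 0 →
      (∀ c' : κ → L, (∀ m, D (c' m) = 0) → ∑ m ∈ J, c' m * x m = 0 → (∃ m ∈ J, c' m = 0) →
        ∀ m ∈ J, c' m = 0) → (∀ m ∈ J, S m) ∨ ∀ m ∈ J, ¬ S m) :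
    ∀ (J : Finset κ) (c : κ → L), J ⊆ T → (∀ m, D (c m) = 0) → ∑ m ∈ J, c m * x m = 0 →
      ∑ m ∈ J with S m, c m * x m = 0 := by
  intro J
  induction J using Finset.strongInduction with
  | H J ih =>
  intro c hn hc hrel
  have hzero : ∀ c' : κ → L, (∀ m, D (c' m) = 0) → ∑ m ∈ J, c' m * x m = 0 →
      (∃ m ∈ J, c' m = 0) → ∑ m ∈ J with S m, c' m * x m = 0 := by
    rintro c' hc' hrel' ⟨m, hm, hm0⟩
    have h1 := ih (J.erase m) (Finset.erase_ssubset hm) c'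
      ((Finset.erase_subset _ _).trans hn) hc' (by
        rw [Finset.sum_erase _ (by rw [hm0, zero_mul]), hrel'])
    rwa [Finset.filter_erase, Finset.sum_erase _ (by rw [hm0, zero_mul])] at h1
  by_cases h0 : ∃ m ∈ J, c m = 0
  · exact hzero c hc hrel h0
  push Not at h0
  by_cases hmin : ∀ c' : κ → L, (∀ m, D (c' m) = 0) → ∑ m ∈ J, c' m * x m = 0 →
      (∃ m ∈ J, c' m = 0) → ∀ m ∈ J, c' m = 0
  · rcases hcirc J c hn hc h0 hrel hmin with h | h
    · rw [Finset.filter_true_of_mem h, hrel]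
    · rw [Finset.filter_false_of_mem h, Finset.sum_empty]
  push Not at hmin
  obtain ⟨c', hc', hrel', hm0, m₁, hm₁, hne⟩ := hmin
  have h1 := hzero c' hc' hrel' hm0
  -- The multiple of c' is chosen to kill the coefficient at m₁; the ratio is again a constant of D.
  have h2 := hzero (fun m => c m - c m₁ / c' m₁ * c' m) (fun m => by
      rw [map_sub, Derivation.leibniz, Derivation.leibniz_div]
      simp [hc, hc']) (by
      simp only [sub_mul, Finset.sum_sub_distrib, hrel, mul_assoc, ← Finset.mul_sum, hrel',
        mul_zero, sub_zero]) ⟨m₁, hm₁, by field_simp; ring⟩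
  simpa only [sub_mul, Finset.sum_sub_distrib, mul_assoc, ← Finset.mul_sum, h1, mul_zero,
    sub_zero] using h2

end Circuit

/-! ### Cutting a polynomial below a gap -/

section LowPart
variable {σ K : Type*} [Field K]

/-- The sum of the terms of `F` whose exponent of `X_i` is at most `α`. -/
noncomputable def lowPart (i : σ) (α : ℕ) (F : MvPolynomial σ K) : MvPolynomial σ K :=
  ∑ m ∈ F.support with m i ≤ α, monomial m (coeff m F)

theorem coeff_lowPart (i : σ) (α : ℕ) (F : MvPolynomial σ K) (m : σ →₀ ℕ) :
    coeff m (lowPart i α F) = if m i ≤ α then coeff m F else 0 := by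
  classical
  rw [lowPart, coeff_sum]
  simp only [coeff_monomial]
  rw [Finset.sum_ite_eq']
  simp only [Finset.mem_filter, mem_support_iff]
  split_ifs with h1 h2 h2
  · rfl
  · exact (h2 h1.2).elim
  · exact (not_not.mp fun h => h1 ⟨h, h2⟩).symm
  · rfl

theorem lowPart_eulerDeriv (i j : σ) (α : ℕ) (F : MvPolynomial σ K) :
    lowPart i α (eulerDeriv j F) = eulerDeriv j (lowPart i α F) := by
  ext m
  rw [coeff_lowPart, coeff_eulerDeriv, coeff_eulerDeriv, coeff_lowPart]
  split_ifs <;> simp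

/-- Multiplication by a polynomial without `X_i` commutes with taking the low part. -/
theorem lowPart_mul_of_degreeOf_eq_zero (i : σ) (α : ℕ) {g : MvPolynomial σ K}
    (hg : degreeOf i g = 0) (F : MvPolynomial σ K) :
    lowPart i α (g * F) = g * lowPart i α F := by
  classical
  ext m
  rw [coeff_lowPart, coeff_mul, coeff_mul]
  have h : ∀ x ∈ Finset.HasAntidiagonal.antidiagonal m, coeff x.1 g * coeff x.2 (lowPart i α F) =
      if m i ≤ α then coeff x.1 g * coeff x.2 F else 0 := by
    intro x hx
    rw [coeff_lowPart]
    by_cases hx1 : coeff x.1 g = 0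
    · simp [hx1]
    have h1 : x.1 i = 0 := by
      have := degreeOf_le_iff.mp hg.le x.1 (mem_support_iff.mpr hx1)
      omega
    rw [← Finset.HasAntidiagonal.mem_antidiagonal.mp hx, Finsupp.add_apply, h1, zero_add]
    split_ifs <;> simp
  rw [Finset.sum_congr rfl h]
  split_ifs <;> simp

end LowPart

/-! ### The gap theorem for one irreducible factor -/

section Gap

/-- Every linear form `b m_i + a m_j` with `a ≠ 0` takes two values on the support of `q`. -/
def IsPlanar {σ K : Type*} [Field K] (i j : σ) (q : MvPolynomial σ K) : Prop :=
  ∀ a b : ℤ, a ≠ 0 → ∃ m ∈ q.support, ∃ m' ∈ q.support, b * m i + a * m j ≠ b * m' i + a * m' j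

variable {σ K : Type*} [Field K] {q : MvPolynomial σ K} {i j : σ}

theorem IsPlanar.degreeOf_pos (h : IsPlanar i j q) : 0 < degreeOf j q := by
  obtain ⟨m, hm, m', hm', hne⟩ := h 1 0 one_ne_zero
  by_contra h0
  have h1 := degreeOf_le_iff.mp (show degreeOf j q ≤ 0 by omega) m hm
  have h2 := degreeOf_le_iff.mp (show degreeOf j q ≤ 0 by omega) m' hm'
  refine hne ?_
  rw [Nat.le_zero.mp h1, Nat.le_zero.mp h2]
  simp

theorem IsPlanar.ne_zero (h : IsPlanar i j q) : q ≠ 0 := by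
  rintro rfl
  simpa using h.degreeOf_pos

theorem IsPlanar.not_dvd_X (h : IsPlanar i j q) (hij : i ≠ j) : ¬ q ∣ X i := by
  rintro ⟨H, hH⟩
  have hH0 : H ≠ 0 := by rintro rfl; rw [mul_zero] at hH; exact X_ne_zero i hH
  have h1 := congrArg (degreeOf j) hH
  rw [degreeOf_mul_eq h.ne_zero hH0, degreeOf_X_of_ne hij.symm] at h1
  have := h.degreeOf_pos
  omega

/-- The total degree of θ_j q is at most that of q, so a quotient is a constant c. Comparing
coefficients, every exponent of X_j in q equals c, against planarity. -/
theorem IsPlanar.not_dvd_eulerDeriv [CharZero K] (h : IsPlanar i j q) : ¬ q ∣ eulerDeriv j q := by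
  rintro ⟨H, hH⟩
  have hq0 := h.ne_zero
  obtain ⟨m, hm, m', hm', hne⟩ := h 1 0 one_ne_zero
  have hc : ∃ c, H = C c := by
    by_cases hH0 : H = 0
    · exact ⟨0, by rw [hH0, C_0]⟩
    have h1 := totalDegree_mul_of_isDomain hq0 hH0
    have h2 : (eulerDeriv j q).totalDegree ≤ q.totalDegree :=
      Finset.sup_mono (support_eulerDeriv_subset j q)
    rw [hH] at h2
    exact ⟨_, totalDegree_eq_zero_iff_eq_C.mp (by omega)⟩
  obtain ⟨c, rfl⟩ := hc
  have h3 : ∀ m ∈ q.support, (m j : K) = c := by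
    intro m hm
    have := congrArg (coeff m) hH
    rw [coeff_eulerDeriv, mul_comm q, coeff_C_mul] at this
    exact mul_right_cancel₀ (mem_support_iff.mp hm) this
  refine hne ?_
  have h4 : m j = m' j := Nat.cast_injective (R := K) ((h3 m hm).trans (h3 m' hm').symm)
  rw [h4]
  simp

/-- A minimal relation reaching across the gap would contain monomials ν below and μ above it, and
`exponent_le_of_monomial_relation` forbids exponents so far apart. -/
theorem dvd_lowPart.{u} {σ : Type} {K : Type u} [Field K] [CharZero K] {q : MvPolynomial σ K}
    {i j : σ} (hq : Irreducible q) (hij : i ≠ j) (hi : 0 < degreeOf i q) (hp : IsPlanar i j q)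
    {F : MvPolynomial σ K} {ℓ α : ℕ} (hcard : F.support.card ≤ ℓ)
    (hgap : ∀ m ∈ F.support, m i ≤ α ∨ α + (ℓ - 1) * (ℓ - 2) * degreeOf i q < m i)
    (hqF : q ∣ F) : q ∣ lowPart i α F := by
  classical
  obtain ⟨L, _, _, ι, hι, hfrac, hlift, hder⟩ := exists_function_field hq
  have hj := hp.degreeOf_pos
  have : CharZero L := charZero_of_injective_algebraMap (algebraMap K L).injective
  obtain ⟨D, hD⟩ := hder (tangentDeriv q i j) (tangentDeriv_self q i j)
  -- q divides no variable: X_i is excluded by the degree in X_j, the other variables by the degree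
  -- in X_i.
  have hmono : ∀ m, ι (monomial m 1) ≠ 0 := by
    intro m h0
    have h1 : ∀ k, ¬ q ∣ X k := by
      intro k hk
      have h2 : degreeOf i q ≤ degreeOf i (X k : MvPolynomial σ K) := by
        obtain ⟨H, hH⟩ := hk
        have hH0 : H ≠ 0 := by rintro rfl; rw [mul_zero] at hH; exact X_ne_zero k hH
        rw [hH, degreeOf_mul_eq hq.ne_zero hH0]
        omega
      by_cases hki : k = i
      · exact hp.not_dvd_X hij (hki ▸ hk)
      · rw [degreeOf_X_of_ne (Ne.symm hki)] at h2
        omega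
    rw [hι, monomial_eq, C_1, one_mul, Finsupp.prod] at h0
    obtain ⟨k, _, hk⟩ := (hq.prime.dvd_finsetProd_iff _).mp h0
    exact h1 k (hq.prime.dvd_of_dvd_pow hk)
  have hCD : ∀ a : K, D (algebraMap K L a) = 0 := by
    intro a
    rw [← ι.commutes, hD, Derivation.map_algebraMap, map_zero]
  have hmap : ∀ m, ι (monomial m (coeff m F)) =
      algebraMap K L (coeff m F) * ι (monomial m 1) := by
    intro m
    rw [← mul_one (coeff m F), ← C_mul_monomial, map_mul, mul_one, ← algebraMap_eq, ι.commutes]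
  rw [← hι, lowPart, map_sum]
  simp only [hmap]
  refine sum_filter_eq_zero_of_circuits D (fun m => ι (monomial m 1)) (fun m => m i ≤ α) F.support
    ?_ F.support (fun m => algebraMap K L (coeff m F)) subset_rfl (fun _ => hCD _) ?_
  swap
  · rw [← (hι F).mpr hqF]
    conv_rhs => rw [F.as_sum, map_sum]
    exact Finset.sum_congr rfl fun m _ => (hmap m).symm
  intro J c hJ hc hne hrel hmin
  by_contra! hcon
  obtain ⟨⟨μ, hμ, hμα⟩, ν, hν, hνα⟩ := hcon
  have hgapμ := (hgap μ (hJ hμ)).resolve_left (by omega)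
  have hνμ : ν ≠ μ := by rintro rfl; omega
  -- The weight is orthogonal to μ - ν in the coordinates i and j, so both monomials weigh the same.
  -- Its j-entry is nonzero because the gap separates μ_i from ν_i.
  let wt : σ → ℤ := fun k => if k = i then (ν j : ℤ) - μ j else
    if k = j then (μ i : ℤ) - ν i else 0
  have hwti : wt i = (ν j : ℤ) - μ j := if_pos rfl
  have hwtj : wt j = (μ i : ℤ) - ν i := by simp only [wt, if_neg hij.symm, if_pos]
  have hwt : ∀ k, k ≠ i → k ≠ j → wt k = 0 := fun k h1 h2 => by
    simp only [wt, if_neg h1, if_neg h2]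
  have hweight : ∀ m : σ →₀ ℕ, Finsupp.weight wt m = wt i * m i + wt j * m j := by
    intro m
    induction m using Finsupp.induction_linear with
    | zero => simp
    | add f g hf hg => rw [map_add, hf, hg]; simp only [Finsupp.add_apply]; push_cast; ring
    | single k n =>
      rw [Finsupp.weight_single]
      by_cases h1 : k = i
      · subst h1
        simp [Finsupp.single_eq_of_ne hij.symm, mul_comm]
      by_cases h2 : k = j
      · subst h2
        simp [Finsupp.single_eq_of_ne hij, mul_comm]
      · simp [hwt k h1 h2, Finsupp.single_eq_of_ne (Ne.symm h1),
          Finsupp.single_eq_of_ne (Ne.symm h2)]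
  have hwtj0 : wt j ≠ 0 := by rw [hwtj]; omega
  have hsupp : q.support.Nonempty := support_nonempty.mpr hq.ne_zero
  obtain ⟨m₀, hm₀, hmin₀⟩ := q.support.exists_min_image (fun m => Finsupp.weight wt m) hsupp
  obtain ⟨m₁, hm₁, hmax₁⟩ := q.support.exists_max_image (fun m => Finsupp.weight wt m) hsupp
  obtain ⟨w, hw⟩ := Int.eq_ofNat_of_zero_le (sub_nonneg.mpr (hmin₀ m₁ hm₁))
  have hm₁w : Finsupp.weight wt m₁ = Finsupp.weight wt m₀ + w := by linarith
  -- Planarity says precisely that this weight, having a nonzero j-entry, is not constant on the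
  -- support of q.
  have hw0 : 0 < w := by
    rcases Nat.eq_zero_or_pos w with rfl | h
    · obtain ⟨m, hm, m', hm', hmm⟩ := hp (wt j) (wt i) hwtj0
      refine (hmm ?_).elim
      rw [← hweight, ← hweight]
      have h1 := hmin₀ m hm
      have h2 := hmin₀ m' hm'
      have h3 := hmax₁ m hm
      have h4 := hmax₁ m' hm'
      push_cast at hm₁w
      linarith
    · exact h
  have hbox : q ∈ restrictSupport K (weightBox wt i (degreeOf i q) (Finsupp.weight wt m₀)
      (Finsupp.weight wt m₀ + w) 1) := by
    rw [mem_restrictSupport_iff]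
    intro m hm
    refine ⟨?_, ?_, ?_⟩
    · rw [one_mul]; exact degreeOf_le_iff.mp le_rfl m hm
    · simpa using hmin₀ m hm
    · rw [← hm₁w]; simpa using hmax₁ m hm
  obtain ⟨U, V, hU, hV, hqU, hqV, c', hc', hcUV⟩ := exists_monomial_relation ι D hι hD hmono hc
    hrel hμ hν hνμ (hne ν hν) (fun c' hc' hs m hm => by
      have h1 := hmin (fun m => if m = μ then 0 else c' m) (fun m => by
          split_ifs
          · exact map_zero D
          · exact hc' m) (by
        rw [← Finset.add_sum_erase _ _ hμ, if_pos rfl, zero_mul, zero_add, ← hs]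
        refine Finset.sum_congr rfl fun m hm => ?_
        rw [if_neg (Finset.ne_of_mem_erase hm)]) ⟨μ, hμ, if_pos rfl⟩ m (Finset.mem_of_mem_erase hm)
      simpa only [if_neg (Finset.ne_of_mem_erase hm)] using h1) hbox
  have hle := exponent_le_of_monomial_relation ι hι hlift hij hi hj hwt hwtj0 hbox hm₀ rfl hm₁ hm₁w
    hw0 hU hV hqU hqV (by rw [hweight, hweight, hwti, hwtj]; ring)
    (isAlgebraic_of_deriv_eq_zero ι hι hfrac hij hj (hp.not_dvd_X hij) hp.not_dvd_eulerDeriv D hD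
      hc') hcUV
  have hJℓ : J.card ≤ ℓ := (Finset.card_le_card hJ).trans hcard
  -- The Wronskians have order |J| - 1, which is where the factor (ℓ-1)(ℓ-2) in the gap comes from.
  have h2 : 2 * (J.card - 1).choose 2 ≤ (ℓ - 1) * (ℓ - 2) := by
    rw [Nat.choose_two_right, Nat.mul_div_cancel' (Nat.even_mul_pred_self _).two_dvd]
    exact Nat.mul_le_mul (by omega) (by omega)
  have h3 := Nat.mul_le_mul_right (degreeOf i q) h2
  omega

end Gap

/-! ### From a factor to its powers -/

section Powers
variable {σ K : Type*} [Field K] {q : MvPolynomial σ K}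

/-- In characteristic 0 and with q ∤ d q, applying d lowers a positive multiplicity of q by exactly
one. -/
theorem pow_dvd_of_forall_dvd_iterate [CharZero K] (hq : Prime q)
    (d : Derivation K (MvPolynomial σ K) (MvPolynomial σ K)) (hd : ¬ q ∣ d q) :
    ∀ (ν : ℕ) (G : MvPolynomial σ K), (∀ a < ν, q ∣ d^[a] G) → q ^ ν ∣ G
  | 0, G, _ => by simp
  | ν + 1, G, h => by
    by_cases hG : G = 0
    · rw [hG]; exact dvd_zero _
    have h1 : q ^ ν ∣ d G := pow_dvd_of_forall_dvd_iterate hq d hd ν (d G) fun a ha => by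
      rw [← Function.iterate_succ_apply]
      exact h (a + 1) (by omega)
    obtain ⟨H, hH, hqH⟩ := (FiniteMultiplicity.of_not_isUnit hq.not_isUnit
      hG).exists_eq_pow_mul_and_not_dvd
    set m := multiplicity q G
    rw [hH]
    by_cases hm : ν + 1 ≤ m
    · exact dvd_mul_of_dvd_left (pow_dvd_pow q hm) _
    exfalso
    have hqG : q ∣ G := h 0 (by omega)
    obtain ⟨k, hk⟩ : ∃ k, m = k + 1 := by
      refine Nat.exists_eq_succ_of_ne_zero fun h0 => hqH ?_
      rwa [hH, h0, pow_zero, one_mul] at hqG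
    have h2 : q ^ (k + 1) ∣ d G := (pow_dvd_pow q (by omega)).trans h1
    have h3 : d G = q ^ k * (q * d H + ((k + 1 : ℕ) : MvPolynomial σ K) * d q * H) := by
      rw [hH, hk, Derivation.leibniz, Derivation.leibniz_pow]
      simp only [smul_eq_mul, nsmul_eq_mul, Nat.add_sub_cancel]
      ring
    rw [h3, pow_succ, mul_dvd_mul_iff_left (pow_ne_zero _ hq.ne_zero)] at h2
    rw [dvd_add_right (dvd_mul_right q _)] at h2
    rcases hq.dvd_or_dvd h2 with h4 | h4
    · rcases hq.dvd_or_dvd h4 with h5 | h5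
      · refine hq.not_isUnit (isUnit_of_dvd_unit h5 ?_)
        rw [← map_natCast (C : K →+* MvPolynomial σ K)]
        exact (IsUnit.mk0 _ (Nat.cast_ne_zero.mpr (Nat.succ_ne_zero k))).map C
      · exact hd h5
    · exact hqH h4

theorem pow_dvd_iterate (d : Derivation K (MvPolynomial σ K) (MvPolynomial σ K)) :
    ∀ (a b : ℕ) (G : MvPolynomial σ K), q ^ (a + b) ∣ G → q ^ b ∣ d^[a] G
  | 0, b, G, h => by simpa using h
  | a + 1, b, G, ⟨H, hH⟩ => by
    refine pow_dvd_iterate d a b (d G) ?_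
    rw [hH, show a + 1 + b = a + b + 1 by ring, Derivation.leibniz, Derivation.leibniz_pow]
    simp only [smul_eq_mul, nsmul_eq_mul, Nat.add_sub_cancel]
    exact dvd_add (dvd_mul_of_dvd_left (pow_dvd_pow q (Nat.le_succ _)) _)
      (dvd_mul_of_dvd_right (dvd_mul_of_dvd_right (dvd_mul_right _ _) _) _)

end Powers

/-- The iterates of θ_j commute with cutting and do not enlarge the support, so the gap theorem
applies to each of them with the same ℓ and α. -/
theorem pow_dvd_lowPart_of_irreducible.{u} {σ : Type} {K : Type u} [Field K] [CharZero K]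
    {q : MvPolynomial σ K} {i j : σ} (hq : Irreducible q) (hij : i ≠ j) (hi : 0 < degreeOf i q)
    (hp : IsPlanar i j q) {F : MvPolynomial σ K} {ℓ α : ℕ} (hcard : F.support.card ≤ ℓ)
    (hgap : ∀ m ∈ F.support, m i ≤ α ∨ α + (ℓ - 1) * (ℓ - 2) * degreeOf i q < m i) {ν : ℕ}
    (hqF : q ^ ν ∣ F) : q ^ ν ∣ lowPart i α F := by
  refine pow_dvd_of_forall_dvd_iterate hq.prime (eulerDeriv j) hp.not_dvd_eulerDeriv ν _
    fun a ha => ?_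
  have h1 : q ∣ (eulerDeriv j)^[a] F := by
    rw [← pow_one q]
    exact pow_dvd_iterate _ a 1 F ((pow_dvd_pow q (by omega)).trans hqF)
  have h2 : ∀ a, (eulerDeriv j)^[a] (lowPart i α F) = lowPart i α ((eulerDeriv j)^[a] F) := by
    intro a
    induction a with
    | zero => rfl
    | succ a ih => rw [Function.iterate_succ_apply', ih, Function.iterate_succ_apply' (eulerDeriv j),
        lowPart_eulerDeriv]
  have h3 : ∀ a, ((eulerDeriv j)^[a] F).support ⊆ F.support := by
    intro a
    induction a with
    | zero => exact subset_rfl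
    | succ a ih =>
      rw [Function.iterate_succ_apply']
      exact (support_eulerDeriv_subset _ _).trans ih
  rw [h2]
  exact dvd_lowPart hq hij hi hp ((Finset.card_le_card (h3 a)).trans hcard)
    (fun m hm => hgap m (h3 a hm)) h1

namespace Sparse

/-! ### The gap theorem for products of multidimensional factors -/

section Multidimensional
variable {K : Type*} [Field K] {n : ℕ}

/-- If no j works, then on the support every coordinate is an affine function of the i-th one, and
the Newton polytope spans at most a line. -/
theorem IsMultidimensional.exists_isPlanar {q : MvPolynomial (Fin n) K} (hq : IsMultidimensional q)
    (i : Fin n) : ∃ j, i ≠ j ∧ IsPlanar i j q := by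
  by_contra! hcon
  have h1 : ∀ j, ∃ c : ℝ, ∀ m ∈ q.support, ∀ m' ∈ q.support,
      (m j : ℝ) - m' j = c * ((m i : ℝ) - m' i) := by
    intro j
    by_cases hij : i = j
    · subst hij
      exact ⟨1, fun m _ m' _ => (one_mul _).symm⟩
    have h2 := hcon j hij
    simp only [IsPlanar] at h2
    push Not at h2
    obtain ⟨a, b, ha, hab⟩ := h2
    refine ⟨-(b / a), fun m hm m' hm' => ?_⟩
    have h3 := hab m hm m' hm'
    have h4 : (b : ℝ) * m i + a * m j = b * m' i + a * m' j := by exact_mod_cast h3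
    have ha' : (a : ℝ) ≠ 0 := by exact_mod_cast ha
    field_simp
    linear_combination h4
  choose c hc using h1
  have hle : vectorSpan ℝ (newtonPolytope q) ≤ Submodule.span ℝ {c} := by
    rw [newtonPolytope, ← direction_affineSpan, affineSpan_convexHull, direction_affineSpan,
      vectorSpan_def, Submodule.span_le]
    rintro _ ⟨_, ⟨m, hm, rfl⟩, _, ⟨m', hm', rfl⟩, rfl⟩
    refine Submodule.mem_span_singleton.mpr ⟨(m i : ℝ) - m' i, funext fun j => ?_⟩
    simp only [Pi.smul_apply, smul_eq_mul, vsub_eq_sub, Pi.sub_apply]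
    rw [hc j m hm m' hm', mul_comm]
  have h2 := Submodule.finrank_mono hle
  have h3 := finrank_span_le_card (R := ℝ) ({c} : Set (Fin n → ℝ))
  rw [Set.toFinset_singleton, Finset.card_singleton] at h3
  have h4 : 2 ≤ Module.finrank ℝ (vectorSpan ℝ (newtonPolytope q)) := hq
  omega

theorem dvd_of_forall_irreducible_pow_dvd {R : Type*} [CommRing R] [IsDomain R]
    [UniqueFactorizationMonoid R] {a b : R} (ha : a ≠ 0)
    (h : ∀ p : R, Irreducible p → ∀ k, p ^ k ∣ a → p ^ k ∣ b) : a ∣ b := by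
  induction a using UniqueFactorizationMonoid.induction_on_coprime with
  | h0 => exact (ha rfl).elim
  | h1 hu => exact hu.dvd
  | hpr k hp => exact h _ hp.irreducible k dvd_rfl
  | hcp hxy hx hy =>
    have hx0 := left_ne_zero_of_mul ha
    have hy0 := right_ne_zero_of_mul ha
    exact hxy.mul_dvd (hx hx0 fun p hp k hk => h p hp k (dvd_mul_of_dvd_left hk _))
      (hy hy0 fun p hp k hk => h p hp k (dvd_mul_of_dvd_right hk _))

/-- Powers of `g` dividing a polynomial with a gap in the exponents of `X_i` divide the part of the
polynomial below the gap. -/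
theorem pow_dvd_lowPart [CharZero K] {g F : MvPolynomial (Fin n) K} (hg0 : g ≠ 0)
    (hg : ∀ q, Irreducible q → q ∣ g → IsMultidimensional q) {i : Fin n} {e ℓ α : ℕ}
    (hge : degreeOf i g ≤ e) (hcard : F.support.card ≤ ℓ)
    (hgap : ∀ m ∈ F.support, m i ≤ α ∨ α + (ℓ - 1) * (ℓ - 2) * e < m i) {ν : ℕ}
    (hgF : g ^ ν ∣ F) : g ^ ν ∣ lowPart i α F := by
  refine dvd_of_forall_irreducible_pow_dvd (pow_ne_zero _ hg0) fun q hq k hk => ?_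
  have hqF := hk.trans hgF
  rcases Nat.eq_zero_or_pos k with rfl | hk0
  · simp
  have hqg : q ∣ g := hq.prime.dvd_of_dvd_pow ((dvd_pow_self q (by omega)).trans hk)
  -- A factor without X_i passes through the cut unchanged; only the other case needs the gap.
  rcases Nat.eq_zero_or_pos (degreeOf i q) with hi | hi
  · obtain ⟨H, rfl⟩ := hqF
    rw [lowPart_mul_of_degreeOf_eq_zero i α (by rw [degreeOf_pow_eq i q k hq.ne_zero, hi, mul_zero])]
    exact dvd_mul_right _ _
  obtain ⟨j, hij, hp⟩ := (hg q hq hqg).exists_isPlanar i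
  have hle : degreeOf i q ≤ e := by
    obtain ⟨H, rfl⟩ := hqg
    rw [degreeOf_mul_eq hq.ne_zero (right_ne_zero_of_mul hg0)] at hge
    omega
  refine pow_dvd_lowPart_of_irreducible hq hij hi hp hcard (fun m hm => ?_) hqF
  refine (hgap m hm).imp_right fun h => lt_of_le_of_lt ?_ h
  exact Nat.add_le_add_left (Nat.mul_le_mul_left _ hle) _

end Multidimensional

/-! ### What sorting and cutting compute -/

section Values
variable {K : Type*} {n : ℕ}

theorem ret_val {α : Type*} (a : α) : (ret a).val = a := rfl

theorem tick_val {α : Type*} (x : Timed α) : (tick x).val = x.val := rfl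

theorem bind_val {α β : Type*} (x : Timed α) (f : α → Timed β) :
    (x.bind f).val = (f x.val).val := rfl

theorem count_val {α : Type*} (l : List α) : (count l).val = l.length := by
  induction l with
  | nil => rfl
  | cons a l ih => simp [count, tick_val, bind_val, ret_val, ih]

theorem concat_val {α : Type*} (l r : List α) : (concat l r).val = l ++ r := by
  induction l with
  | nil => rfl
  | cons a l ih => simp [concat, tick_val, bind_val, ret_val, ih]

theorem le_maxExponent (i : Fin n) (l : List (SparseTerm K n)) :
    ∀ t ∈ l, t.exp i ≤ (maxExponent i l).val := by
  induction l with
  | nil => simp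
  | cons a l ih =>
    intro t ht
    change t.exp i ≤ max (a.exp i) (maxExponent i l).val
    rcases List.mem_cons.mp ht with rfl | ht
    · exact le_max_left _ _
    · exact (ih t ht).trans (le_max_right _ _)

theorem exists_eq_maxExponent (i : Fin n) (l : List (SparseTerm K n)) (hl : l ≠ []) :
    ∃ t ∈ l, t.exp i = (maxExponent i l).val := by
  induction l with
  | nil => exact (hl rfl).elim
  | cons a l ih =>
    change ∃ t ∈ a :: l, t.exp i = max (a.exp i) (maxExponent i l).val
    rcases le_total (maxExponent i l).val (a.exp i) with h | h
    · exact ⟨a, List.mem_cons_self, (max_eq_left h).symm⟩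
    · by_cases hl' : l = []
      · subst hl'
        exact ⟨a, List.mem_cons_self, (max_eq_left (Nat.zero_le _)).symm⟩
      · obtain ⟨t, ht, hte⟩ := ih hl'
        exact ⟨t, List.mem_cons_of_mem _ ht, by rw [max_eq_right h, hte]⟩

theorem splitBit_val (i : Fin n) (b : ℕ) (l : List (SparseTerm K n)) :
    (splitBit i b l).val = (l.filter fun t => !(t.exp i).testBit b,
      l.filter fun t => (t.exp i).testBit b) := by
  induction l with
  | nil => rfl
  | cons a l ih =>
    simp only [splitBit, tick_val, bind_val, ret_val, ih, bitAt]
    cases h : (a.exp i).testBit b <;> simp [h]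

theorem radixSort_perm (i : Fin n) (b m : ℕ) (l : List (SparseTerm K n)) :
    (radixSort i b m l).val.Perm l := by
  induction m generalizing b l with
  | zero => exact List.Perm.refl _
  | succ m ih =>
    simp only [radixSort, bind_val, concat_val, splitBit_val]
    refine (ih _ _).trans ?_
    refine List.perm_append_comm.trans ?_
    exact List.filter_append_perm _ l

/-- Each pass is stable: terms agreeing in bit b keep the order given by the lower bits, and those
with bit 0 precede those with bit 1. -/
theorem radixSort_sorted (i : Fin n) (b m : ℕ) (l : List (SparseTerm K n))
    (h : l.Pairwise fun t u => t.exp i % 2 ^ b ≤ u.exp i % 2 ^ b) :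
    (radixSort i b m l).val.Pairwise fun t u =>
      t.exp i % 2 ^ (b + m) ≤ u.exp i % 2 ^ (b + m) := by
  induction m generalizing b l with
  | zero => exact h
  | succ m ih =>
    simp only [radixSort, bind_val, concat_val, splitBit_val]
    rw [show b + (m + 1) = b + 1 + m by ring]
    refine ih _ _ ?_
    have hmod : ∀ x : ℕ, x % 2 ^ (b + 1) = x % 2 ^ b + 2 ^ b * (x.testBit b).toNat := by
      intro x
      rw [Nat.mod_pow_succ, Nat.testBit_eq_decide_div_mod_eq]
      rcases Nat.mod_two_eq_zero_or_one (x / 2 ^ b) with h | h <;> simp [h]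
    rw [List.pairwise_append]
    refine ⟨?_, ?_, ?_⟩
    · refine (h.filter _).imp_of_mem fun {t u} ht hu htu => ?_
      have h1 := (List.mem_filter.mp ht).2
      have h2 := (List.mem_filter.mp hu).2
      simp only [Bool.not_eq_true'] at h1 h2
      rw [hmod, hmod, h1, h2]
      exact Nat.add_le_add_right htu _
    · refine (h.filter _).imp_of_mem fun {t u} ht hu htu => ?_
      have h1 := (List.mem_filter.mp ht).2
      have h2 := (List.mem_filter.mp hu).2
      rw [hmod, hmod, h1, h2]
      exact Nat.add_le_add_right htu _
    · intro t ht u hu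
      have h1 := (List.mem_filter.mp ht).2
      have h2 := (List.mem_filter.mp hu).2
      simp only [Bool.not_eq_true'] at h1
      rw [hmod, hmod, h1, h2]
      have := Nat.mod_lt (t.exp i) (Nat.two_pow_pos b)
      simp only [Bool.toNat_false, Bool.toNat_true, mul_zero, mul_one, add_zero]
      omega

/-- The sorted list of terms that `univariatePartition` cuts. -/
def sortedTerms (i : Fin n) (h : List (SparseTerm K n)) : List (SparseTerm K n) :=
  (radixSort i 0 (maxExponent i h).val.size h).val

theorem sortedTerms_perm (i : Fin n) (h : List (SparseTerm K n)) : (sortedTerms i h).Perm h :=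
  radixSort_perm _ _ _ _

theorem sortedTerms_sorted (i : Fin n) (h : List (SparseTerm K n)) :
    (sortedTerms i h).Pairwise fun t u => t.exp i ≤ u.exp i := by
  have h1 := radixSort_sorted i 0 (maxExponent i h).val.size h
    (List.pairwise_of_forall (by simp [Nat.mod_one]))
  refine h1.imp_of_mem fun {t u} ht hu htu => ?_
  have hlt : ∀ t ∈ sortedTerms i h, t.exp i < 2 ^ (0 + (maxExponent i h).val.size) := by
    intro t ht
    rw [zero_add]
    exact (le_maxExponent i h t ((sortedTerms_perm i h).mem_iff.mp ht)).trans_lt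
      (Nat.lt_size_self _)
  rwa [Nat.mod_eq_of_lt (hlt t ht), Nat.mod_eq_of_lt (hlt u hu)] at htu

theorem univariatePartition_val (h : List (SparseTerm K n)) (δ : ℕ) (i : Fin n) :
    (univariatePartition h δ i).val = (cutAtGaps i δ (sortedTerms i h)).val := rfl

theorem cutAtGaps_cons_cons (i : Fin n) (δ : ℕ) (t u : SparseTerm K n)
    (l : List (SparseTerm K n)) :
    (cutAtGaps i δ (t :: u :: l)).val =
      if δ < u.exp i - t.exp i then [t] :: (cutAtGaps i δ (u :: l)).val else
        match (cutAtGaps i δ (u :: l)).val with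
        | [] => [[t]]
        | p :: ps => (t :: p) :: ps := by
  simp only [cutAtGaps, tick_val, bind_val, ret_val, natSub, natLT, decide_eq_true_eq]

/-- The pieces between the gaps of a sorted list. -/
theorem cutAtGaps_spec (i : Fin n) (δ : ℕ) (l : List (SparseTerm K n))
    (hl : l.Pairwise fun t u => t.exp i ≤ u.exp i) :
    (cutAtGaps i δ l).val.flatten = l ∧ (∀ p ∈ (cutAtGaps i δ l).val, p ≠ []) ∧
      (cutAtGaps i δ l).val.Pairwise (fun p p' => ∀ x ∈ p, ∀ y ∈ p', x.exp i + δ < y.exp i) ∧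
      ∀ p ∈ (cutAtGaps i δ l).val, ∀ x ∈ p, ∀ y ∈ p,
        y.exp i ≤ x.exp i + (p.length - 1) * δ := by
  induction l with
  | nil => simp [cutAtGaps, tick_val, ret_val]
  | cons t l ih =>
    cases l with
    | nil => simp [cutAtGaps, tick_val, ret_val]
    | cons u l =>
      obtain ⟨hflat, hne, hsep, hw⟩ := ih (List.Pairwise.of_cons hl)
      have hl' := List.pairwise_cons.mp hl
      have hl'' := List.pairwise_cons.mp hl'.2
      rw [cutAtGaps_cons_cons]
      split_ifs with hgap
      · refine ⟨by simp [hflat], ?_, ?_, ?_⟩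
        · intro p hp
          rcases List.mem_cons.mp hp with rfl | hp
          · simp
          · exact hne p hp
        · refine List.pairwise_cons.mpr ⟨fun p hp x hx y hy => ?_, hsep⟩
          rw [List.mem_singleton.mp hx]
          have hy' : y ∈ u :: l := by
            rw [← hflat]
            exact List.mem_flatten.mpr ⟨p, hp, hy⟩
          have huy : u.exp i ≤ y.exp i := by
            rcases List.mem_cons.mp hy' with rfl | h
            · exact le_rfl
            · exact hl''.1 y h
          omega
        · intro p hp
          rcases List.mem_cons.mp hp with rfl | hp
          · simp
          · exact hw p hp
      · cases hc : (cutAtGaps i δ (u :: l)).val with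
        | nil => rw [hc] at hflat; simp at hflat
        | cons p ps =>
          rw [hc] at hflat hne hsep hw
          have hp0 : p ≠ [] := hne p List.mem_cons_self
          obtain ⟨u', p', rfl⟩ := List.exists_cons_of_ne_nil hp0
          obtain rfl : u' = u := by simpa using congrArg List.head? hflat
          have hsep' := List.pairwise_cons.mp hsep
          refine ⟨by simpa using hflat, ?_, ?_, ?_⟩
          · intro q hq
            rcases List.mem_cons.mp hq with rfl | hq
            · simp
            · exact hne q (List.mem_cons_of_mem _ hq)
          · refine List.pairwise_cons.mpr ⟨fun q hq x hx y hy => ?_, hsep'.2⟩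
            rcases List.mem_cons.mp hx with rfl | hx
            · have h1 := hsep'.1 q hq u' List.mem_cons_self y hy
              have h2 := hl'.1 u' List.mem_cons_self
              omega
            · exact hsep'.1 q hq x hx y hy
          · intro q hq
            rcases List.mem_cons.mp hq with rfl | hq
            · have hw' := hw _ List.mem_cons_self
              simp only [List.length_cons, Nat.add_sub_cancel] at hw' ⊢
              have htu := hl'.1 u' List.mem_cons_self
              have hmin : ∀ y ∈ u' :: p', t.exp i ≤ y.exp i := fun y hy =>
                hl'.1 y (by
                  rw [← hflat]
                  exact List.mem_flatten.mpr ⟨_, List.mem_cons_self, hy⟩)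
              intro x hx y hy
              rw [add_mul, one_mul]
              rcases List.mem_cons.mp hy with rfl | hy'
              · rcases List.mem_cons.mp hx with rfl | hx
                · omega
                · have := hmin x hx
                  omega
              · rcases List.mem_cons.mp hx with rfl | hx
                · have := hw' u' List.mem_cons_self y hy'
                  omega
                · have := hw' x hx y hy'
                  omega
            · exact hw q (List.mem_cons_of_mem _ hq)

theorem univariatePartition_spec (h : List (SparseTerm K n)) (δ : ℕ) (i : Fin n) :
    (univariatePartition h δ i).val.flatten.Perm h ∧
      (∀ p ∈ (univariatePartition h δ i).val, p ≠ []) ∧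
      (univariatePartition h δ i).val.Pairwise
        (fun p p' => ∀ x ∈ p, ∀ y ∈ p', x.exp i + δ < y.exp i) ∧
      ∀ p ∈ (univariatePartition h δ i).val, ∀ x ∈ p, ∀ y ∈ p,
        y.exp i ≤ x.exp i + (p.length - 1) * δ := by
  obtain ⟨h1, h2⟩ := cutAtGaps_spec i δ _ (sortedTerms_sorted i h)
  rw [univariatePartition_val]
  exact ⟨(congrArg (List.Perm · h) h1).mpr (sortedTerms_perm i h), h2⟩

end Values

/-! ### Lists of terms as polynomials -/

section Poly
variable {K : Type*} [Field K] {n : ℕ}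

/-- The polynomial with the given list of terms. -/
noncomputable def toPoly (l : List (SparseTerm K n)) : MvPolynomial (Fin n) K :=
  (l.map fun t => monomial (Finsupp.equivFunOnFinite.symm t.exp) t.coeff).sum

/-- The terms are nonzero and their exponent vectors are distinct. -/
def IsReduced (l : List (SparseTerm K n)) : Prop :=
  (∀ t ∈ l, t.coeff ≠ 0) ∧ (l.map SparseTerm.exp).Nodup

theorem isLacunaryRep_iff (l : List (SparseTerm K n)) (f : MvPolynomial (Fin n) K) :
    IsLacunaryRep l f ↔ IsReduced l ∧ toPoly l = f := by
  rw [IsLacunaryRep, IsReduced, and_assoc]; rfl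

theorem toPoly_nil : toPoly ([] : List (SparseTerm K n)) = 0 := rfl

theorem toPoly_cons (t : SparseTerm K n) (l : List (SparseTerm K n)) :
    toPoly (t :: l) = monomial (Finsupp.equivFunOnFinite.symm t.exp) t.coeff + toPoly l := rfl

theorem toPoly_append (l r : List (SparseTerm K n)) : toPoly (l ++ r) = toPoly l + toPoly r := by
  simp [toPoly]

theorem toPoly_flatten (S : List (List (SparseTerm K n))) :
    toPoly S.flatten = (S.map toPoly).sum := by
  induction S with
  | nil => rfl
  | cons h S ih => rw [List.flatten_cons, toPoly_append, ih, List.map_cons, List.sum_cons]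

theorem toPoly_perm {l r : List (SparseTerm K n)} (h : l.Perm r) : toPoly l = toPoly r :=
  (h.map _).sum_eq

theorem IsReduced.perm {l r : List (SparseTerm K n)} (hl : IsReduced l) (h : l.Perm r) :
    IsReduced r :=
  ⟨fun t ht => hl.1 t (h.mem_iff.mpr ht), (h.map _).nodup_iff.mp hl.2⟩

theorem IsReduced.sublist {l r : List (SparseTerm K n)} (hl : IsReduced l) (h : r.Sublist l) :
    IsReduced r :=
  ⟨fun t ht => hl.1 t (h.subset ht), hl.2.sublist (h.map _)⟩

theorem coeff_toPoly_of_forall_ne (l : List (SparseTerm K n)) (m : Fin n →₀ ℕ)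
    (h : ∀ t ∈ l, t.exp ≠ m) : coeff m (toPoly l) = 0 := by
  induction l with
  | nil => exact coeff_zero m
  | cons t l ih =>
    rw [toPoly_cons, coeff_add, coeff_monomial, if_neg, ih fun u hu => h u
      (List.mem_cons_of_mem _ hu), add_zero]
    rintro rfl
    exact h t List.mem_cons_self rfl

theorem IsReduced.coeff_toPoly {l : List (SparseTerm K n)} (hl : IsReduced l) {t : SparseTerm K n}
    (ht : t ∈ l) : coeff (Finsupp.equivFunOnFinite.symm t.exp) (toPoly l) = t.coeff := by
  induction l with
  | nil => simp at ht
  | cons u l ih =>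
    have hnd := List.nodup_cons.mp hl.2
    rw [toPoly_cons, coeff_add, coeff_monomial]
    rcases List.mem_cons.mp ht with rfl | ht
    · rw [if_pos rfl, coeff_toPoly_of_forall_ne, add_zero]
      intro v hv hvt
      exact hnd.1 (List.mem_map.mpr ⟨v, hv, hvt⟩)
    · rw [if_neg, zero_add, ih (hl.sublist (List.sublist_cons_self _ _)) ht]
      intro h
      exact hnd.1 (List.mem_map.mpr ⟨t, ht, (Finsupp.equivFunOnFinite.symm.injective h).symm⟩)

theorem IsReduced.mem_support_iff {l : List (SparseTerm K n)} (hl : IsReduced l)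
    (m : Fin n →₀ ℕ) : m ∈ (toPoly l).support ↔ ∃ t ∈ l, t.exp = m := by
  refine ⟨fun h => ?_, ?_⟩
  · by_contra! hne
    exact MvPolynomial.mem_support_iff.mp h (coeff_toPoly_of_forall_ne l m hne)
  · rintro ⟨t, ht, hm⟩
    have : m = Finsupp.equivFunOnFinite.symm t.exp := by
      rw [hm]; exact (Finsupp.equivFunOnFinite.symm_apply_apply m).symm
    rw [this, MvPolynomial.mem_support_iff, hl.coeff_toPoly ht]
    exact hl.1 t ht

theorem IsReduced.card_support {l : List (SparseTerm K n)} (hl : IsReduced l) :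
    (toPoly l).support.card = l.length := by
  classical
  have h1 : (toPoly l).support =
      ((l.map SparseTerm.exp).toFinset).map Finsupp.equivFunOnFinite.symm.toEmbedding := by
    ext m
    rw [hl.mem_support_iff, Finset.mem_map]
    constructor
    · rintro ⟨t, ht, hm⟩
      exact ⟨t.exp, List.mem_toFinset.mpr (List.mem_map.mpr ⟨t, ht, rfl⟩), by
        rw [hm]; exact Finsupp.equivFunOnFinite.symm_apply_apply m⟩
    · rintro ⟨e, he, rfl⟩
      obtain ⟨t, ht, rfl⟩ := List.mem_map.mp (List.mem_toFinset.mp he)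
      exact ⟨t, ht, rfl⟩
  rw [h1, Finset.card_map, List.toFinset_card_of_nodup hl.2, List.length_map]

theorem IsReduced.toPoly_ne_zero {l : List (SparseTerm K n)} (hl : IsReduced l) (h : l ≠ []) :
    toPoly l ≠ 0 := by
  intro h0
  have h1 := hl.card_support
  rw [h0, support_zero, Finset.card_empty] at h1
  exact h (List.length_eq_zero_iff.mp h1.symm)

theorem lowPart_toPoly (i : Fin n) (α : ℕ) (l : List (SparseTerm K n)) :
    lowPart i α (toPoly l) = toPoly (l.filter fun t => t.exp i ≤ α) := by
  induction l with
  | nil => ext m; simp [coeff_lowPart, toPoly_nil]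
  | cons t l ih =>
    have h1 : lowPart i α (toPoly (t :: l)) =
        (if t.exp i ≤ α then monomial (Finsupp.equivFunOnFinite.symm t.exp) t.coeff else 0) +
          lowPart i α (toPoly l) := by
      ext m
      rw [toPoly_cons, coeff_add, coeff_lowPart, coeff_lowPart, coeff_add, coeff_monomial]
      by_cases hm : Finsupp.equivFunOnFinite.symm t.exp = m
      · subst hm
        by_cases h : t.exp i ≤ α <;> simp [h]
      · have : coeff m (if t.exp i ≤ α then
            monomial (Finsupp.equivFunOnFinite.symm t.exp) t.coeff else 0) = 0 := by
          split_ifs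
          · rw [coeff_monomial, if_neg hm]
          · exact coeff_zero m
        rw [this, if_neg hm]
        simp
    rw [h1, ih, List.filter_cons]
    by_cases h : t.exp i ≤ α
    · simp [h, toPoly_cons]
    · simp [h]

/-- Powers of `g` dividing a polynomial divide the pieces between the gaps. -/
theorem pow_dvd_pieces [CharZero K] {g : MvPolynomial (Fin n) K} (hg0 : g ≠ 0)
    (hg : ∀ q, Irreducible q → q ∣ g → IsMultidimensional q) {i : Fin n} {e ℓ δ : ℕ}
    (hge : degreeOf i g ≤ e) (hδ : (ℓ - 1) * (ℓ - 2) * e ≤ δ) (ν : ℕ) :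
    ∀ S : List (List (SparseTerm K n)), IsReduced S.flatten → S.flatten.length ≤ ℓ →
      S.Pairwise (fun p p' => ∀ x ∈ p, ∀ y ∈ p', x.exp i + δ < y.exp i) →
      g ^ ν ∣ toPoly S.flatten → ∀ p ∈ S, g ^ ν ∣ toPoly p
  | [], _, _, _, _ => by simp
  | p :: S, hred, hlen, hsep, hdvd => by
    have hsep' := List.pairwise_cons.mp hsep
    rw [List.flatten_cons] at hred hlen hdvd
    have hpdvd : g ^ ν ∣ toPoly p := by
      by_cases hp : p = []
      · rw [hp, toPoly_nil]; exact dvd_zero _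
      obtain ⟨t, ht, htmax⟩ := exists_eq_maxExponent i p hp
      have hS : ∀ y ∈ S.flatten, (maxExponent i p).val + δ < y.exp i := by
        intro y hy
        obtain ⟨p', hp', hy'⟩ := List.mem_flatten.mp hy
        rw [← htmax]
        exact hsep'.1 p' hp' t ht y hy'
      -- The first piece is the low part up to its own largest exponent; the remaining pieces lie
      -- beyond the gap and are treated recursively after subtracting it.
      have h1 : toPoly p = lowPart i (maxExponent i p).val (toPoly (p ++ S.flatten)) := by
        rw [lowPart_toPoly, List.filter_append, List.filter_eq_self.mpr fun t ht => by
          simpa using le_maxExponent i p t ht, List.filter_eq_nil_iff.mpr fun y hy => by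
          have := hS y hy
          simp only [decide_eq_true_eq]
          omega, List.append_nil]
      rw [h1]
      refine pow_dvd_lowPart hg0 hg hge (hred.card_support.le.trans hlen) (fun m hm => ?_) hdvd
      obtain ⟨t, ht, htm⟩ := (hred.mem_support_iff m).mp hm
      rw [← htm]
      rcases List.mem_append.mp ht with ht | ht
      · exact Or.inl (le_maxExponent i p t ht)
      · exact Or.inr (lt_of_le_of_lt (Nat.add_le_add_left hδ _) (hS t ht))
    intro p' hp'
    rcases List.mem_cons.mp hp' with rfl | hp'
    · exact hpdvd
    · refine pow_dvd_pieces hg0 hg hge hδ ν S (hred.sublist (List.sublist_append_right _ _))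
        ?_ hsep'.2 ?_ p' hp'
      · rw [List.length_append] at hlen; omega
      · rw [toPoly_append] at hdvd
        exact (dvd_add_right hpdvd).mp hdvd

end Poly

/-! ### Refinement, the loop and removal of monomials -/

section Refinement
variable {K : Type*} {n : ℕ}

theorem threshold_val (k dX dY : ℕ) : (threshold k dX dY).val =
    4 * (dX * dY) * ((k - 1) * (k - 1)) * (dX * dY) := rfl

theorem refineAll_nil (i : Fin n) (di others : ℕ) :
    (refineAll (K := K) i di others []).val = [] := rfl

theorem refineAll_cons (i : Fin n) (di others : ℕ) (h : List (SparseTerm K n))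
    (S : List (List (SparseTerm K n))) : (refineAll i di others (h :: S)).val =
      (univariatePartition h (threshold h.length others di).val i).val ++
        (refineAll i di others S).val := by
  simp only [refineAll, tick_val, bind_val, concat_val, count_val]

theorem refineAll_flatten_perm (i : Fin n) (di others : ℕ) (S : List (List (SparseTerm K n))) :
    (refineAll i di others S).val.flatten.Perm S.flatten := by
  induction S with
  | nil => exact List.Perm.refl _
  | cons h S ih =>
    rw [refineAll_cons, List.flatten_append, List.flatten_cons]
    exact (univariatePartition_spec h _ i).1.append ih

theorem refineAll_ne_nil (i : Fin n) (di others : ℕ) (S : List (List (SparseTerm K n))) :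
    ∀ p ∈ (refineAll i di others S).val, p ≠ [] := by
  induction S with
  | nil => simp [refineAll_nil]
  | cons h S ih =>
    rw [refineAll_cons]
    intro p hp
    rcases List.mem_append.mp hp with hp | hp
    · exact (univariatePartition_spec h _ i).2.1 p hp
    · exact ih p hp

theorem univariatePartition_length_pos {h : List (SparseTerm K n)} (hh : h ≠ []) (δ : ℕ)
    (i : Fin n) : 0 < (univariatePartition h δ i).val.length := by
  rw [List.length_pos_iff]
  intro h0
  have := (univariatePartition_spec h δ i).1
  rw [h0] at this
  exact hh this.symm.eq_nil

theorem length_le_refineAll (i : Fin n) (di others : ℕ) (S : List (List (SparseTerm K n)))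
    (hS : ∀ h ∈ S, h ≠ []) : S.length ≤ (refineAll i di others S).val.length := by
  induction S with
  | nil => simp
  | cons h S ih =>
    rw [refineAll_cons, List.length_append, List.length_cons]
    have h1 := ih fun p hp => hS p (List.mem_cons_of_mem _ hp)
    have h2 := univariatePartition_length_pos (hS h List.mem_cons_self)
      (threshold h.length others di).val i
    omega

theorem forall₂_perm_trans {α : Type*} {S T U : List (List α)} (h : List.Forall₂ List.Perm S T)
    (h' : List.Forall₂ List.Perm T U) : List.Forall₂ List.Perm S U := by
  induction h generalizing U with
  | nil => exact h'
  | cons hp _ ih =>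
    cases h' with
    | cons hp' h' => exact List.Forall₂.cons (hp.trans hp') (ih h')

/-- The range of the exponents of one variable is bounded in terms of the threshold. -/
def IsNarrow (b : Fin n × ℕ × ℕ) (h : List (SparseTerm K n)) : Prop :=
  ∀ x ∈ h, ∀ y ∈ h, y.exp b.1 ≤
    x.exp b.1 + (h.length - 1) * (threshold h.length b.2.2 b.2.1).val

theorem IsNarrow.perm {b : Fin n × ℕ × ℕ} {h h' : List (SparseTerm K n)} (hh : IsNarrow b h)
    (hp : h.Perm h') : IsNarrow b h' := by
  intro x hx y hy
  rw [← hp.length_eq]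
  exact hh x (hp.mem_iff.mpr hx) y (hp.mem_iff.mpr hy)

/-- Each nonempty piece yields at least one, so an unchanged count means that nothing was cut; a
piece that is not cut has no consecutive exponents further apart than the threshold. -/
theorem refineAll_of_length_eq (b : Fin n × ℕ × ℕ) (S : List (List (SparseTerm K n)))
    (hS : ∀ h ∈ S, h ≠ []) (hlen : (refineAll b.1 b.2.1 b.2.2 S).val.length = S.length) :
    List.Forall₂ List.Perm (refineAll b.1 b.2.1 b.2.2 S).val S ∧
      ∀ h ∈ (refineAll b.1 b.2.1 b.2.2 S).val, IsNarrow b h := by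
  induction S with
  | nil => rw [refineAll_nil]; simp
  | cons h S ih =>
    have hS' : ∀ h ∈ S, h ≠ [] := fun p hp => hS p (List.mem_cons_of_mem _ hp)
    rw [refineAll_cons, List.length_append, List.length_cons] at hlen
    have h1 := length_le_refineAll b.1 b.2.1 b.2.2 S hS'
    have h2 := univariatePartition_length_pos (hS h List.mem_cons_self)
      (threshold h.length b.2.2 b.2.1).val b.1
    obtain ⟨p, hp⟩ := List.length_eq_one_iff.mp (show (univariatePartition h
      (threshold h.length b.2.2 b.2.1).val b.1).val.length = 1 by omega)
    obtain ⟨h3, h4⟩ := ih hS' (by omega)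
    obtain ⟨hperm, -, -, hw⟩ := univariatePartition_spec h
      (threshold h.length b.2.2 b.2.1).val b.1
    rw [refineAll_cons, hp]
    rw [hp] at hperm hw
    have hph : p.Perm h := by simpa using hperm
    refine ⟨List.Forall₂.cons hph h3, fun q hq => ?_⟩
    rcases List.mem_cons.mp hq with rfl | hq
    · intro x hx y hy
      have := hw q List.mem_cons_self x hx y hy
      rwa [hph.length_eq] at this ⊢
    · exact h4 q hq

theorem sweep_cons (b : Fin n × ℕ × ℕ) (bs : List (Fin n × ℕ × ℕ))
    (S : List (List (SparseTerm K n))) :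
    (sweep (b :: bs) S).val = (sweep bs (refineAll b.1 b.2.1 b.2.2 S).val).val := rfl

theorem length_le_sweep (bs : List (Fin n × ℕ × ℕ)) (S : List (List (SparseTerm K n)))
    (hS : ∀ h ∈ S, h ≠ []) : S.length ≤ (sweep bs S).val.length := by
  induction bs generalizing S with
  | nil => exact le_rfl
  | cons b bs ih =>
    rw [sweep_cons]
    exact (length_le_refineAll _ _ _ S hS).trans (ih _ (refineAll_ne_nil _ _ _ S))

/-- Counts never decrease, so no single step of the sweep cut anything. The later steps merely
permute terms within pieces, so the narrowness obtained for an earlier variable persists. -/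
theorem sweep_of_length_eq (bs : List (Fin n × ℕ × ℕ)) (S : List (List (SparseTerm K n)))
    (hS : ∀ h ∈ S, h ≠ []) (hlen : (sweep bs S).val.length = S.length) :
    List.Forall₂ List.Perm (sweep bs S).val S ∧
      ∀ b ∈ bs, ∀ h ∈ (sweep bs S).val, IsNarrow b h := by
  induction bs generalizing S with
  | nil => exact ⟨List.forall₂_same.mpr fun _ _ => List.Perm.refl _, by simp⟩
  | cons b bs ih =>
    rw [sweep_cons] at hlen ⊢
    have h1 := length_le_refineAll b.1 b.2.1 b.2.2 S hS
    have hne := refineAll_ne_nil b.1 b.2.1 b.2.2 S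
    have h2 := length_le_sweep bs _ hne
    obtain ⟨h3, h4⟩ := refineAll_of_length_eq b S hS (by omega)
    obtain ⟨h5, h6⟩ := ih _ hne (by omega)
    have hnarrow : ∀ T T' : List (List (SparseTerm K n)), List.Forall₂ List.Perm T T' →
        (∀ h ∈ T', IsNarrow b h) → ∀ h ∈ T, IsNarrow b h := by
      intro T T' hTT'
      induction hTT' with
      | nil => simp
      | cons hp _ ih =>
        intro hT' h hh
        rcases List.mem_cons.mp hh with rfl | hh
        · exact (hT' _ List.mem_cons_self).perm hp.symm
        · exact ih (fun h hh => hT' h (List.mem_cons_of_mem _ hh)) h hh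
    refine ⟨forall₂_perm_trans h5 h3, fun b' hb' => ?_⟩
    rcases List.mem_cons.mp hb' with rfl | hb'
    · exact hnarrow _ _ h5 h4
    · exact h6 b' hb'

/-- What remains true of a set of polynomials under a step that refines each of them. -/
theorem sweep_induction (P : List (List (SparseTerm K n)) → Prop) (bs : List (Fin n × ℕ × ℕ))
    (hP : ∀ b ∈ bs, ∀ S, P S → P (refineAll b.1 b.2.1 b.2.2 S).val)
    (S : List (List (SparseTerm K n))) (hS : P S) : P (sweep bs S).val := by
  induction bs generalizing S with
  | nil => exact hS
  | cons b bs ih =>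
    rw [sweep_cons]
    exact ih (fun b' hb' => hP b' (List.mem_cons_of_mem _ hb')) _ (hP b List.mem_cons_self S hS)

/-- The loop stops within `k + 1` evaluations of its condition if the number of polynomials is
bounded by `k`. -/
theorem whileLoop_spec (bs : List (Fin n × ℕ × ℕ)) (Inv Done : List (List (SparseTerm K n)) → Prop)
    (k A : ℕ) (hInv : ∀ S, Inv S → Inv (sweep bs S).val) (hlen : ∀ S, Inv S → S.length ≤ k)
    (hmono : ∀ S, Inv S → S.length ≤ (sweep bs S).val.length)
    (hDone : ∀ S, Inv S → (sweep bs S).val.length = S.length → Done (sweep bs S).val)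
    (hcost : ∀ s S, Inv S →
      (count S).cost + (natLT s (count S).val).cost + (sweep bs S).cost ≤ A) :
    ∀ (fuel s : ℕ) (S : List (List (SparseTerm K n))), Inv S → s ≤ S.length →
      (s = S.length → Done S) → k < s + fuel →
      ∃ S', (whileLoop bs fuel s S).val = some S' ∧ Inv S' ∧ Done S' ∧
        (whileLoop bs fuel s S).cost ≤ (k + 1 - s) * A
  | 0, s, S, hS, hs, _, hk => by
    have := hlen S hS
    omega
  | fuel + 1, s, S, hS, hs, hd, hk => by
    have hSk := hlen S hS
    have hc := hcost s S hS
    rw [count_val] at hc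
    -- Here s is the count before the preceding sweep, so that equality on exit says this sweep cut
    -- nothing.
    by_cases hlt : s < S.length
    · obtain ⟨S', h1, h2, h3, h4⟩ := whileLoop_spec bs Inv Done k A hInv hlen hmono hDone hcost fuel
        S.length (sweep bs S).val (hInv S hS) (hmono S hS) (fun h => hDone S hS h.symm) (by omega)
      have hif : whileLoop bs (fuel + 1) s S =
          ⟨(whileLoop bs fuel S.length (sweep bs S).val).val, (count S).cost +
            ((natLT s S.length).cost + ((sweep bs S).cost +
              (whileLoop bs fuel S.length (sweep bs S).val).cost))⟩ := by
        simp only [whileLoop, Timed.bind, count_val]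
        simp [natLT, hlt]
      rw [hif]
      refine ⟨S', h1, h2, h3, ?_⟩
      have h5 : (k + 1 - S.length) * A + A ≤ (k + 1 - s) * A := by
        rw [← Nat.succ_mul]
        exact Nat.mul_le_mul_right A (by omega)
      dsimp only
      omega
    · have hif : whileLoop bs (fuel + 1) s S =
          ⟨some S, (count S).cost + ((natLT s S.length).cost + 0)⟩ := by
        simp only [whileLoop, Timed.bind, count_val]
        simp [natLT, hlt, ret]
      rw [hif]
      refine ⟨S, rfl, hS, hd (by omega), ?_⟩
      have h5 : A ≤ (k + 1 - s) * A := Nat.le_mul_of_pos_left A (by omega)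
      dsimp only
      omega

/-- The lower bounds serve correctness, the upper bounds by D the running time, and those by the
supremum of d the degree of the output. The prefix maximum `pre` must be general for the induction.
-/
theorem boundTable_spec (D : ℕ) (d : Fin n → ℕ) (pre : ℕ) (is : List (Fin n)) :
    (boundTable D d pre is).val.1.map Prod.fst = is ∧
      (∀ j ∈ is, min (d j) D ≤ (boundTable D d pre is).val.2) ∧
      (boundTable D d pre is).val.2 ≤ D ∧
      (boundTable D d pre is).val.2 ≤ is.toFinset.sup d ∧
      (is.Nodup → ∀ b ∈ (boundTable D d pre is).val.1, b.2.1 = min (d b.1) D ∧ pre ≤ b.2.2 ∧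
        (∀ j ∈ is, j ≠ b.1 → min (d j) D ≤ b.2.2) ∧ b.2.2 ≤ max pre D ∧
        b.2.2 ≤ max pre (is.toFinset.sup d)) := by
  induction is generalizing pre with
  | nil => simp [boundTable, tick_val, ret_val]
  | cons i is ih =>
    obtain ⟨h1, h2, h3, h4, h5⟩ := ih (max pre (min (d i) D))
    have hval : (boundTable D d pre (i :: is)).val =
        ((i, min (d i) D, max pre (boundTable D d (max pre (min (d i) D)) is).val.2) ::
          (boundTable D d (max pre (min (d i) D)) is).val.1,
          max (min (d i) D) (boundTable D d (max pre (min (d i) D)) is).val.2) := rfl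
    rw [hval]
    generalize boundTable D d (max pre (min (d i) D)) is = r at *
    simp only [List.map_cons, h1, List.toFinset_cons, Finset.sup_insert,
      List.mem_cons, forall_eq_or_imp, true_and]
    refine ⟨⟨le_max_left _ _, fun j hj => (h2 j hj).trans (le_max_right _ _)⟩,
      max_le (min_le_right _ _) h3, max_le ((min_le_left _ _).trans le_sup_left)
      (h4.trans le_sup_right), fun hnd => ?_⟩
    have hnd' := List.nodup_cons.mp hnd
    refine ⟨⟨le_max_left _ _, ⟨fun h => (h rfl).elim, fun j hj _ =>
      (h2 j hj).trans (le_max_right _ _)⟩, max_le_max_left _ h3, max_le_max_left _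
      (h4.trans le_sup_right)⟩, fun b hb => ?_⟩
    obtain ⟨g1, g2, g3, g4, g5⟩ := h5 hnd'.2 b hb
    refine ⟨g1, (le_max_left _ _).trans g2, ⟨fun _ => (le_max_right _ _).trans g2, g3⟩, ?_, ?_⟩
    · refine g4.trans (max_le (max_le (le_max_left _ _) ?_) (le_max_right _ _))
      exact (min_le_right _ _).trans (le_max_right _ _)
    · refine g5.trans (max_le (max_le (le_max_left _ _) ?_) ?_)
      · exact ((min_le_left _ _).trans le_sup_left).trans (le_max_right _ _)
      · exact le_sup_right.trans (le_max_right _ _)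

theorem sumEntries_val (e : Fin n → ℕ) (is : List (Fin n)) :
    (sumEntries e is).val = (is.map e).sum := by
  induction is with
  | nil => rfl
  | cons i is ih => simp [sumEntries, tick_val, bind_val, natAdd, ih]

theorem totalDegreeOf_cons (t : SparseTerm K n) (l : List (SparseTerm K n)) :
    (totalDegreeOf (t :: l)).val = max (∑ i, t.exp i) (totalDegreeOf l).val := by
  simp only [totalDegreeOf, tick_val, bind_val, natMax, sumEntries_val]
  rw [← List.ofFn_eq_map, List.sum_ofFn]

theorem sum_le_totalDegreeOf (l : List (SparseTerm K n)) :
    ∀ t ∈ l, ∑ i, t.exp i ≤ (totalDegreeOf l).val := by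
  induction l with
  | nil => simp
  | cons u l ih =>
    intro t ht
    rw [totalDegreeOf_cons]
    rcases List.mem_cons.mp ht with rfl | ht
    · exact le_max_left _ _
    · exact (ih t ht).trans (le_max_right _ _)

theorem totalDegreeOf_le (l : List (SparseTerm K n)) (D : ℕ) (h : ∀ t ∈ l, ∑ i, t.exp i ≤ D) :
    (totalDegreeOf l).val ≤ D := by
  induction l with
  | nil => exact Nat.zero_le _
  | cons u l ih =>
    rw [totalDegreeOf_cons]
    exact max_le (h u List.mem_cons_self) (ih fun t ht => h t (List.mem_cons_of_mem _ ht))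

theorem removeMonomials_val (S : List (List (SparseTerm K n))) :
    (removeMonomials S).val = S.map fun h => (removeMonomial h).val := by
  induction S with
  | nil => rfl
  | cons h S ih => simp [removeMonomials, tick_val, bind_val, ret_val, ih]

theorem shiftExponents_val (v : Fin n → ℕ) (l : List (SparseTerm K n)) :
    (shiftExponents v l).val = l.map fun t => ⟨t.coeff, fun i => t.exp i - v i⟩ := by
  induction l with
  | nil => rfl
  | cons t l ih =>
    simp only [shiftExponents, tick_val, bind_val, ret_val, ih, fillArray, natSub, List.map_cons]

theorem minExponents_spec (v : Fin n → ℕ) (l : List (SparseTerm K n)) (i : Fin n) :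
    ((minExponents v l).val i ≤ v i ∧ ∀ t ∈ l, (minExponents v l).val i ≤ t.exp i) ∧
      ((minExponents v l).val i = v i ∨ ∃ t ∈ l, (minExponents v l).val i = t.exp i) := by
  induction l generalizing v with
  | nil => simp [minExponents, tick_val, ret_val]
  | cons t l ih =>
    have hval : (minExponents v (t :: l)).val =
        (minExponents (fun i => min (v i) (t.exp i)) l).val := rfl
    obtain ⟨⟨h1, h2⟩, h3⟩ := ih fun i => min (v i) (t.exp i)
    rw [hval]
    refine ⟨⟨h1.trans (min_le_left _ _), fun u hu => ?_⟩, ?_⟩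
    · rcases List.mem_cons.mp hu with rfl | hu
      · exact h1.trans (min_le_right _ _)
      · exact h2 u hu
    · rcases h3 with h3 | ⟨u, hu, h3⟩
      · rw [h3]
        rcases min_choice (v i) (t.exp i) with h | h
        · exact Or.inl h
        · exact Or.inr ⟨t, List.mem_cons_self, h⟩
      · exact Or.inr ⟨u, List.mem_cons_of_mem _ hu, h3⟩

/-- The exponents that `removeMonomial` subtracts. -/
def minimalExponents : List (SparseTerm K n) → Fin n → ℕ
  | [] => 0
  | t :: l => (minExponents t.exp l).val

theorem minimalExponents_isLeast {h : List (SparseTerm K n)} (hh : h ≠ []) (i : Fin n) :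
    IsLeast {a | ∃ t ∈ h, t.exp i = a} (minimalExponents h i) := by
  obtain ⟨t, l, rfl⟩ := List.exists_cons_of_ne_nil hh
  obtain ⟨⟨h1, h2⟩, h3⟩ := minExponents_spec t.exp l i
  refine ⟨?_, ?_⟩
  · rcases h3 with h3 | ⟨u, hu, h3⟩
    · exact ⟨t, List.mem_cons_self, h3.symm⟩
    · exact ⟨u, List.mem_cons_of_mem _ hu, h3.symm⟩
  · rintro _ ⟨u, hu, rfl⟩
    rcases List.mem_cons.mp hu with rfl | hu
    · exact h1
    · exact h2 u hu

theorem removeMonomial_val (h : List (SparseTerm K n)) : (removeMonomial h).val =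
    h.map fun t => ⟨t.coeff, fun i => t.exp i - minimalExponents h i⟩ := by
  cases h with
  | nil => rfl
  | cons t l => simp only [removeMonomial, tick_val, bind_val, shiftExponents_val, minimalExponents]

end Refinement

/-! ### Division by the monomial content -/

section MonomialContent
variable {K : Type*} [Field K] {n : ℕ}

theorem toPoly_eq_monomial_mul {h : List (SparseTerm K n)} :
    toPoly h = monomial (Finsupp.equivFunOnFinite.symm (minimalExponents h)) 1 *
      toPoly (removeMonomial h).val := by
  by_cases hh : h = []
  · subst hh
    rw [removeMonomial_val, List.map_nil, toPoly_nil, mul_zero]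
  have key : ∀ l : List (SparseTerm K n), (∀ t ∈ l, t ∈ h) → toPoly l =
      monomial (Finsupp.equivFunOnFinite.symm (minimalExponents h)) 1 *
        toPoly (l.map fun t => (⟨t.coeff, fun i => t.exp i - minimalExponents h i⟩ :
          SparseTerm K n)) := by
    intro l
    induction l with
    | nil => intro _; rw [List.map_nil, toPoly_nil, mul_zero]
    | cons t l ih =>
      intro hl
      rw [List.map_cons, toPoly_cons, toPoly_cons, mul_add,
        ← ih fun u hu => hl u (List.mem_cons_of_mem _ hu), monomial_mul, one_mul]
      congr 2
      refine congrArg monomial (Finsupp.ext fun i => ?_)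
      have := (minimalExponents_isLeast hh i).2 ⟨t, hl t List.mem_cons_self, rfl⟩
      change t.exp i = minimalExponents h i + (t.exp i - minimalExponents h i)
      omega
  rw [removeMonomial_val]
  exact key h fun _ ht => ht

theorem IsReduced.multivaluation_toPoly {h : List (SparseTerm K n)} (hr : IsReduced h)
    (hh : h ≠ []) : multivaluation (toPoly h) =
      Finsupp.equivFunOnFinite.symm (minimalExponents h) := by
  refine congrArg _ (funext fun i => ?_)
  refine IsLeast.csInf_eq ?_
  have hset : (fun a : Fin n →₀ ℕ => a i) '' ((toPoly h).support : Set (Fin n →₀ ℕ)) =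
      {a | ∃ t ∈ h, t.exp i = a} := by
    refine Set.ext fun a => ?_
    simp only [Set.mem_image, Finset.mem_coe, hr.mem_support_iff, Set.mem_ofPred_eq]
    constructor
    · rintro ⟨m, ⟨t, ht, hm⟩, rfl⟩
      exact ⟨t, ht, congrFun hm i⟩
    · rintro ⟨t, ht, rfl⟩
      exact ⟨Finsupp.equivFunOnFinite.symm t.exp, ⟨t, ht, rfl⟩, rfl⟩
  rw [hset]
  exact minimalExponents_isLeast hh i

theorem IsReduced.normalized_toPoly {h : List (SparseTerm K n)} (hr : IsReduced h)
    (hh : h ≠ []) : normalized (toPoly h) = toPoly (removeMonomial h).val := by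
  rw [normalized, hr.multivaluation_toPoly hh]
  conv_lhs => rw [toPoly_eq_monomial_mul]
  rw [divMonomial_monomial_mul]

theorem IsReduced.removeMonomial {h : List (SparseTerm K n)} (hr : IsReduced h) :
    IsReduced (Sparse.removeMonomial h).val := by
  by_cases hh : h = []
  · subst hh; exact hr
  rw [removeMonomial_val]
  refine ⟨fun t ht => ?_, ?_⟩
  · obtain ⟨u, hu, rfl⟩ := List.mem_map.mp ht
    exact hr.1 u hu
  · rw [List.map_map]
    have h1 : (SparseTerm.exp ∘ fun t : SparseTerm K n =>
        (⟨t.coeff, fun i => t.exp i - minimalExponents h i⟩ : SparseTerm K n)) =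
        (fun e : Fin n → ℕ => fun i => e i - minimalExponents h i) ∘ SparseTerm.exp := rfl
    rw [h1, ← List.map_map]
    refine hr.2.map_on fun e he e' he' hee' => funext fun i => ?_
    obtain ⟨t, ht, rfl⟩ := List.mem_map.mp he
    obtain ⟨u, hu, rfl⟩ := List.mem_map.mp he'
    have h2 := (minimalExponents_isLeast hh i).2 ⟨t, ht, rfl⟩
    have h3 := (minimalExponents_isLeast hh i).2 ⟨u, hu, rfl⟩
    have h4 := congrFun hee' i
    omega

/-- Powers of a polynomial without one-dimensional factors are not affected by monomials. -/
theorem pow_dvd_monomial_mul_iff {g : MvPolynomial (Fin n) K} (hg0 : g ≠ 0)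
    (hg : ∀ q, Irreducible q → q ∣ g → IsMultidimensional q) (m : Fin n →₀ ℕ) (ν : ℕ)
    (F : MvPolynomial (Fin n) K) : g ^ ν ∣ monomial m 1 * F ↔ g ^ ν ∣ F := by
  refine ⟨fun h => ?_, fun h => dvd_mul_of_dvd_right h _⟩
  have hrel : IsRelPrime (g ^ ν) (monomial m (1 : K)) := by
    refine UniqueFactorizationMonoid.isRelPrime_iff_no_prime_factors (pow_ne_zero _ hg0) |>.mpr
      fun q hqg hqm hq => ?_
    have hqg' : q ∣ g := hq.dvd_of_dvd_pow hqg
    rw [monomial_eq, C_1, one_mul, Finsupp.prod] at hqm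
    obtain ⟨k, _, hk⟩ := (hq.dvd_finsetProd_iff _).mp hqm
    obtain ⟨j, hij, hp⟩ := (hg q hq.irreducible hqg').exists_isPlanar k
    exact hp.not_dvd_X hij (hq.dvd_of_dvd_pow hk)
  exact hrel.dvd_of_dvd_mul_left h

end MonomialContent

/-! ### Step counts -/

section Cost
variable {K : Type*} {n : ℕ}

theorem ret_cost {α : Type*} (a : α) : (ret a).cost = 0 := rfl

theorem tick_cost {α : Type*} (x : Timed α) : (tick x).cost = x.cost + 1 := rfl

theorem bind_cost {α β : Type*} (x : Timed α) (f : α → Timed β) :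
    (x.bind f).cost = x.cost + (f x.val).cost := rfl

theorem size_le_self (a : ℕ) : a.size ≤ a :=
  Nat.size_le.mpr Nat.lt_two_pow_self

theorem size_mul_le (a b : ℕ) : (a * b).size ≤ a.size + b.size := by
  rw [Nat.size_le, pow_add]
  exact Nat.mul_lt_mul'' (Nat.lt_size_self a) (Nat.lt_size_self b)

theorem length_le_length_flatten {α : Type*} {S : List (List α)} (hS : ∀ h ∈ S, h ≠ []) :
    S.length ≤ S.flatten.length := by
  induction S with
  | nil => exact le_rfl
  | cons h S ih =>
    have h1 := ih fun h hh => hS h (List.mem_cons_of_mem _ hh)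
    have h2 := List.length_pos_iff.mpr (hS h List.mem_cons_self)
    rw [List.flatten_cons, List.length_append, List.length_cons]
    omega

theorem count_cost {α : Type*} (l : List α) : (count l).cost = l.length + 1 := by
  induction l with
  | nil => rfl
  | cons a l ih => simp [count, tick_cost, bind_cost, ret_cost, ih]

theorem concat_cost {α : Type*} (l r : List α) : (concat l r).cost = l.length + 1 := by
  induction l with
  | nil => rfl
  | cons a l ih => simp [concat, tick_cost, bind_cost, ret_cost, ih]

theorem maxExponent_cost (i : Fin n) (B : ℕ) (l : List (SparseTerm K n))
    (h : ∀ t ∈ l, (t.exp i).size ≤ B) : (maxExponent i l).cost ≤ l.length * (B + 2) + 1 := by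
  induction l with
  | nil => simp [maxExponent, tick_cost, ret_cost]
  | cons a l ih =>
    have h1 := ih fun t ht => h t (List.mem_cons_of_mem _ ht)
    have h2 := h a List.mem_cons_self
    simp only [maxExponent, tick_cost, bind_cost, natMax, List.length_cons]
    rw [add_mul]
    have := min_le_left (a.exp i).size (maxExponent i l).val.size
    omega

theorem size_maxExponent_le (i : Fin n) (B : ℕ) (l : List (SparseTerm K n))
    (h : ∀ t ∈ l, (t.exp i).size ≤ B) : (maxExponent i l).val.size ≤ B := by
  by_cases hl : l = []
  · subst hl
    exact (Nat.size_zero).le.trans (Nat.zero_le _)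
  · obtain ⟨t, ht, hte⟩ := exists_eq_maxExponent i l hl
    exact hte ▸ h t ht

theorem splitBit_cost (i : Fin n) (b : ℕ) (l : List (SparseTerm K n)) :
    (splitBit i b l).cost = 2 * l.length + 1 := by
  induction l with
  | nil => rfl
  | cons a l ih =>
    simp only [splitBit, tick_cost, bind_cost, ret_cost, bitAt, ih, List.length_cons]
    ring

theorem radixSort_cost (i : Fin n) (b m : ℕ) (l : List (SparseTerm K n)) :
    (radixSort i b m l).cost ≤ m * (3 * l.length + 2) := by
  induction m generalizing b l with
  | zero => simp [radixSort, ret_cost]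
  | succ m ih =>
    simp only [radixSort, bind_cost, splitBit_cost, concat_cost, concat_val, splitBit_val]
    set s := l.filter fun t => !(t.exp i).testBit b with hs
    have h1 : s.length ≤ l.length := List.length_filter_le _ _
    have h2 : (s ++ l.filter fun t => (t.exp i).testBit b).length = l.length :=
      (List.perm_append_comm.trans (List.filter_append_perm _ l)).length_eq
    have h3 := ih (b + 1) (s ++ l.filter fun t => (t.exp i).testBit b)
    rw [h2] at h3
    rw [add_mul]
    omega

theorem cutAtGaps_cost (i : Fin n) (δ B : ℕ) (l : List (SparseTerm K n))
    (h : ∀ t ∈ l, (t.exp i).size ≤ B) : (cutAtGaps i δ l).cost ≤ l.length * (3 * B + 3) + 1 := by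
  induction l with
  | nil => simp [cutAtGaps, tick_cost, ret_cost]
  | cons t l ih =>
    cases l with
    | nil => simp [cutAtGaps, tick_cost, ret_cost]
    | cons u l =>
      have h1 := ih fun t ht => h t (List.mem_cons_of_mem _ ht)
      have h2 := h t List.mem_cons_self
      have h3 := h u (List.mem_cons_of_mem _ List.mem_cons_self)
      have h4 : (u.exp i - t.exp i).size ≤ B := (Nat.size_le_size (Nat.sub_le _ _)).trans h3
      have h5 := min_le_right δ.size (u.exp i - t.exp i).size
      simp only [cutAtGaps, tick_cost, bind_cost, ret_cost, natSub, natLT]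
      rw [List.length_cons, add_mul]
      omega

theorem univariatePartition_cost {h : List (SparseTerm K n)} (hh : h ≠ []) (δ : ℕ) (i : Fin n)
    (B : ℕ) (hB : ∀ t ∈ h, (t.exp i).size ≤ B) :
    (univariatePartition h δ i).cost ≤ 10 * (h.length * (B + 1)) := by
  have h1 := maxExponent_cost i B h hB
  have h2 := size_maxExponent_le i B h hB
  have h3 := radixSort_cost i 0 (maxExponent i h).val.size h
  have h4 := cutAtGaps_cost i δ B (sortedTerms i h)
    fun t ht => hB t ((sortedTerms_perm i h).mem_iff.mp ht)
  rw [(sortedTerms_perm i h).length_eq] at h4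
  have h5 : 1 ≤ h.length := List.length_pos_iff.mpr hh
  have h6 := Nat.mul_le_mul_right (3 * h.length + 2) h2
  simp only [univariatePartition, bind_cost, bitLength]
  change _ + (_ + (_ + (cutAtGaps i δ (sortedTerms i h)).cost)) ≤ _
  have h7 := Nat.mul_le_mul_right B h5
  nlinarith

theorem univariatePartition_length_le (h : List (SparseTerm K n)) (δ : ℕ) (i : Fin n) :
    (univariatePartition h δ i).val.length ≤ h.length := by
  obtain ⟨h1, h2, -⟩ := univariatePartition_spec h δ i
  rw [← h1.length_eq]
  exact length_le_length_flatten h2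

/-- The crude bound of the bit length of k by k itself suffices, since partitioning a piece is
linear in its number of terms anyway. -/
theorem threshold_cost (k dX dY B : ℕ) (hX : dX.size ≤ B) (hY : dY.size ≤ B) :
    (threshold k dX dY).cost ≤ 7 * k + 10 * B + 16 := by
  have h1 := size_le_self k
  have h2 : (k - 1).size ≤ k := (size_le_self _).trans (Nat.sub_le _ _)
  have h3 := size_mul_le (k - 1) (k - 1)
  have h4 := size_mul_le dX dY
  have h5 := size_mul_le 4 (dX * dY)
  have h6 := size_mul_le (4 * (dX * dY)) ((k - 1) * (k - 1))
  have h7 : Nat.size 4 = 3 := by decide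
  have h8 : Nat.size 1 = 1 := by decide
  simp only [threshold, bind_cost, natSub, natMul]
  omega

/-- The costs are linear in the lengths of the pieces, so they add up to a bound in the total number
of terms, however these are distributed. -/
theorem refineAll_cost (i : Fin n) (di others B : ℕ) (hd : di.size ≤ B) (ho : others.size ≤ B)
    (S : List (List (SparseTerm K n))) (hS : ∀ h ∈ S, h ≠ [])
    (hB : ∀ t ∈ S.flatten, (t.exp i).size ≤ B) :
    (refineAll i di others S).cost ≤ 40 * (S.flatten.length * (B + 1)) + 1 := by
  induction S with
  | nil => simp [refineAll, tick_cost, ret_cost]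
  | cons h S ih =>
    rw [List.flatten_cons] at hB ⊢
    have hh := hS h List.mem_cons_self
    have h1 := ih (fun h hh => hS h (List.mem_cons_of_mem _ hh))
      fun t ht => hB t (List.mem_append_right _ ht)
    have h2 := threshold_cost h.length others di B ho hd
    have h3 := univariatePartition_cost hh (threshold h.length others di).val i B
      fun t ht => hB t (List.mem_append_left _ ht)
    have h4 := univariatePartition_length_le h (threshold h.length others di).val i
    have h5 := Nat.mul_le_mul_right B (List.length_pos_iff.mpr hh : 1 ≤ h.length)
    have h6 : 1 ≤ h.length := List.length_pos_iff.mpr hh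
    simp only [refineAll, tick_cost, bind_cost, count_cost, count_val, concat_cost,
      List.length_append]
    nlinarith

theorem sweep_cost (B : ℕ) (bs : List (Fin n × ℕ × ℕ))
    (hbs : ∀ b ∈ bs, b.2.1.size ≤ B ∧ b.2.2.size ≤ B)
    (S : List (List (SparseTerm K n))) (hS : ∀ h ∈ S, h ≠ [])
    (hB : ∀ t ∈ S.flatten, ∀ i, (t.exp i).size ≤ B) :
    (sweep bs S).cost ≤ bs.length * (40 * (S.flatten.length * (B + 1)) + 2) + 1 := by
  induction bs generalizing S with
  | nil => simp [sweep, tick_cost, ret_cost]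
  | cons b bs ih =>
    have hp := refineAll_flatten_perm b.1 b.2.1 b.2.2 S
    have h1 := ih (fun b hb => hbs b (List.mem_cons_of_mem _ hb))
      (refineAll b.1 b.2.1 b.2.2 S).val (refineAll_ne_nil _ _ _ S)
      fun t ht => hB t (hp.mem_iff.mp ht)
    have hb := hbs b List.mem_cons_self
    have h2 := refineAll_cost b.1 b.2.1 b.2.2 B hb.1 hb.2 S hS fun t ht => hB t ht b.1
    rw [hp.length_eq] at h1
    simp only [sweep, tick_cost, bind_cost]
    rw [List.length_cons, add_mul]
    omega

theorem sumEntries_cost (e : Fin n → ℕ) (D : ℕ) (is : List (Fin n)) (h : (is.map e).sum ≤ D) :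
    (sumEntries e is).cost ≤ is.length * (2 * D.size + 2) + 1 := by
  induction is with
  | nil => simp [sumEntries, tick_cost, ret_cost]
  | cons i is ih =>
    rw [List.map_cons, List.sum_cons] at h
    have h1 := ih (by omega)
    have h2 : (e i).size ≤ D.size := Nat.size_le_size (by omega)
    have h3 : (is.map e).sum.size ≤ D.size := Nat.size_le_size (by omega)
    simp only [sumEntries, tick_cost, bind_cost, sumEntries_val, natAdd]
    rw [List.length_cons, add_mul]
    omega

theorem totalDegreeOf_cost (D : ℕ) (l : List (SparseTerm K n)) (h : ∀ t ∈ l, ∑ i, t.exp i ≤ D) :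
    (totalDegreeOf l).cost ≤ l.length * (n * (2 * D.size + 2) + D.size + 3) + 1 := by
  induction l with
  | nil => simp [totalDegreeOf, tick_cost, ret_cost]
  | cons t l ih =>
    have h1 := ih fun t ht => h t (List.mem_cons_of_mem _ ht)
    have h2 := h t List.mem_cons_self
    rw [← List.sum_ofFn, List.ofFn_eq_map] at h2
    have h3 := sumEntries_cost t.exp D _ h2
    rw [List.length_finRange] at h3
    have h4 : (sumEntries t.exp (List.finRange n)).val.size ≤ D.size :=
      Nat.size_le_size ((sumEntries_val _ _).le.trans h2)
    have h5 := min_le_left (sumEntries t.exp (List.finRange n)).val.size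
      (totalDegreeOf l).val.size
    simp only [totalDegreeOf, tick_cost, bind_cost, natMax]
    rw [List.length_cons, add_mul]
    omega

theorem boundTable_cost (D : ℕ) (d : Fin n → ℕ) (pre : ℕ) (is : List (Fin n)) :
    (boundTable D d pre is).cost ≤ is.length * (4 * D.size + 5) + 1 := by
  induction is generalizing pre with
  | nil => simp [boundTable, tick_cost, ret_cost]
  | cons i is ih =>
    have h1 := ih (max pre (min (d i) D))
    have h2 := Nat.size_le_size (boundTable_spec D d (max pre (min (d i) D)) is).2.2.1
    have h3 := Nat.size_le_size (min_le_right (d i) D)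
    have h4 := min_le_right (d i).size D.size
    have h5 := min_le_right pre.size (min (d i) D).size
    have h6 := min_le_right pre.size (boundTable D d (max pre (min (d i) D)) is).val.2.size
    have h7 := min_le_right (min (d i) D).size
      (boundTable D d (max pre (min (d i) D)) is).val.2.size
    simp only [boundTable, tick_cost, bind_cost, ret_cost, natMin, natMax]
    rw [List.length_cons, add_mul]
    omega

theorem fillArray_cost {α : Type*} (c : Fin n → Timed α) (b : ℕ) (h : ∀ i, (c i).cost + 1 ≤ b) :
    (fillArray c).cost ≤ n * b := by
  have := Finset.sum_le_card_nsmul Finset.univ (fun i => (c i).cost + 1) b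
    fun i _ => h i
  simpa [fillArray] using this

theorem minExponents_cost (B : ℕ) (l : List (SparseTerm K n)) (v : Fin n → ℕ)
    (h : ∀ t ∈ l, ∀ i, (t.exp i).size ≤ B) :
    (minExponents v l).cost ≤ l.length * (n * (B + 2) + 1) + 1 := by
  induction l generalizing v with
  | nil => simp [minExponents, tick_cost, ret_cost]
  | cons t l ih =>
    have h1 := fun v => ih v fun t ht => h t (List.mem_cons_of_mem _ ht)
    have h2 := fillArray_cost (fun i => natMin (v i) (t.exp i)) (B + 2) fun i =>
      Nat.add_le_add_right ((min_le_right _ _).trans (h t List.mem_cons_self i)) 2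
    simp only [minExponents, tick_cost, bind_cost]
    have h3 := h1 (fillArray fun i => natMin (v i) (t.exp i)).val
    rw [List.length_cons, add_mul]
    omega

theorem shiftExponents_cost (B : ℕ) (v : Fin n → ℕ) (hv : ∀ i, (v i).size ≤ B)
    (l : List (SparseTerm K n)) (h : ∀ t ∈ l, ∀ i, (t.exp i).size ≤ B) :
    (shiftExponents v l).cost ≤ l.length * (n * (2 * B + 2) + 1) + 1 := by
  induction l with
  | nil => simp [shiftExponents, tick_cost, ret_cost]
  | cons t l ih =>
    have h1 := ih fun t ht => h t (List.mem_cons_of_mem _ ht)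
    have h2 := fillArray_cost (fun i => natSub (t.exp i) (v i)) (2 * B + 2) fun i => by
      have := h t List.mem_cons_self i
      have := hv i
      simp only [natSub]
      omega
    simp only [shiftExponents, tick_cost, bind_cost, ret_cost]
    rw [List.length_cons, add_mul]
    omega

theorem removeMonomial_cost (hn : 0 < n) (B : ℕ) {h : List (SparseTerm K n)} (hh : h ≠ [])
    (hB : ∀ t ∈ h, ∀ i, (t.exp i).size ≤ B) :
    (removeMonomial h).cost + 1 ≤ 10 * (h.length * (n * (B + 1))) := by
  obtain ⟨t, l, rfl⟩ := List.exists_cons_of_ne_nil hh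
  have h1 := minExponents_cost B l t.exp fun u hu => hB u (List.mem_cons_of_mem _ hu)
  have h2 := shiftExponents_cost B (minExponents t.exp l).val (fun i =>
    (Nat.size_le_size (minExponents_spec t.exp l i).1.1).trans (hB t List.mem_cons_self i))
    (t :: l) hB
  have h3 := Nat.mul_le_mul_left l.length hn
  have h4 := Nat.mul_le_mul_right B hn
  simp only [removeMonomial, tick_cost, bind_cost]
  rw [List.length_cons] at h2 ⊢
  nlinarith

theorem removeMonomials_cost (hn : 0 < n) (B : ℕ) (S : List (List (SparseTerm K n)))
    (hS : ∀ h ∈ S, h ≠ []) (hB : ∀ t ∈ S.flatten, ∀ i, (t.exp i).size ≤ B) :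
    (removeMonomials S).cost ≤ 10 * (S.flatten.length * (n * (B + 1))) + 1 := by
  induction S with
  | nil => simp [removeMonomials, tick_cost, ret_cost]
  | cons h S ih =>
    rw [List.flatten_cons] at hB ⊢
    have h1 := ih (fun h hh => hS h (List.mem_cons_of_mem _ hh))
      fun t ht => hB t (List.mem_append_right _ ht)
    have h2 := removeMonomial_cost hn B (hS h List.mem_cons_self)
      fun t ht => hB t (List.mem_append_left _ ht)
    simp only [removeMonomials, tick_cost, bind_cost, ret_cost]
    rw [List.length_append, add_mul]
    omega

/-- For positive D the left side is (size - 1) + 2, at most 3 log(D + 2)/log 2, and 3/log 2 < 5; the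
summand 2 inside the logarithm keeps D = 0 and D = 1 harmless. -/
theorem size_add_one_le_log (D : ℕ) : ((D.size : ℝ) + 1) ≤ 5 * Real.log ((D : ℝ) + 2) := by
  have h2 := Real.log_two_gt_d9
  have hlog : Real.log 2 ≤ Real.log ((D : ℝ) + 2) :=
    Real.log_le_log (by norm_num) (by linarith [Nat.cast_nonneg (α := ℝ) D])
  rcases Nat.eq_zero_or_pos D.size with h0 | h0
  · rw [h0]
    push_cast
    linarith
  · have h1 : 2 ^ (D.size - 1) ≤ D := Nat.lt_size.mp (by omega)
    have h3 : ((D.size - 1 : ℕ) : ℝ) * Real.log 2 ≤ Real.log ((D : ℝ) + 2) := by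
      rw [← Real.log_pow]
      refine Real.log_le_log (by positivity) ?_
      have : ((2 ^ (D.size - 1) : ℕ) : ℝ) ≤ D := by exact_mod_cast h1
      push_cast at this
      linarith
    rw [Nat.cast_sub h0, Nat.cast_one] at h3
    have h4 : (1 : ℝ) ≤ D.size := by exact_mod_cast h0
    nlinarith

end Cost

/-! ### The table of degree bounds of the input -/

section Bounds
variable {K : Type*} {n : ℕ}

/-- The table of degree bounds that the algorithm computes. -/
def boundsOf (l : List (SparseTerm K n)) (d : Fin n → ℕ) : List (Fin n × ℕ × ℕ) :=
  (boundTable (totalDegreeOf l).val d 0 (List.finRange n)).val.1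

theorem boundsOf_length (l : List (SparseTerm K n)) (d : Fin n → ℕ) :
    (boundsOf l d).length = n := by
  have h := congrArg List.length
    (boundTable_spec (totalDegreeOf l).val d 0 (List.finRange n)).1
  rwa [List.length_map, List.length_finRange] at h

theorem exists_mem_boundsOf (l : List (SparseTerm K n)) (d : Fin n → ℕ) (i : Fin n) :
    ∃ b ∈ boundsOf l d, b.1 = i := by
  have h : i ∈ (boundsOf l d).map Prod.fst := by
    rw [boundsOf, (boundTable_spec (totalDegreeOf l).val d 0 (List.finRange n)).1]
    exact List.mem_finRange i
  exact List.mem_map.mp h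

theorem boundsOf_spec (l : List (SparseTerm K n)) (d : Fin n → ℕ) :
    ∀ b ∈ boundsOf l d, b.2.1 = min (d b.1) (totalDegreeOf l).val ∧
      (∀ j, j ≠ b.1 → min (d j) (totalDegreeOf l).val ≤ b.2.2) ∧
      b.2.2 ≤ (totalDegreeOf l).val ∧ b.2.1 ≤ Finset.univ.sup d ∧ b.2.2 ≤ Finset.univ.sup d := by
  intro b hb
  obtain ⟨-, -, -, -, h5⟩ := boundTable_spec (totalDegreeOf l).val d 0 (List.finRange n)
  obtain ⟨h1, -, h2, h3, h4⟩ := h5 (List.nodup_finRange n) b hb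
  rw [Nat.zero_max] at h3 h4
  refine ⟨h1, fun j => h2 j (List.mem_finRange j), h3, ?_, ?_⟩
  · rw [h1]
    exact (min_le_left _ _).trans (Finset.le_sup (Finset.mem_univ _))
  · exact h4.trans (Finset.sup_mono (Finset.subset_univ _))

end Bounds

/-! ### Invariant, running time and output of the algorithm -/

section Correctness
variable {K : Type*} [Field K] {n : ℕ}

/-- All irreducible factors of the nonzero polynomial `g` are multidimensional, and the thresholds
computed from the table `bs` suit its degrees. -/
structure IsCovered (bs : List (Fin n × ℕ × ℕ)) (g : MvPolynomial (Fin n) K) : Prop where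
  ne_zero : g ≠ 0
  factors : ∀ q, Irreducible q → q ∣ g → IsMultidimensional q
  degreeOf_le : ∀ b ∈ bs, degreeOf b.1 g ≤ b.2.2 * b.2.1

theorem refineAll_pow_dvd [CharZero K] {g : MvPolynomial (Fin n) K} (hg0 : g ≠ 0)
    (hg : ∀ q, Irreducible q → q ∣ g → IsMultidimensional q) {i : Fin n} {di others : ℕ}
    (hge : degreeOf i g ≤ others * di) (ν : ℕ) (S : List (List (SparseTerm K n)))
    (hS : IsReduced S.flatten) (hdvd : ∀ h ∈ S, g ^ ν ∣ toPoly h) :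
    ∀ h ∈ (refineAll i di others S).val, g ^ ν ∣ toPoly h := by
  induction S with
  | nil => simp [refineAll_nil]
  | cons h S ih =>
    rw [List.flatten_cons] at hS
    -- The threshold 4 (ℓ-1)² (d_i M_i)² exceeds the gap (ℓ-1)(ℓ-2) d_i M_i that is needed, with
    -- room to spare.
    have hδ : (h.length - 1) * (h.length - 2) * (others * di) ≤
        (threshold h.length others di).val := by
      rw [threshold_val]
      rcases Nat.eq_zero_or_pos (others * di) with h0 | h0
      · rw [h0]; simp
      · refine Nat.mul_le_mul_right _ ?_
        refine (Nat.mul_le_mul_left _ (by omega : h.length - 2 ≤ h.length - 1)).trans ?_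
        exact Nat.le_mul_of_pos_left _ (by omega)
    obtain ⟨h1, -, h2, -⟩ := univariatePartition_spec h (threshold h.length others di).val i
    have h3 := pow_dvd_pieces hg0 hg hge hδ ν _
      ((hS.sublist (List.sublist_append_left _ _)).perm h1.symm) h1.length_eq.le h2
      (by rw [toPoly_perm h1]; exact hdvd h List.mem_cons_self)
    rw [refineAll_cons]
    intro p hp
    rcases List.mem_append.mp hp with hp | hp
    · exact h3 p hp
    · exact ih (hS.sublist (List.sublist_append_right _ _))
        (fun h hh => hdvd h (List.mem_cons_of_mem _ hh)) p hp

/-- The pieces in `S` arise from `l` by distributing its terms, and inherit its covered factors. -/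
structure IsRefinement (bs : List (Fin n × ℕ × ℕ)) (l : List (SparseTerm K n))
    (S : List (List (SparseTerm K n))) : Prop where
  perm : S.flatten.Perm l
  ne_nil : ∀ h ∈ S, h ≠ []
  pow_dvd : ∀ g, IsCovered bs g → ∀ ν : ℕ, g ^ ν ∣ toPoly l → ∀ h ∈ S, g ^ ν ∣ toPoly h

theorem IsRefinement.sweep [CharZero K] {bs : List (Fin n × ℕ × ℕ)} {l : List (SparseTerm K n)}
    (hl : IsReduced l) {S : List (List (SparseTerm K n))} (hS : IsRefinement bs l S) :
    IsRefinement bs l (sweep bs S).val := by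
  refine sweep_induction (IsRefinement bs l) bs (fun b hb S hS => ?_) S hS
  refine ⟨(refineAll_flatten_perm _ _ _ S).trans hS.perm, refineAll_ne_nil _ _ _ S,
    fun g hg ν hν => ?_⟩
  exact refineAll_pow_dvd hg.ne_zero hg.factors (hg.degreeOf_le b hb) ν S (hl.perm hS.perm.symm)
    (hS.pow_dvd g hg ν hν)

theorem multivariatePartition_spec [CharZero K] (hn : 0 < n) {l : List (SparseTerm K n)}
    (hl : IsReduced l) (hl0 : l ≠ []) (d : Fin n → ℕ) :
    ∃ S, (multivariatePartition (l.length + 1) l d).val =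
        some (S.map fun h => (removeMonomial h).val) ∧
      IsRefinement (boundsOf l d) l S ∧ (∀ b ∈ boundsOf l d, ∀ h ∈ S, IsNarrow b h) ∧
      (multivariatePartition (l.length + 1) l d).cost ≤
        120 * (n * l.length ^ 2 * ((totalDegreeOf l).val.size + 1)) := by
  set D := (totalDegreeOf l).val with hD
  set B := D.size with hB
  set k := l.length with hk
  have hk1 : 1 ≤ k := List.length_pos_iff.mpr hl0
  have hexp : ∀ t ∈ l, ∀ i, (t.exp i).size ≤ B := fun t ht i =>
    Nat.size_le_size ((Finset.single_le_sum (fun _ _ => Nat.zero_le _)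
      (Finset.mem_univ i)).trans (sum_le_totalDegreeOf l t ht))
  have hsize : ∀ b ∈ boundsOf l d, b.2.1.size ≤ B ∧ b.2.2.size ≤ B := by
    intro b hb
    obtain ⟨h1, -, h3, -⟩ := boundsOf_spec l d b hb
    exact ⟨Nat.size_le_size (h1.le.trans (min_le_right _ _)), Nat.size_le_size h3⟩
  have hlen : ∀ S, IsRefinement (boundsOf l d) l S → S.length ≤ k := fun S hS =>
    (length_le_length_flatten hS.ne_nil).trans hS.perm.length_eq.le
  have hnk : n ≤ n * k := Nat.le_mul_of_pos_right _ hk1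
  have hkn : k ≤ n * k := Nat.le_mul_of_pos_left _ hn
  obtain ⟨S, h1, h2, h3, h4⟩ := whileLoop_spec (boundsOf l d) (IsRefinement (boundsOf l d) l)
    (fun S => ∀ b ∈ boundsOf l d, ∀ h ∈ S, IsNarrow b h) k (47 * (n * k * (B + 1)))
    (fun S hS => hS.sweep hl) hlen (fun S hS => length_le_sweep _ S hS.ne_nil)
    (fun S hS h => (sweep_of_length_eq _ S hS.ne_nil h).2)
    (fun s S hS => by
      have h1 := sweep_cost B (boundsOf l d) hsize S hS.ne_nil
        fun t ht => hexp t (hS.perm.mem_iff.mp ht)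
      have h2 := min_le_right s.size S.length.size
      have h3 := size_le_self S.length
      have h4 := hlen S hS
      rw [hS.perm.length_eq, boundsOf_length] at h1
      rw [count_cost, count_val]
      simp only [natLT]
      nlinarith)
    -- The loop starts from s = 0 with one piece, so at least one sweep is run; the counts at the
    -- evaluations of the condition strictly increase until the last, and k + 1 evaluations suffice.
    (k + 1) 0 [l]
    ⟨by simp, by simpa using hl0, by simp⟩ (Nat.zero_le _) (by simp) (by omega)
  have h5 := removeMonomials_cost hn B S h2.ne_nil fun t ht => hexp t (h2.perm.mem_iff.mp ht)
  rw [h2.perm.length_eq] at h5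
  have h6 := totalDegreeOf_cost D l (sum_le_totalDegreeOf l)
  have h7 := boundTable_cost D d 0 (List.finRange n)
  rw [List.length_finRange] at h7
  have hrun : multivariatePartition (k + 1) l d =
      ⟨some (S.map fun h => (removeMonomial h).val), (totalDegreeOf l).cost +
        ((boundTable D d 0 (List.finRange n)).cost +
          ((whileLoop (boundsOf l d) (k + 1) 0 [l]).cost + ((removeMonomials S).cost + 0)))⟩ := by
    rw [boundsOf] at h1
    simp only [multivariatePartition, Timed.bind, boundsOf, h1, ret, removeMonomials_val]
    rfl
  rw [hrun]
  refine ⟨S, rfl, h2, h3, ?_⟩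
  dsimp only
  rw [← hB] at h6 h7
  rw [← hk] at h5 h6
  have h8 : (k + 1 - 0) * (47 * (n * k * (B + 1))) ≤ 94 * (n * k ^ 2 * (B + 1)) := by
    rw [Nat.sub_zero]
    calc (k + 1) * (47 * (n * k * (B + 1))) ≤ (2 * k) * (47 * (n * k * (B + 1))) :=
          Nat.mul_le_mul_right _ (by omega)
      _ = 94 * (n * k ^ 2 * (B + 1)) := by ring
  have h9 : n * k * (B + 1) ≤ n * k ^ 2 * (B + 1) := by
    rw [sq, ← mul_assoc]
    exact Nat.mul_le_mul_right _ (Nat.le_mul_of_pos_right _ hk1)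
  have h10 : k * (n * (2 * B + 2) + B + 3) + 1 ≤ 6 * (n * k * (B + 1)) := by nlinarith
  have h11 : n * (4 * B + 5) + 1 ≤ 6 * (n * k * (B + 1)) := by nlinarith
  have h12 : 10 * (k * (n * (B + 1))) + 1 ≤ 11 * (n * k * (B + 1)) := by nlinarith
  -- The total degree, the table, the loop and the removal of monomials cost 6 + 6 + 94 + 11 ≤ 120
  -- units.
  omega

theorem IsReduced.degreeOf_toPoly_le {l : List (SparseTerm K n)} (hl : IsReduced l) {i : Fin n}
    {b : ℕ} (h : ∀ t ∈ l, t.exp i ≤ b) : degreeOf i (toPoly l) ≤ b := by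
  rw [degreeOf_eq_sup]
  refine Finset.sup_le fun m hm => ?_
  obtain ⟨t, ht, hm⟩ := (hl.mem_support_iff m).mp hm
  rw [← hm]
  exact h t ht

/-- Capping at the total degree is harmless because g divides the input polynomial. The factor M_i
in the threshold is at least 1 whenever g involves X_i: an irreducible factor of g is
multidimensional, which forces a second variable to exist. -/
theorem isCovered_boundsOf {l : List (SparseTerm K n)} (hl : IsReduced l) (hl0 : l ≠ [])
    {d : Fin n → ℕ} (hd : ∀ i, 0 < d i) {g : MvPolynomial (Fin n) K} (hgl : g ∣ toPoly l)
    (hg : ∀ q, Irreducible q → q ∣ g → IsMultidimensional q) (hgd : ∀ i, degreeOf i g ≤ d i) :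
    IsCovered (boundsOf l d) g := by
  have hf0 := hl.toPoly_ne_zero hl0
  have hg0 : g ≠ 0 := ne_zero_of_dvd_ne_zero hf0 hgl
  have hle : ∀ i, degreeOf i g ≤ (totalDegreeOf l).val := by
    intro i
    refine le_trans ?_ (hl.degreeOf_toPoly_le fun t ht =>
      (Finset.single_le_sum (fun _ _ => Nat.zero_le _) (Finset.mem_univ i)).trans
        (sum_le_totalDegreeOf l t ht))
    obtain ⟨H, hH⟩ := hgl
    rw [hH, degreeOf_mul_eq hg0 (right_ne_zero_of_mul (hH ▸ hf0))]
    exact Nat.le_add_right _ _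
  refine ⟨hg0, hg, fun b hb => ?_⟩
  obtain ⟨h1, h2, -⟩ := boundsOf_spec l d b hb
  rcases Nat.eq_zero_or_pos (degreeOf b.1 g) with h0 | h0
  · rw [h0]; exact Nat.zero_le _
  have hunit : ¬ IsUnit g := by
    intro hu
    obtain ⟨c, -, rfl⟩ := isUnit_iff_eq_C_of_isReduced.mp hu
    rw [degreeOf_C] at h0
    exact h0.false
  obtain ⟨q, hq, hqg⟩ := WfDvdMonoid.exists_irreducible_factor hunit hg0
  obtain ⟨j, hj, -⟩ := (hg q hq hqg).exists_isPlanar b.1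
  have h3 := h2 j hj.symm
  have h4 : 1 ≤ min (d j) (totalDegreeOf l).val :=
    le_min (hd j) (h0.trans_le (hle b.1))
  have h5 : degreeOf b.1 g ≤ b.2.1 := h1 ▸ le_min (hgd b.1) (hle b.1)
  exact h5.trans (Nat.le_mul_of_pos_left _ (h4.trans h3))

theorem isPartition_map_toPoly (S : List (List (SparseTerm K n))) (hS : IsReduced S.flatten)
    (hne : ∀ h ∈ S, h ≠ []) : IsPartition (toPoly S.flatten) (S.map toPoly) := by
  refine ⟨fun p hp => ?_, ?_, (toPoly_flatten S).symm⟩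
  · obtain ⟨h, hh, rfl⟩ := List.mem_map.mp hp
    exact (hS.sublist (List.sublist_flatten_of_mem hh)).toPoly_ne_zero (hne h hh)
  · clear hne
    induction S with
    | nil => simp
    | cons h S ih =>
      rw [List.flatten_cons] at hS
      rw [List.map_cons, List.pairwise_cons]
      refine ⟨fun p hp => ?_, ih (hS.sublist (List.sublist_append_right _ _))⟩
      obtain ⟨h', hh', rfl⟩ := List.mem_map.mp hp
      rw [Finset.disjoint_left]
      intro m hm hm'
      have hr := hS.sublist (List.sublist_append_left _ _)
      have hr' := (hS.sublist (List.sublist_append_right _ _)).sublist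
        (List.sublist_flatten_of_mem hh')
      obtain ⟨t, ht, htm⟩ := (hr.mem_support_iff m).mp hm
      obtain ⟨u, hu, hum⟩ := (hr'.mem_support_iff m).mp hm'
      have hnd := hS.2
      rw [List.map_append, List.nodup_append] at hnd
      exact hnd.2.2 _ (List.mem_map_of_mem ht) _
        (List.mem_map_of_mem (List.mem_flatten.mpr ⟨h', hh', hu⟩)) (htm.trans hum.symm)

/-- After removal of the content the degree is the spread of the exponents, at most k gaps of size 4
s⁴ k² each. -/
theorem degreeOf_normalized_le {b : Fin n × ℕ × ℕ} {h : List (SparseTerm K n)} (hr : IsReduced h)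
    (hh : h ≠ []) (hb : IsNarrow b h) {s k : ℕ} (h1 : b.2.1 ≤ s) (h2 : b.2.2 ≤ s)
    (hk : h.length ≤ k) : degreeOf b.1 (normalized (toPoly h)) ≤ 4 * s ^ 4 * k ^ 3 := by
  rw [hr.normalized_toPoly hh]
  refine hr.removeMonomial.degreeOf_toPoly_le fun t ht => ?_
  rw [removeMonomial_val] at ht
  obtain ⟨u, hu, rfl⟩ := List.mem_map.mp ht
  obtain ⟨v, hv, hve⟩ := (minimalExponents_isLeast hh b.1).1
  have h3 := hb v hv u hu
  have h4 : (h.length - 1) * (threshold h.length b.2.2 b.2.1).val ≤ 4 * s ^ 4 * k ^ 3 := by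
    rw [threshold_val]
    calc _ ≤ k * (4 * (s * s) * (k * k) * (s * s)) := by
          gcongr <;> omega
      _ = 4 * s ^ 4 * k ^ 3 := by ring
  dsimp only
  omega

theorem emultiplicity_eq_iInf {R : Type*} [CommMonoidWithZero R] {g f : R} {p : List R} (φ : R → R)
    (h : ∀ ν : ℕ, g ^ ν ∣ f ↔ ∀ x ∈ p, g ^ ν ∣ φ x) :
    emultiplicity g f = ⨅ x ∈ p, emultiplicity g (φ x) := by
  refine ENat.eq_of_forall_natCast_le_iff fun ν => ?_
  rw [← pow_dvd_iff_le_emultiplicity, h ν, le_iInf₂_iff]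
  simp only [pow_dvd_iff_le_emultiplicity]

theorem IsMultidimensional.ne_zero {g : MvPolynomial (Fin n) K} (h : IsMultidimensional g) :
    g ≠ 0 := by
  rintro rfl
  rw [IsMultidimensional, newtonPolytope, support_zero, Finset.coe_empty, Set.image_empty,
    convexHull_empty, vectorSpan_empty, finrank_bot] at h
  omega

end Correctness

end Sparse

theorem mainTheorem3 :
    ∃ C : ℕ, ∀ (K : Type*) [Field K] [CharZero K] (n : ℕ) (_ : 0 < n)
      (d : Fin n → ℕ) (_ : ∀ i, 0 < d i)
      (f : MvPolynomial (Fin n) K) (_ : f ≠ 0)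
      (l : List (Sparse.SparseTerm K n)) (_ : Sparse.IsLacunaryRep l f),
      ∃ (fuel : ℕ) (out : List (List (Sparse.SparseTerm K n)))
        (p : List (MvPolynomial (Fin n) K)),
        -- the algorithm stops, within the claimed time, with the output `out`
        (Sparse.multivariatePartition fuel l d).val = some out ∧
        ((Sparse.multivariatePartition fuel l d).cost : ℝ) ≤
          C * n * (f.support.card : ℝ) ^ 2 * Real.log ((f.totalDegree : ℝ) + 2) ∧
        -- the output is a partition of `f`, each summand divided by its monomial content
        Sparse.IsPartition f p ∧
        List.Forall₂ (fun h o => Sparse.IsLacunaryRep o (Sparse.normalized h)) p out ∧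
        -- the degrees of the output polynomials
        (∀ h ∈ p, ∀ i, MvPolynomial.degreeOf i (Sparse.normalized h) ≤
          C * (Finset.univ.sup d) ^ 4 * f.support.card ^ 3) ∧
        -- the multiplicities of the multidimensional factors
        ∀ g : MvPolynomial (Fin n) K,
          Sparse.IsMultidimensional g →
          (∀ q, Irreducible q → q ∣ g → Sparse.IsMultidimensional q) →
          (∀ i, MvPolynomial.degreeOf i g ≤ d i) →
          emultiplicity g f = (⨅ h ∈ p, emultiplicity g h) ∧
          emultiplicity g f = (⨅ h ∈ p, emultiplicity g (Sparse.normalized h)) := by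
  -- 600 = 120 · 5, from the step count and from the passage from bit length to logarithm; the
  -- degree bound would need only 4.
  refine ⟨600, fun K _ _ n hn d hd f hf l hlf => ?_⟩
  obtain ⟨hl, rfl⟩ := (Sparse.isLacunaryRep_iff l f).mp hlf
  have hl0 : l ≠ [] := by
    rintro rfl
    exact hf Sparse.toPoly_nil
  obtain ⟨S, h1, h2, h3, h4⟩ := Sparse.multivariatePartition_spec hn hl hl0 d
  have hflat := hl.perm h2.perm.symm
  have hred : ∀ h ∈ S, Sparse.IsReduced h := fun h hh =>
    hflat.sublist (List.sublist_flatten_of_mem hh)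
  refine ⟨l.length + 1, _, S.map Sparse.toPoly, h1, ?_, ?_, ?_, ?_, fun g hg hgq hgd => ?_⟩
  · rw [hl.card_support]
    have h5 : (Sparse.totalDegreeOf l).val ≤ (Sparse.toPoly l).totalDegree := by
      refine Sparse.totalDegreeOf_le l _ fun t ht => ?_
      have h := MvPolynomial.le_totalDegree ((hl.mem_support_iff
        (Finsupp.equivFunOnFinite.symm t.exp)).mpr ⟨t, ht, rfl⟩)
      rwa [Finsupp.sum_fintype _ _ fun _ => rfl] at h
    have h6 := Sparse.size_add_one_le_log (Sparse.toPoly l).totalDegree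
    have h7 : (((Sparse.totalDegreeOf l).val.size : ℕ) : ℝ) ≤
        (Sparse.toPoly l).totalDegree.size := by
      exact_mod_cast Nat.size_le_size h5
    calc ((Sparse.multivariatePartition (l.length + 1) l d).cost : ℝ)
        ≤ 120 * (n * l.length ^ 2 * ((Sparse.totalDegreeOf l).val.size + 1)) := by
          exact_mod_cast h4
      _ ≤ 120 * (n * l.length ^ 2 *
            (5 * Real.log (((Sparse.toPoly l).totalDegree : ℝ) + 2))) := by
          gcongr
          linarith
      _ = _ := by push_cast; ring
  · have h := Sparse.isPartition_map_toPoly S hflat h2.ne_nil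
    rwa [Sparse.toPoly_perm h2.perm] at h
  · rw [List.forall₂_map_left_iff, List.forall₂_map_right_iff, List.forall₂_same]
    intro h hh
    rw [Sparse.isLacunaryRep_iff]
    exact ⟨(hred h hh).removeMonomial, ((hred h hh).normalized_toPoly (h2.ne_nil h hh)).symm⟩
  · intro q hq i
    obtain ⟨h, hh, rfl⟩ := List.mem_map.mp hq
    obtain ⟨b, hb, rfl⟩ := Sparse.exists_mem_boundsOf l d i
    obtain ⟨-, -, -, h5, h6⟩ := Sparse.boundsOf_spec l d b hb
    rw [hl.card_support]
    have hlen : h.length ≤ l.length := by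
      rw [← h2.perm.length_eq]
      exact (List.sublist_flatten_of_mem hh).length_le
    refine (Sparse.degreeOf_normalized_le (hred h hh) (h2.ne_nil h hh) (h3 b hb h hh) h5 h6
      hlen).trans ?_
    gcongr
    norm_num
  · have hiff : ∀ ν : ℕ, g ^ ν ∣ Sparse.toPoly l ↔
        ∀ q ∈ S.map Sparse.toPoly, g ^ ν ∣ q := by
      intro ν
      refine ⟨fun hν q hq => ?_, fun h => ?_⟩
      · obtain ⟨h, hh, rfl⟩ := List.mem_map.mp hq
        -- For positive ν the polynomial g itself divides the input, which is what justifies the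
        -- capped bounds; ν = 0 must be separated since g need not be a divisor at all.
        rcases Nat.eq_zero_or_pos ν with rfl | hpos
        · rw [pow_zero]
          exact one_dvd _
        · exact h2.pow_dvd g (Sparse.isCovered_boundsOf hl hl0 hd
            ((dvd_pow_self g hpos.ne').trans hν) hgq hgd) ν hν h hh
      · rw [← Sparse.toPoly_perm h2.perm, Sparse.toPoly_flatten]
        exact List.dvd_sum h
    refine ⟨Sparse.emultiplicity_eq_iInf id hiff,
      Sparse.emultiplicity_eq_iInf Sparse.normalized fun ν => (hiff ν).trans ?_⟩
    refine forall₂_congr fun q hq => ?_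
    obtain ⟨h, hh, rfl⟩ := List.mem_map.mp hq
    rw [(hred h hh).normalized_toPoly (h2.ne_nil h hh)]
    conv_lhs => rw [Sparse.toPoly_eq_monomial_mul]
    exact Sparse.pow_dvd_monomial_mul_iff hg.ne_zero hgq _ ν _
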